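/- **Definitions.** A finite lattice $\mathcal L$ is *geometric* if all maximal chains from $\hat 0$ to a given element have the same length (the rank $\mathrm{rk}$), every element is a join of atoms, and $\mathrm{rk}(F\wedge G)+\mathrm{rk}(F\vee G)\le \mathrm{rk}\,F+\mathrm{rk}\,G$. An element $F$ is *modular* if equality holds for all $G$. An *embedding* of geometric lattices is an injective map that preserves finite joins (including the empty join $\hat 0$) and sends atoms to atoms. A *modular extension* of $\mathcal L$ is an embedding $\iota:\mathcal L\to\mathcal E$ with image an interval $[\hat 0,F_\iota]$ such that $F_\iota$ is modular in $\mathcal E$. A *modular diagram* of $\mathcal L$ is a triple $\Gamma=(\mathcal E,\iota,J)$ with $(\mathcal E,\iota)$ a modular extension of $\mathcal L$ and $J$ a finite word of atoms of $\mathcal E$. Its degree is $|J|-2\big(\mathrm{rk}\bigvee J-\mathrm{rk}((\bigvee J)\wedge F_\iota)\big)$ and its grading is $\mathrm{gr}(\Gamma)=\iota^{-1}\big((\bigvee J)\wedge F_\iota\big)\in\mathcal L$. For a non-trivial (at least two elements) geometric lattice $\mathcal L$, $\mathcal{MD}(\mathcal L)$ is the $\mathbb Z$-graded $\mathbb Q$-vector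 space spanned by the modular diagrams modulo: (1) $(\mathcal E,\iota,J)\sim-(\mathcal E,\iota,J')$ if $J,J'$ differ by a transposition; (2) $(\mathcal E,\iota,J)\sim(\mathcal E',\varphi\circ\iota,\varphi(J))$ for an embedding $\varphi:\mathcal E\to\mathcal E'$ with $\mathrm{rk}\,\mathcal E=\mathrm{rk}\,\mathcal E'$; (3) $(\mathcal E,\iota,J)\sim0$ if $F_\iota\vee\bigvee J<\hat1$; (4) $(\mathcal E,\iota,J)\sim 0$ if $\mathcal E\simeq\mathcal E_1\times\mathcal E_2$ with both factors non-trivial and $F_\iota\in\mathcal E_1\times\{\hat0\}$; (5) $(\mathcal E,\iota,J)\sim0$ if for some modular $G\ge F_\iota$ exactly two atoms of $J$ are not below $G$. An atom $H\in J$ is a *bridge* if it is the only atom of $J$ not below some flat $G\ge F_\iota$, and *contractible* if it is not a bridge and $H\not\le F_\iota$. If $J=H_1\cdots H_n$ has no repeated letter, then $d(\mathcal E,\iota,J)=\sum_{H_i\text{ contractible}}(-1)^{i+1}([H_i,\hat1],H_i\vee\iota,H_i\vee(J\setminus H_i))$; if $J$ has a repeated letter, the diagram is zero in $\mathcal{MD}(\mathcal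 L)$ and so is its differential. The product is $(\mathcal E_1,\iota_1,J_1)\bullet(\mathcal E_2,\iota_2,J_2)=(\mathcal E_1\cup_{\mathcal L}\mathcal E_2,\iota_{12},J_1J_2)$, where $\mathcal E_1\cup_{\mathcal L}\mathcal E_2\subset\mathcal E_1\times\mathcal E_2$ is the subposet of pairs with $\iota_1^{-1}(x_1\wedge F_{\iota_1})=\iota_2^{-1}(x_2\wedge F_{\iota_2})$, $\iota_{12}(z)=(\iota_1(z),\iota_2(z))$, and atoms $H$ of $\mathcal E_1$, $K$ of $\mathcal E_2$ are identified with $(H,\iota_2\iota_1^{-1}(H\wedge F_{\iota_1}))$ and $(\iota_1\iota_2^{-1}(K\wedge F_{\iota_2}),K)$. **Statement.** Let $\mathcal L$ be a non-trivial geometric lattice. Then $d$ and $\bullet$ are well defined on $\mathcal{MD}(\mathcal L)$, the degree defines a direct sum decomposition of $\mathcal{MD}(\mathcal L)$, $d$ has degree $+1$ and $d^2=0$. For $F\in\mathcal L$ let $\mathcal{MD}(\mathcal L,F)$ be the subspace spanned by the modular diagrams of grading $F$. Then: 1. each $\mathcal{MD}(\mathcal L,F)$ is a subcomplex (a graded subspace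 stable under $d$), and $\mathcal{MD}(\mathcal L)=\bigoplus_{F\in\mathcal L}\mathcal{MD}(\mathcal L,F)$; 2. $\mathcal{MD}(\mathcal L,F_1)\bullet\mathcal{MD}(\mathcal L,F_2)\subset\mathcal{MD}(\mathcal L,F_1\vee F_2)$ for all $F_1,F_2\in\mathcal L$; 3. for every $F\in\mathcal L$ with $F\neq\hat0$ there is an isomorphism of dg-complexes $\mathcal{MD}(\mathcal L,F)\simeq\mathcal{MD}([\hat0,F],\hat1)$, that is, a linear isomorphism that preserves degrees in both directions and commutes with the differentials. -/

import Mathlib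

universe u

set_option linter.unusedSectionVars false
set_option linter.unusedVariables false
set_option linter.style.haveILetI false

namespace GeomLat

/-! ### Geometric lattices, embeddings, modular elements -/

/-- The rank of a flat: the length of a longest chain descending from it. -/
noncomputable def rk {P : Type*} [Preorder P] (x : P) : ℕ := (Order.height x).toNat

/-- Finite geometric lattices. A maximal chain from the least element to `F` is a series of
covering relations starting at the least element and ending in `F`. -/
class IsGeometric (L : Type*) [Lattice L] [BoundedOrder L] : Prop where
  finite : Finite L
  wellRanked : ∀ s t : RelSeries {p : L × L | p.1 ⋖ p.2},
    s.head = ⊥ → t.head = ⊥ → s.last = t.last → s.length = t.length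
  atomistic : ∀ x : L, ∃ S : Set L, (∀ a ∈ S, IsAtom a) ∧ IsLUB S x
  semimodular : ∀ x y : L, rk (x ⊓ y) + rk (x ⊔ y) ≤ rk x + rk y

/-- Modular elements. -/
def IsModularElt {L : Type*} [Lattice L] (F : L) : Prop :=
  ∀ G : L, rk (F ⊓ G) + rk (F ⊔ G) = rk F + rk G

/-- Embeddings of geometric lattices: injective maps that preserve all finite joins (the empty one
included) and send atoms to atoms. Such maps are automatically strictly increasing. -/
structure IsEmb {L M : Type*} [Lattice L] [BoundedOrder L] [Lattice M] [BoundedOrder M]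
    (φ : L → M) : Prop where
  injective : Function.Injective φ
  map_bot : φ ⊥ = ⊥
  map_sup : ∀ x y, φ (x ⊔ y) = φ x ⊔ φ y
  map_atom : ∀ a, IsAtom a → IsAtom (φ a)

/-- `ι : L → E` is a modular extension: an embedding whose image is the interval below the flat
`F_ι = ι ⊤`, where `F_ι` is modular in `E`. -/
structure IsModExt {L E : Type*} [Lattice L] [BoundedOrder L] [Lattice E] [BoundedOrder E]
    (ι : L → E) : Prop where
  emb : IsEmb ι
  range_eq : Set.range ι = Set.Icc ⊥ (ι ⊤)
  modular : IsModularElt (ι ⊤)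

/-- `trace ι x = ι⁻¹ (x ∧ F_ι)`. -/
noncomputable def trace {L E : Type*} [Lattice L] [BoundedOrder L] [Lattice E]
    (ι : L → E) (x : E) : L := Function.invFun ι (x ⊓ ι ⊤)

/-! ### Basic facts on ranks -/

section Rank

variable {L : Type*} [Lattice L] [BoundedOrder L]

theorem height_ne_top [Finite L] (x : L) : Order.height x ≠ ⊤ := by
  have := Fintype.ofFinite L
  have h : Order.height x ≤ (Fintype.card L : ℕ∞) :=
    Order.height_le fun p _ => by exact_mod_cast p.length_lt_card.le
  exact ne_top_of_le_ne_top (by simp) h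

theorem coe_rk [Finite L] (x : L) : ((rk x : ℕ) : ℕ∞) = Order.height x :=
  ENat.natCast_toNat (height_ne_top x)

theorem rk_bot : rk (⊥ : L) = 0 := by simp [rk]

theorem rk_strictMono [Finite L] : StrictMono (rk : L → ℕ) := by
  intro x y h
  have := Order.height_add_one_le h
  rw [← coe_rk, ← coe_rk] at this
  have h2 : rk x + 1 ≤ rk y := by exact_mod_cast this
  omega

theorem rk_mono [Finite L] {x y : L} (h : x ≤ y) : rk x ≤ rk y := rk_strictMono.monotone h

theorem eq_of_le_of_rk [Finite L] {x y : L} (h : x ≤ y) (h2 : rk y ≤ rk x) : x = y := by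
  rcases h.lt_or_eq with h | h
  · exact absurd (rk_strictMono h) (by omega)
  · exact h

theorem rk_atom [Finite L] {a : L} (h : IsAtom a) : rk a = 1 := by
  have h1 : Order.height a ≤ (1 : ℕ) := by
    rw [Order.height_le_coe_iff]
    intro y hy
    rw [h.2 y hy]; simp
  rw [← coe_rk] at h1
  have h2 : rk a ≤ 1 := by exact_mod_cast h1
  have h3 := rk_strictMono h.bot_lt
  omega

theorem length_eq_of_rank (r : L → ℕ) (hcov : ∀ a b : L, a ⋖ b → r b = r a + 1)
    (s : RelSeries {p : L × L | p.1 ⋖ p.2}) (hs : s.head = ⊥) (h0 : r ⊥ = 0) :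
    r s.last = s.length := by
  have key : ∀ n (hn : n < s.length + 1), r (s.toFun ⟨n, hn⟩) = n := by
    intro n
    induction n with
    | zero => intro hn; exact (congrArg r hs).trans h0
    | succ k ih =>
      intro hn
      have := hcov _ _ (s.step ⟨k, by omega⟩)
      have h2 := ih (by omega)
      simp only [Fin.castSucc_mk, Fin.succ_mk] at this
      rw [this, h2]
  exact key s.length (by omega)

/-- A criterion for being geometric, which also computes the rank. -/
theorem geometric_of_rank [Finite L] (r : L → ℕ) (hr : StrictMono r) (h0 : r ⊥ = 0)
    (hsub : ∀ x y, r (x ⊓ y) + r (x ⊔ y) ≤ r x + r y)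
    (hat : ∀ x, ∃ S : Set L, (∀ a ∈ S, r a = 1) ∧ IsLUB S x) :
    IsGeometric L ∧ ∀ x, rk x = r x := by
  have hcov : ∀ a b : L, a ⋖ b → r b = r a + 1 := by
    intro a b hab
    obtain ⟨S, hS, hlub⟩ := hat b
    have : ∃ s ∈ S, ¬ s ≤ a := by
      by_contra! hcon
      exact absurd (hlub.2 hcon) (not_le_of_gt hab.lt)
    obtain ⟨s, hs, hsa⟩ := this
    have hb : a ⊔ s = b := by
      rcases hab.eq_or_eq le_sup_left (sup_le hab.le (hlub.1 hs)) with h | h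
      · exact absurd (by rw [← h]; exact le_sup_right) hsa
      · exact h
    have h1 := hsub a s
    rw [hb, hS s hs] at h1
    have := hr hab.lt
    omega
  have hrk : ∀ x, rk x = r x := by
    intro x
    apply le_antisymm
    · have := Order.height_le_height_apply_of_strictMono r hr x
      rw [Order.height_nat, ← coe_rk] at this
      exact_mod_cast this
    · induction x using WellFoundedLT.induction with
      | ind x ih =>
        rcases eq_or_ne x ⊥ with rfl | hx
        · omega
        · obtain ⟨y, hy, hyx⟩ := exists_le_covBy_of_lt (bot_lt_iff_ne_bot.mpr hx)
          have h1 := hcov _ _ hyx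
          have h2 := ih y hyx.lt
          have h3 := rk_strictMono hyx.lt
          omega
  refine ⟨⟨inferInstance, ?_, ?_, ?_⟩, hrk⟩
  · intro s t hs ht hst
    rw [← length_eq_of_rank r hcov s hs h0, ← length_eq_of_rank r hcov t ht h0, hst]
  · intro x
    obtain ⟨S, hS, hlub⟩ := hat x
    refine ⟨S, fun a ha => ⟨?_, ?_⟩, hlub⟩
    · rintro rfl
      have := hS _ ha
      omega
    · intro b hb
      by_contra hne
      have h1 := hr (bot_lt_iff_ne_bot.mpr hne)
      have h2 := hr hb
      have := hS _ ha
      omega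
  · intro x y
    simp only [hrk]
    exact hsub x y

theorem isAtom_of_rk [Finite L] {a : L} (h : rk a = 1) : IsAtom a := by
  refine ⟨?_, ?_⟩
  · rintro rfl
    rw [rk_bot] at h; omega
  · intro b hb
    by_contra hne
    have h1 := rk_strictMono (bot_lt_iff_ne_bot.mpr hne)
    have h2 := rk_strictMono hb
    omega

variable [IsGeometric L]

theorem rk_atom_sup {a x : L} (ha : IsAtom a) (hax : ¬ a ≤ x) : rk (a ⊔ x) = rk x + 1 := by
  have := IsGeometric.finite (L := L)
  have h1 := IsGeometric.semimodular a x
  have h2 : x < a ⊔ x := lt_of_le_of_ne le_sup_right (fun h => hax (by rw [h]; exact le_sup_left))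
  have h3 := rk_strictMono h2
  have h4 := rk_atom ha
  omega

/-- The modular law for elements below a modular element. -/
theorem modular_law {F : L} (hF : IsModularElt F) {A : L} (hA : A ≤ F) (B : L) :
    F ⊓ (A ⊔ B) = A ⊔ (F ⊓ B) := by
  have := IsGeometric.finite (L := L)
  symm
  apply eq_of_le_of_rk
  · exact le_inf (sup_le hA inf_le_left) (sup_le_sup_left inf_le_right A)
  · have h1 := hF (A ⊔ B)
    have h2 := hF B
    have h3 : F ⊔ (A ⊔ B) = F ⊔ B := by rw [← sup_assoc, sup_eq_left.mpr hA]
    have h4 := IsGeometric.semimodular (A ⊔ (F ⊓ B)) B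
    have h5 : A ⊔ (F ⊓ B) ⊔ B = A ⊔ B := by
      rw [sup_assoc, sup_eq_right.mpr (inf_le_right : F ⊓ B ≤ B)]
    have h6 : rk (F ⊓ B) ≤ rk ((A ⊔ (F ⊓ B)) ⊓ B) := rk_mono (le_inf le_sup_right inf_le_right)
    rw [h3] at h1
    rw [h5] at h4
    omega

/-- The modular law for elements above a given one, with a modular middle term. -/
theorem modular_law' {F : L} (hF : IsModularElt F) {A B : L} (hAB : A ≤ B) :
    B ⊓ (A ⊔ F) = A ⊔ (B ⊓ F) := by
  have := IsGeometric.finite (L := L)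
  symm
  apply eq_of_le_of_rk
  · exact le_inf (sup_le hAB inf_le_left) (sup_le_sup_left inf_le_right A)
  · have h1 := hF (B ⊓ (A ⊔ F))
    have h2 := hF (A ⊔ (B ⊓ F))
    have h3 : F ⊓ (B ⊓ (A ⊔ F)) = F ⊓ B :=
      le_antisymm (le_inf inf_le_left (inf_le_right.trans inf_le_left))
        (le_inf inf_le_left (le_inf inf_le_right (inf_le_left.trans le_sup_right)))
    have h4 : rk (F ⊓ (A ⊔ (B ⊓ F))) ≥ rk (F ⊓ B) :=
      rk_mono (le_inf inf_le_left (le_sup_of_le_right (by rw [inf_comm])))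
    have h4' : rk (F ⊓ (A ⊔ (B ⊓ F))) ≤ rk (F ⊓ B) :=
      rk_mono (le_inf inf_le_left (inf_le_right.trans (sup_le hAB inf_le_left)))
    have h5 : rk (F ⊔ (B ⊓ (A ⊔ F))) ≤ rk (F ⊔ (A ⊔ (B ⊓ F))) :=
      rk_mono (sup_le le_sup_left (inf_le_right.trans
        (sup_le (le_sup_of_le_right le_sup_left) le_sup_left)))
    rw [h3] at h1
    omega

end Rank

/-! ### Facts on modular extensions -/

section Extension

variable {L E : Type*} [Lattice L] [BoundedOrder L] [Lattice E] [BoundedOrder E]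

theorem IsEmb.le_iff {φ : L → E} (h : IsEmb φ) {x y : L} : φ x ≤ φ y ↔ x ≤ y := by
  rw [← sup_eq_right, ← h.map_sup, h.injective.eq_iff, sup_eq_right]

theorem IsModExt.map_trace {ι : L → E} (h : IsModExt ι) (x : E) : ι (trace ι x) = x ⊓ ι ⊤ := by
  have : x ⊓ ι ⊤ ∈ Set.range ι := by rw [h.range_eq]; exact ⟨bot_le, inf_le_right⟩
  exact Function.invFun_eq this

theorem IsModExt.le_trace_iff {ι : L → E} (h : IsModExt ι) {z : L} {x : E} :
    z ≤ trace ι x ↔ ι z ≤ x := by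
  rw [← h.emb.le_iff, h.map_trace, le_inf_iff, and_iff_left (h.emb.le_iff.mpr le_top)]

theorem IsModExt.trace_mono {ι : L → E} (h : IsModExt ι) {x y : E} (hxy : x ≤ y) :
    trace ι x ≤ trace ι y :=
  h.le_trace_iff.mpr ((h.le_trace_iff.mp le_rfl).trans hxy)

theorem IsModExt.trace_map {ι : L → E} (h : IsModExt ι) (z : L) : trace ι (ι z) = z :=
  h.emb.injective (by rw [h.map_trace, inf_eq_left]; exact h.emb.le_iff.mpr le_top)

theorem IsModExt.trace_inf {ι : L → E} (h : IsModExt ι) (x y : E) :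
    trace ι (x ⊓ y) = trace ι x ⊓ trace ι y :=
  le_antisymm (le_inf (h.trace_mono inf_le_left) (h.trace_mono inf_le_right))
    (h.le_trace_iff.mpr (le_inf (h.le_trace_iff.mp inf_le_left) (h.le_trace_iff.mp inf_le_right)))

theorem IsModExt.trace_bot {ι : L → E} (h : IsModExt ι) : trace ι ⊥ = ⊥ := by
  rw [← h.emb.map_bot, h.trace_map]

theorem IsModExt.trace_top {ι : L → E} (h : IsModExt ι) : trace ι ⊤ = ⊤ :=
  top_le_iff.mp (h.le_trace_iff.mpr le_top)

variable [IsGeometric E]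

theorem IsModExt.trace_sup {ι : L → E} (h : IsModExt ι) (x : E) (z : L) :
    trace ι (x ⊔ ι z) = trace ι x ⊔ z := by
  apply h.emb.injective
  rw [h.map_trace, h.emb.map_sup, h.map_trace, inf_comm, sup_comm x,
    modular_law h.modular (h.emb.le_iff.mpr le_top), sup_comm, inf_comm]

theorem IsModExt.rk_map {ι : L → E} (h : IsModExt ι) (z : L) : rk (ι z) = rk z := by
  unfold rk
  congr 1
  apply le_antisymm
  · apply Order.height_le
    intro p hp
    have hmono : StrictMono fun x : Set.Iic (ι z) => trace ι (x : E) := by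
      intro a b hab
      refine lt_of_le_of_ne (h.trace_mono hab.le) fun hne => hab.ne ?_
      have h1 := congrArg ι hne
      simp only [h.map_trace] at h1
      have hz : ι z ≤ ι ⊤ := h.emb.le_iff.mpr le_top
      rw [inf_eq_left.mpr ((show (a : E) ≤ ι z from a.2).trans hz),
        inf_eq_left.mpr ((show (b : E) ≤ ι z from b.2).trans hz)] at h1
      exact Subtype.ext h1
    have hle : ∀ i, p i ≤ ι z := fun i => by rw [← hp]; exact LTSeries.monotone p (Fin.le_last i)
    let q : LTSeries L := ⟨p.length, fun i => trace ι (p i), fun i =>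
      hmono (show (⟨p i.castSucc, hle _⟩ : Set.Iic (ι z)) < ⟨p i.succ, hle _⟩ from p.step i)⟩
    have hq : q.last = z := by
      change trace ι (p (Fin.last _)) = z
      have : p (Fin.last _) = ι z := hp
      rw [this, h.trace_map]
    rw [← hq]
    exact Order.length_le_height_last (p := q)
  · apply Order.height_le_height_apply_of_strictMono
    intro x y hxy
    exact lt_of_le_of_ne (h.emb.le_iff.mpr hxy.le) fun hne => hxy.ne (h.emb.injective hne)

theorem IsModExt.rk_trace {ι : L → E} (h : IsModExt ι) (x : E) :
    rk (trace ι x) + rk (x ⊔ ι ⊤) = rk x + rk (ι ⊤) := by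
  have := h.modular x
  rw [← h.rk_map, h.map_trace, inf_comm, sup_comm]
  omega

theorem IsModExt.trace_atom {ι : L → E} (h : IsModExt ι) [Finite L] {a : E} (ha : IsAtom a) :
    rk (trace ι a) ≤ 1 := by
  have := IsGeometric.finite (L := E)
  rw [← h.rk_map, h.map_trace, ← rk_atom ha]
  exact rk_mono inf_le_left

/-! ### Contraction -/

/-- The upper interval above a flat of a geometric lattice is geometric. -/
theorem geometric_Ici (H : E) : IsGeometric (Set.Ici H) ∧
    ∀ x : Set.Ici H, rk x = rk (x : E) - rk H := by
  have := IsGeometric.finite (L := E)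
  apply geometric_of_rank
  · intro x y hxy
    have h1 : rk (x : E) < rk (y : E) := rk_strictMono hxy
    have h2 : rk H ≤ rk (x : E) := rk_mono x.2
    change rk (x : E) - rk H < rk (y : E) - rk H
    omega
  · simp
  · intro x y
    have h1 := IsGeometric.semimodular (x : E) (y : E)
    have h2 : rk H ≤ rk (x : E) := rk_mono x.2
    have h3 : rk H ≤ rk (y : E) := rk_mono y.2
    have h4 : rk H ≤ rk ((x : E) ⊓ y) := rk_mono (le_inf x.2 y.2)
    have h5 : rk (x : E) ≤ rk ((x : E) ⊔ y) := rk_mono le_sup_left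
    change rk ((x : E) ⊓ y) - rk H + (rk ((x : E) ⊔ y) - rk H) ≤
      rk (x : E) - rk H + (rk (y : E) - rk H)
    omega
  · intro x
    obtain ⟨S, hS, hlub⟩ := IsGeometric.atomistic (x : E)
    refine ⟨{y | ∃ a ∈ S, ¬ a ≤ H ∧ (y : E) = a ⊔ H}, ?_, ?_, ?_⟩
    · rintro y ⟨a, ha, haH, hy⟩
      rw [hy, rk_atom_sup (hS a ha) haH]
      omega
    · rintro y ⟨a, ha, -, hy⟩
      change (y : E) ≤ x
      rw [hy]
      exact sup_le (hlub.1 ha) x.2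
    · intro z hz
      change (x : E) ≤ z
      apply hlub.2
      intro a ha
      by_cases haH : a ≤ H
      · exact haH.trans z.2
      · exact le_sup_left.trans (hz (a := ⟨a ⊔ H, le_sup_right⟩) ⟨a, ha, haH, rfl⟩)

instance instGeometricIci (H : E) : IsGeometric (Set.Ici H) := (geometric_Ici H).1

theorem isAtom_sup_Ici {H K : E} (hK : IsAtom K) (hKH : ¬ K ≤ H) :
    IsAtom (⟨H ⊔ K, le_sup_left⟩ : Set.Ici H) := by
  have := IsGeometric.finite (L := E)
  apply isAtom_of_rk
  rw [(geometric_Ici H).2]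
  change rk (H ⊔ K) - rk H = 1
  rw [sup_comm, rk_atom_sup hK hKH]
  omega

/-- If `H` is an atom not below `F_ι` then `H ∨ ι` is a modular extension with values in
`[H, 1]`. -/
theorem IsModExt.contract {ι : L → E} (h : IsModExt ι) {H : E} (hH : IsAtom H)
    (hHF : ¬ H ≤ ι ⊤) : IsModExt (fun z => (⟨H ⊔ ι z, le_sup_left⟩ : Set.Ici H)) := by
  have := IsGeometric.finite (L := E)
  have hdisj : H ⊓ ι ⊤ = ⊥ := by
    rcases hH.le_iff.mp (inf_le_left : H ⊓ ι ⊤ ≤ H) with h1 | h1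
    · exact h1
    · exact absurd (inf_eq_left.mp h1) hHF
  have hkey : ∀ z, ι ⊤ ⊓ (H ⊔ ι z) = ι z := by
    intro z
    rw [sup_comm, modular_law h.modular (h.emb.le_iff.mpr le_top), inf_comm, hdisj, sup_bot_eq]
  refine ⟨⟨?_, ?_, ?_, ?_⟩, ?_, ?_⟩
  · intro z w hzw
    have h1 : H ⊔ ι z = H ⊔ ι w := congrArg Subtype.val hzw
    apply h.emb.injective
    rw [← hkey z, h1, hkey w]
  · apply Subtype.ext
    change H ⊔ ι ⊥ = H
    rw [h.emb.map_bot, sup_bot_eq]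
  · intro z w
    apply Subtype.ext
    change H ⊔ ι (z ⊔ w) = (H ⊔ ι z) ⊔ (H ⊔ ι w)
    rw [h.emb.map_sup, sup_sup_sup_comm, sup_idem]
  · intro a ha
    apply isAtom_sup_Ici (h.emb.map_atom a ha)
    intro hle
    rcases hH.le_iff.mp hle with h1 | h1
    · exact (h.emb.map_atom a ha).1 h1
    · exact hHF (by rw [← h1]; exact h.emb.le_iff.mpr le_top)
  · ext x
    constructor
    · rintro ⟨z, rfl⟩
      exact ⟨bot_le, sup_le_sup_left (h.emb.le_iff.mpr le_top) H⟩
    · rintro ⟨-, hx⟩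
      have hx' : (x : E) ≤ H ⊔ ι ⊤ := hx
      refine ⟨trace ι x, Subtype.ext ?_⟩
      change H ⊔ ι (trace ι x) = x
      rw [h.map_trace, ← modular_law' h.modular x.2, inf_eq_left.mpr hx']
  · intro G
    rw [(geometric_Ici H).2, (geometric_Ici H).2, (geometric_Ici H).2, (geometric_Ici H).2]
    change rk ((H ⊔ ι ⊤) ⊓ (G : E)) - rk H + (rk (H ⊔ ι ⊤ ⊔ (G : E)) - rk H) =
      rk (H ⊔ ι ⊤) - rk H + (rk (G : E) - rk H)
    have e1 : (H ⊔ ι ⊤) ⊓ (G : E) = H ⊔ (G : E) ⊓ ι ⊤ := by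
      rw [inf_comm, modular_law' h.modular G.2]
    have e2 : H ⊔ ι ⊤ ⊔ (G : E) = ι ⊤ ⊔ (G : E) := by
      rw [sup_comm H, sup_assoc, sup_eq_right.mpr (show H ≤ (G : E) from G.2)]
    have h1 := h.modular (G : E)
    have h2 := rk_atom_sup hH hHF
    have h3 := rk_atom_sup hH (fun hle => hHF (hle.trans inf_le_right) : ¬ H ≤ (G : E) ⊓ ι ⊤)
    have h4 := rk_atom hH
    have h5 : rk H ≤ rk (G : E) := rk_mono G.2
    have h6 : rk (G : E) ≤ rk (ι ⊤ ⊔ (G : E)) := rk_mono le_sup_right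
    rw [inf_comm] at h1
    rw [e1, e2, h2, h3]
    omega

end Extension

/-! ### Pushouts -/

section Pushout

variable {L E₁ E₂ : Type*} [Lattice L] [BoundedOrder L] [Lattice E₁] [BoundedOrder E₁]
  [Lattice E₂] [BoundedOrder E₂]

/-- The pushout of two extensions of `L`: the subposet of `E₁ × E₂` of the pairs `(x₁, x₂)` with
`ι₁⁻¹ (x₁ ∧ F_ι₁) = ι₂⁻¹ (x₂ ∧ F_ι₂)`. -/
abbrev Pushout (ι₁ : L → E₁) (ι₂ : L → E₂) : Type _ :=
  {p : E₁ × E₂ // trace ι₁ p.1 = trace ι₂ p.2}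

variable {ι₁ : L → E₁} {ι₂ : L → E₂} [IsGeometric E₁] [IsGeometric E₂]

/-- The common trace on `L` of the join of two elements of the pushout. -/
noncomputable def joinTrace (p q : Pushout ι₁ ι₂) : L :=
  trace ι₁ (p.1.1 ⊔ q.1.1) ⊔ trace ι₂ (p.1.2 ⊔ q.1.2)

theorem left_le_joinTrace (p q : Pushout ι₁ ι₂) :
    trace ι₁ (p.1.1 ⊔ q.1.1) ≤ joinTrace p q := le_sup_left

theorem right_le_joinTrace (p q : Pushout ι₁ ι₂) :
    trace ι₂ (p.1.2 ⊔ q.1.2) ≤ joinTrace p q := le_sup_right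

/-- The lattice structure of the pushout, for the order induced by `E₁ × E₂`. -/
noncomputable abbrev pushoutLattice (h₁ : IsModExt ι₁) (h₂ : IsModExt ι₂) :
    Lattice (Pushout ι₁ ι₂) :=
  { (inferInstance : PartialOrder (Pushout ι₁ ι₂)) with
    inf := fun p q => ⟨p.1 ⊓ q.1, by
      rw [Prod.fst_inf, Prod.snd_inf, h₁.trace_inf, h₂.trace_inf, p.2, q.2]⟩
    sup := fun p q => ⟨(p.1.1 ⊔ q.1.1 ⊔ ι₁ (joinTrace p q), p.1.2 ⊔ q.1.2 ⊔ ι₂ (joinTrace p q)), by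
      change trace ι₁ (p.1.1 ⊔ q.1.1 ⊔ ι₁ (joinTrace p q)) =
        trace ι₂ (p.1.2 ⊔ q.1.2 ⊔ ι₂ (joinTrace p q))
      rw [h₁.trace_sup, h₂.trace_sup, sup_eq_right.mpr (left_le_joinTrace p q),
        sup_eq_right.mpr (right_le_joinTrace p q)]⟩
    inf_le_left := fun p q => (inf_le_left : p.1 ⊓ q.1 ≤ p.1)
    inf_le_right := fun p q => (inf_le_right : p.1 ⊓ q.1 ≤ q.1)
    le_inf := fun p q r hq hr => (le_inf hq hr : p.1 ≤ q.1 ⊓ r.1)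
    le_sup_left := fun p q => ⟨le_sup_left.trans le_sup_left, le_sup_left.trans le_sup_left⟩
    le_sup_right := fun p q => ⟨le_sup_right.trans le_sup_left, le_sup_right.trans le_sup_left⟩
    sup_le := fun p q r hp hq => by
      have a1 : p.1.1 ⊔ q.1.1 ≤ r.1.1 := sup_le hp.1 hq.1
      have a2 : p.1.2 ⊔ q.1.2 ≤ r.1.2 := sup_le hp.2 hq.2
      have hx : joinTrace p q ≤ trace ι₁ r.1.1 :=
        sup_le (h₁.trace_mono a1) ((h₂.trace_mono a2).trans r.2.ge)
      exact ⟨sup_le a1 (h₁.le_trace_iff.mp hx), sup_le a2 (h₂.le_trace_iff.mp (hx.trans r.2.le))⟩ }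

/-- The least and greatest elements of the pushout. -/
abbrev pushoutBounded (h₁ : IsModExt ι₁) (h₂ : IsModExt ι₂) :
    letI := pushoutLattice h₁ h₂
    BoundedOrder (Pushout ι₁ ι₂) :=
  letI := pushoutLattice h₁ h₂
  { top := ⟨⊤, by rw [Prod.fst_top, Prod.snd_top, h₁.trace_top, h₂.trace_top]⟩
    bot := ⟨⊥, by rw [Prod.fst_bot, Prod.snd_bot, h₁.trace_bot, h₂.trace_bot]⟩
    le_top := fun p => (le_top : p.1 ≤ ⊤)
    bot_le := fun p => (bot_le : ⊥ ≤ p.1) }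

/-- The rank of `x` relative to the modular flat of the extension. -/
noncomputable def relRk {L E : Type*} [Lattice L] [BoundedOrder L] [Lattice E] [BoundedOrder E]
    (ι : L → E) (x : E) : ℕ := rk (x ⊔ ι ⊤) - rk (ι ⊤)

theorem IsModExt.relRk_add {L E : Type*} [Lattice L] [BoundedOrder L] [Lattice E] [BoundedOrder E]
    [IsGeometric E] {ι : L → E} (h : IsModExt ι) (x : E) :
    relRk ι x + rk (trace ι x) = rk x := by
  have := IsGeometric.finite (L := E)
  have h1 := h.rk_trace x
  have h2 : rk (ι ⊤) ≤ rk (x ⊔ ι ⊤) := rk_mono le_sup_right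
  unfold relRk
  omega

theorem IsModExt.relRk_mono {L E : Type*} [Lattice L] [BoundedOrder L] [Lattice E] [BoundedOrder E]
    [IsGeometric E] {ι : L → E} {x y : E} (hxy : x ≤ y) : relRk ι x ≤ relRk ι y := by
  have := IsGeometric.finite (L := E)
  exact Nat.sub_le_sub_right (rk_mono (sup_le_sup_right hxy _)) _

theorem IsModExt.relRk_sup {L E : Type*} [Lattice L] [BoundedOrder L] [Lattice E] [BoundedOrder E]
    [IsGeometric E] {ι : L → E} (h : IsModExt ι) (x : E) (z : L) :
    relRk ι (x ⊔ ι z) = relRk ι x := by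
  unfold relRk
  rw [sup_assoc, sup_eq_right.mpr (h.emb.le_iff.mpr le_top : ι z ≤ ι ⊤)]

theorem IsModExt.relRk_semi {L E : Type*} [Lattice L] [BoundedOrder L] [Lattice E] [BoundedOrder E]
    [IsGeometric E] {ι : L → E} (h : IsModExt ι) (a b : E) :
    relRk ι (a ⊔ b) + relRk ι (a ⊓ b) + rk (trace ι (a ⊔ b)) ≤
      relRk ι a + relRk ι b + rk (trace ι a ⊔ trace ι b) := by
  have hA := h.relRk_add (a ⊔ ι (trace ι b))
  have hB := h.relRk_add (b ⊔ ι (trace ι a))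
  rw [h.relRk_sup, h.trace_sup] at hA hB
  have hs := IsGeometric.semimodular (a ⊔ ι (trace ι b)) (b ⊔ ι (trace ι a))
  have e : a ⊔ ι (trace ι b) ⊔ (b ⊔ ι (trace ι a)) = a ⊔ b := by
    rw [sup_sup_sup_comm, sup_eq_left]
    exact sup_le ((h.le_trace_iff.mp le_rfl).trans le_sup_right)
      ((h.le_trace_iff.mp le_rfl).trans le_sup_left)
  rw [e] at hs
  have hI := h.relRk_add ((a ⊔ ι (trace ι b)) ⊓ (b ⊔ ι (trace ι a)))
  rw [h.trace_inf, h.trace_sup, h.trace_sup, sup_comm (trace ι b), inf_idem] at hI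
  have hm : relRk ι (a ⊓ b) ≤ relRk ι ((a ⊔ ι (trace ι b)) ⊓ (b ⊔ ι (trace ι a))) :=
    IsModExt.relRk_mono (inf_le_inf le_sup_left le_sup_left)
  have hJ := h.relRk_add (a ⊔ b)
  rw [sup_comm (trace ι b)] at hB
  omega

/-- The canonical embedding of the left factor in the pushout. -/
noncomputable def pushoutInl (h₁ : IsModExt ι₁) (h₂ : IsModExt ι₂) (x : E₁) : Pushout ι₁ ι₂ :=
  ⟨(x, ι₂ (trace ι₁ x)), (h₂.trace_map _).symm⟩

/-- The canonical embedding of the right factor in the pushout. -/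
noncomputable def pushoutInr (h₁ : IsModExt ι₁) (h₂ : IsModExt ι₂) (x : E₂) : Pushout ι₁ ι₂ :=
  ⟨(ι₁ (trace ι₂ x), x), h₁.trace_map _⟩

/-- The embedding `z ↦ (ι₁ z, ι₂ z)` of `L` in the pushout. -/
def pushoutMap (h₁ : IsModExt ι₁) (h₂ : IsModExt ι₂) (z : L) : Pushout ι₁ ι₂ :=
  ⟨(ι₁ z, ι₂ z), (h₁.trace_map z).trans (h₂.trace_map z).symm⟩

/-- The rank function of the pushout. -/
noncomputable def pushoutRk (p : Pushout ι₁ ι₂) : ℕ :=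
  relRk ι₁ p.1.1 + relRk ι₂ p.1.2 + rk (trace ι₁ p.1.1)

theorem pushoutRk_inl (h₁ : IsModExt ι₁) (h₂ : IsModExt ι₂) (x : E₁) :
    pushoutRk (pushoutInl h₁ h₂ x) = rk x := by
  have h : relRk ι₂ (ι₂ (trace ι₁ x)) = 0 := by
    have := h₂.relRk_add (ι₂ (trace ι₁ x))
    rw [h₂.trace_map, h₂.rk_map] at this
    omega
  have := h₁.relRk_add x
  simp only [pushoutRk, pushoutInl, h]
  omega

theorem pushoutRk_inr (h₁ : IsModExt ι₁) (h₂ : IsModExt ι₂) (x : E₂) :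
    pushoutRk (pushoutInr h₁ h₂ x) = rk x := by
  have h : relRk ι₁ (ι₁ (trace ι₂ x)) = 0 := by
    have := h₁.relRk_add (ι₁ (trace ι₂ x))
    rw [h₁.trace_map, h₁.rk_map] at this
    omega
  have := h₂.relRk_add x
  simp only [pushoutRk, pushoutInr, h, h₁.trace_map]
  omega

/-- The pushout of two modular extensions is a geometric lattice. -/
theorem pushout_geometric [IsGeometric L] (h₁ : IsModExt ι₁) (h₂ : IsModExt ι₂) :
    letI := pushoutLattice h₁ h₂
    letI := pushoutBounded h₁ h₂
    IsGeometric (Pushout ι₁ ι₂) ∧ ∀ p : Pushout ι₁ ι₂, rk p = pushoutRk p := by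
  letI := pushoutLattice h₁ h₂
  letI := pushoutBounded h₁ h₂
  have := IsGeometric.finite (L := E₁)
  have := IsGeometric.finite (L := E₂)
  have := IsGeometric.finite (L := L)
  apply geometric_of_rank
  · intro p q hpq
    have hle : p.1 ≤ q.1 := hpq.le
    by_contra! hcon
    have m1 := IsModExt.relRk_mono (ι := ι₁) hle.1
    have m2 := IsModExt.relRk_mono (ι := ι₂) hle.2
    have m3 := rk_mono (h₁.trace_mono hle.1)
    simp only [pushoutRk] at hcon
    have a1 := h₁.relRk_add p.1.1
    have a2 := h₁.relRk_add q.1.1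
    have b1 := h₂.relRk_add p.1.2
    have b2 := h₂.relRk_add q.1.2
    rw [← p.2] at b1
    rw [← q.2] at b2
    have e1 : p.1.1 = q.1.1 := eq_of_le_of_rk hle.1 (by omega)
    have e2 : p.1.2 = q.1.2 := eq_of_le_of_rk hle.2 (by omega)
    exact hpq.ne (Subtype.ext (Prod.ext e1 e2))
  · have h : relRk ι₁ ⊥ = 0 := by simp [relRk]
    have h' : relRk ι₂ ⊥ = 0 := by simp [relRk]
    change relRk ι₁ ⊥ + relRk ι₂ ⊥ + rk (trace ι₁ ⊥) = 0
    rw [h, h', h₁.trace_bot, rk_bot]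
  · intro p q
    have s1 := h₁.relRk_semi p.1.1 q.1.1
    have s2 := h₂.relRk_semi p.1.2 q.1.2
    have hi : pushoutRk (p ⊓ q) = relRk ι₁ (p.1.1 ⊓ q.1.1) + relRk ι₂ (p.1.2 ⊓ q.1.2) +
      rk (trace ι₁ (p.1.1 ⊓ q.1.1)) := rfl
    have hj : pushoutRk (p ⊔ q) = relRk ι₁ (p.1.1 ⊔ q.1.1 ⊔ ι₁ (joinTrace p q)) +
      relRk ι₂ (p.1.2 ⊔ q.1.2 ⊔ ι₂ (joinTrace p q)) +
      rk (trace ι₁ (p.1.1 ⊔ q.1.1 ⊔ ι₁ (joinTrace p q))) := rfl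
    rw [h₁.relRk_sup, h₂.relRk_sup, h₁.trace_sup,
      sup_eq_right.mpr (left_le_joinTrace p q)] at hj
    rw [h₁.trace_inf] at hi
    have hu := IsGeometric.semimodular (trace ι₁ (p.1.1 ⊔ q.1.1)) (trace ι₂ (p.1.2 ⊔ q.1.2))
    have hz := IsGeometric.semimodular (trace ι₁ p.1.1) (trace ι₁ q.1.1)
    have hm : rk (trace ι₁ p.1.1 ⊔ trace ι₁ q.1.1) ≤
        rk (trace ι₁ (p.1.1 ⊔ q.1.1) ⊓ trace ι₂ (p.1.2 ⊔ q.1.2)) := by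
      refine rk_mono (le_inf (sup_le (h₁.trace_mono le_sup_left) (h₁.trace_mono le_sup_right)) ?_)
      rw [p.2, q.2]
      exact sup_le (h₂.trace_mono le_sup_left) (h₂.trace_mono le_sup_right)
    rw [← p.2, ← q.2] at s2
    have hx : rk (joinTrace p q) =
      rk (trace ι₁ (p.1.1 ⊔ q.1.1) ⊔ trace ι₂ (p.1.2 ⊔ q.1.2)) := rfl
    have hp : pushoutRk p = relRk ι₁ p.1.1 + relRk ι₂ p.1.2 + rk (trace ι₁ p.1.1) := rfl
    have hq : pushoutRk q = relRk ι₁ q.1.1 + relRk ι₂ q.1.2 + rk (trace ι₁ q.1.1) := rfl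
    rw [hx] at hj
    omega
  · intro p
    obtain ⟨S, hS, hSlub⟩ := IsGeometric.atomistic p.1.1
    obtain ⟨T, hT, hTlub⟩ := IsGeometric.atomistic p.1.2
    refine ⟨pushoutInl h₁ h₂ '' S ∪ pushoutInr h₁ h₂ '' T, ?_, ?_, ?_⟩
    · rintro _ (⟨a, ha, rfl⟩ | ⟨a, ha, rfl⟩)
      · rw [pushoutRk_inl, rk_atom (hS a ha)]
      · rw [pushoutRk_inr, rk_atom (hT a ha)]
    · rintro _ (⟨a, ha, rfl⟩ | ⟨a, ha, rfl⟩)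
      · exact ⟨hSlub.1 ha, h₂.le_trace_iff.mp ((h₁.trace_mono (hSlub.1 ha)).trans p.2.le)⟩
      · exact ⟨h₁.le_trace_iff.mp ((h₂.trace_mono (hTlub.1 ha)).trans p.2.ge), hTlub.1 ha⟩
    · intro q hq
      refine ⟨hSlub.2 fun a ha => ?_, hTlub.2 fun a ha => ?_⟩
      · exact (hq (Or.inl ⟨a, ha, rfl⟩) : pushoutInl h₁ h₂ a ≤ q).1
      · exact (hq (Or.inr ⟨a, ha, rfl⟩) : pushoutInr h₁ h₂ a ≤ q).2

theorem pushoutInl_atom [IsGeometric L] (h₁ : IsModExt ι₁) (h₂ : IsModExt ι₂) {a : E₁}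
    (ha : IsAtom a) :
    letI := pushoutLattice h₁ h₂
    letI := pushoutBounded h₁ h₂
    IsAtom (pushoutInl h₁ h₂ a) := by
  letI := pushoutLattice h₁ h₂
  letI := pushoutBounded h₁ h₂
  have := IsGeometric.finite (L := E₁)
  have := (pushout_geometric h₁ h₂).1.finite
  apply isAtom_of_rk
  rw [(pushout_geometric h₁ h₂).2, pushoutRk_inl, rk_atom ha]

theorem pushoutInr_atom [IsGeometric L] (h₁ : IsModExt ι₁) (h₂ : IsModExt ι₂) {a : E₂}
    (ha : IsAtom a) :
    letI := pushoutLattice h₁ h₂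
    letI := pushoutBounded h₁ h₂
    IsAtom (pushoutInr h₁ h₂ a) := by
  letI := pushoutLattice h₁ h₂
  letI := pushoutBounded h₁ h₂
  have := IsGeometric.finite (L := E₂)
  have := (pushout_geometric h₁ h₂).1.finite
  apply isAtom_of_rk
  rw [(pushout_geometric h₁ h₂).2, pushoutRk_inr, rk_atom ha]

/-- The map from `L` to the pushout is a modular extension. -/
theorem pushout_modExt [IsGeometric L] (h₁ : IsModExt ι₁) (h₂ : IsModExt ι₂) :
    letI := pushoutLattice h₁ h₂
    letI := pushoutBounded h₁ h₂
    IsModExt (pushoutMap h₁ h₂) := by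
  letI := pushoutLattice h₁ h₂
  letI := pushoutBounded h₁ h₂
  have hrk := (pushout_geometric h₁ h₂).2
  have := IsGeometric.finite (L := E₁)
  have := IsGeometric.finite (L := E₂)
  have hmem : ∀ p : Pushout ι₁ ι₂, p ⊓ pushoutMap h₁ h₂ ⊤ = pushoutMap h₁ h₂ (trace ι₁ p.1.1) := by
    intro p
    apply Subtype.ext
    apply Prod.ext
    · exact (h₁.map_trace _).symm
    · change p.1.2 ⊓ ι₂ ⊤ = ι₂ (trace ι₁ p.1.1)
      rw [p.2, h₂.map_trace]
  have hr : ∀ z, pushoutRk (pushoutMap h₁ h₂ z) = rk z := by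
    intro z
    have : pushoutMap h₁ h₂ z = pushoutInl h₁ h₂ (ι₁ z) := by
      apply Subtype.ext
      apply Prod.ext
      · rfl
      · change ι₂ z = ι₂ (trace ι₁ (ι₁ z))
        rw [h₁.trace_map]
    rw [this, pushoutRk_inl, h₁.rk_map]
  have hmono : ∀ {z w : L}, z ≤ w → pushoutMap h₁ h₂ z ≤ pushoutMap h₁ h₂ w := fun hzw =>
    ⟨h₁.emb.le_iff.mpr hzw, h₂.emb.le_iff.mpr hzw⟩
  refine ⟨⟨?_, ?_, ?_, ?_⟩, ?_, ?_⟩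
  · intro z w hzw
    exact h₁.emb.injective (congrArg (fun p : Pushout ι₁ ι₂ => p.1.1) hzw)
  · exact Subtype.ext (Prod.ext h₁.emb.map_bot h₂.emb.map_bot)
  · intro z w
    apply le_antisymm
    · refine ⟨?_, ?_⟩
      · change ι₁ (z ⊔ w) ≤ ι₁ z ⊔ ι₁ w ⊔ _
        rw [h₁.emb.map_sup]
        exact le_sup_left
      · change ι₂ (z ⊔ w) ≤ ι₂ z ⊔ ι₂ w ⊔ _
        rw [h₂.emb.map_sup]
        exact le_sup_left
    · exact sup_le (hmono le_sup_left) (hmono le_sup_right)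
  · intro a ha
    have := (pushout_geometric h₁ h₂).1.finite
    have := IsGeometric.finite (L := L)
    apply isAtom_of_rk
    rw [hrk, hr, rk_atom ha]
  · ext p
    constructor
    · rintro ⟨z, rfl⟩
      exact ⟨bot_le, hmono le_top⟩
    · rintro ⟨-, hp⟩
      exact ⟨trace ι₁ p.1.1, by rw [← hmem, inf_eq_left.mpr hp]⟩
  · intro p
    have hs : pushoutMap h₁ h₂ ⊤ ⊔ p =
        ⟨(p.1.1 ⊔ ι₁ ⊤, p.1.2 ⊔ ι₂ ⊤), by
          change trace ι₁ (p.1.1 ⊔ ι₁ ⊤) = trace ι₂ (p.1.2 ⊔ ι₂ ⊤)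
          rw [h₁.trace_sup, h₂.trace_sup, sup_top_eq, sup_top_eq]⟩ := by
      apply le_antisymm
      · exact sup_le ⟨le_sup_right, le_sup_right⟩ ⟨le_sup_left, le_sup_left⟩
      · exact ⟨sup_le (le_sup_right : p ≤ pushoutMap h₁ h₂ ⊤ ⊔ p).1
            (le_sup_left : pushoutMap h₁ h₂ ⊤ ≤ pushoutMap h₁ h₂ ⊤ ⊔ p).1,
          sup_le (le_sup_right : p ≤ pushoutMap h₁ h₂ ⊤ ⊔ p).2
            (le_sup_left : pushoutMap h₁ h₂ ⊤ ≤ pushoutMap h₁ h₂ ⊤ ⊔ p).2⟩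
    rw [inf_comm, hmem, hs, hrk, hrk, hrk, hrk, hr, hr]
    simp only [pushoutRk, h₁.relRk_sup, h₂.relRk_sup, h₁.trace_sup, sup_top_eq]
    omega

end Pushout

/-! ### Modular diagrams -/

/-- A modular diagram of `L`: a modular extension `ι : L → E` with a linearly ordered multiset,
that is a finite word, of atoms of `E`. -/
structure ModularDiagram (L : Type u) [Lattice L] [BoundedOrder L] : Type (u + 1) where
  E : Type u
  [lattice : Lattice E]
  [bounded : BoundedOrder E]
  [geometric : IsGeometric E]
  ι : L → E
  ext : IsModExt ι
  J : List E
  atoms : ∀ H ∈ J, IsAtom H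

attribute [instance] ModularDiagram.lattice ModularDiagram.bounded ModularDiagram.geometric

namespace ModularDiagram

variable {L : Type u} [Lattice L] [BoundedOrder L]

/-- The modular flat `F_ι`. -/
def flat (Γ : ModularDiagram L) : Γ.E := Γ.ι ⊤

/-- The join of all the atoms of the diagram. -/
def join (Γ : ModularDiagram L) : Γ.E := (Γ.J : Multiset Γ.E).sup

/-- The degree `|J| - 2 (rk (⋁ J) - rk ((⋁ J) ∧ F_ι))`. -/
noncomputable def deg (Γ : ModularDiagram L) : ℤ :=
  (Γ.J.length : ℤ) - 2 * ((rk Γ.join : ℤ) - (rk (Γ.join ⊓ Γ.flat) : ℤ))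

/-- The `L`-grading `ι⁻¹ ((⋁ J) ∧ F_ι)`. -/
noncomputable def gr (Γ : ModularDiagram L) : L := trace Γ.ι Γ.join

/-- The same modular extension with another word of atoms. -/
def withWord (Γ : ModularDiagram L) (J' : List Γ.E) (h : ∀ H ∈ J', IsAtom H) :
    ModularDiagram L where
  E := Γ.E
  ι := Γ.ι
  ext := Γ.ext
  J := J'
  atoms := h

/-- `H` is a bridge if it is the only atom of `J` not below some flat `G ≥ F_ι`. -/
def IsBridge (Γ : ModularDiagram L) (H : Γ.E) : Prop :=
  H ∈ Γ.J ∧ ∃ G : Γ.E, Γ.flat ≤ G ∧ ¬ H ≤ G ∧ ∀ K ∈ Γ.J, K ≠ H → K ≤ G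

/-- The contractible atoms of `J`. -/
def IsContractible (Γ : ModularDiagram L) (H : Γ.E) : Prop :=
  H ∈ Γ.J ∧ ¬ Γ.IsBridge H ∧ ¬ H ≤ Γ.flat

theorem get_not_mem_eraseIdx {α : Type*} {J : List α} (hJ : J.Nodup) (i : Fin J.length) :
    J.get i ∉ J.eraseIdx i := by
  intro h
  rw [List.mem_eraseIdx_iff_getElem] at h
  obtain ⟨j, hj, hne, hij⟩ := h
  exact hne ((hJ.getElem_inj_iff).mp hij)

/-- The contraction `([H, 1], H ∨ ι, H ∨ (J \ H))` of a diagram without repeated atoms at its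
`i`-th atom `H`, which is not below `F_ι`. -/
def contract (Γ : ModularDiagram L) (hJ : Γ.J.Nodup) (i : Fin Γ.J.length)
    (hi : ¬ Γ.J.get i ≤ Γ.flat) : ModularDiagram L where
  E := Set.Ici (Γ.J.get i)
  ι := fun z => ⟨Γ.J.get i ⊔ Γ.ι z, le_sup_left⟩
  ext := Γ.ext.contract (Γ.atoms _ (List.get_mem _ _)) hi
  J := (Γ.J.eraseIdx i).map fun K => ⟨Γ.J.get i ⊔ K, le_sup_left⟩
  atoms := by
    intro K' hK'
    obtain ⟨K, hK, rfl⟩ := List.mem_map.mp hK'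
    have hKa : IsAtom K := Γ.atoms K (List.mem_of_mem_eraseIdx hK)
    refine isAtom_sup_Ici hKa fun hle => ?_
    rcases (Γ.atoms _ (List.get_mem Γ.J i)).le_iff.mp hle with h | h
    · exact hKa.1 h
    · exact get_not_mem_eraseIdx hJ i (h ▸ hK)

/-- The product of two diagrams: the pushout of the two extensions, with the concatenation of
the two words. -/
noncomputable def mul [IsGeometric L] (Γ₁ Γ₂ : ModularDiagram L) : ModularDiagram L where
  E := Pushout Γ₁.ι Γ₂.ι
  lattice := pushoutLattice Γ₁.ext Γ₂.ext
  bounded := pushoutBounded Γ₁.ext Γ₂.ext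
  geometric := (pushout_geometric Γ₁.ext Γ₂.ext).1
  ι := pushoutMap Γ₁.ext Γ₂.ext
  ext := pushout_modExt Γ₁.ext Γ₂.ext
  J := Γ₁.J.map (pushoutInl Γ₁.ext Γ₂.ext) ++ Γ₂.J.map (pushoutInr Γ₁.ext Γ₂.ext)
  atoms := by
    intro H hH
    rcases List.mem_append.mp hH with h | h
    · obtain ⟨a, ha, rfl⟩ := List.mem_map.mp h
      exact pushoutInl_atom _ _ (Γ₁.atoms a ha)
    · obtain ⟨a, ha, rfl⟩ := List.mem_map.mp h
      exact pushoutInr_atom _ _ (Γ₂.atoms a ha)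

/-- The relations between modular diagrams, as elements of the free vector space on them.
* `swap`: exchanging two neighbouring letters of the word changes the sign (every transposition is
  a product of an odd number of such exchanges);
* `emb`: diagrams related by an embedding between extensions of the same rank are equal;
* `low`: diagrams with `F_ι ∨ ⋁ J < 1` vanish;
* `prod`: diagrams whose lattice is a product of two nontrivial factors, the first of which
  contains `F_ι`, vanish;
* `two`: diagrams for which exactly two atoms of `J` are not below some modular flat `G ≥ F_ι`
  vanish. -/
inductive Rel : (ModularDiagram L →₀ ℚ) → Prop
  | swap (Γ : ModularDiagram L) (l₁ l₂ : List Γ.E) (a b : Γ.E)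
      (h : Γ.J = l₁ ++ a :: b :: l₂) (h' : ∀ H ∈ l₁ ++ b :: a :: l₂, IsAtom H) :
      Rel (Finsupp.single Γ 1 + Finsupp.single (Γ.withWord (l₁ ++ b :: a :: l₂) h') 1)
  | emb (Γ Γ' : ModularDiagram L) (φ : Γ.E → Γ'.E) (hφ : IsEmb φ)
      (hrk : rk (⊤ : Γ.E) = rk (⊤ : Γ'.E)) (hι : ∀ z, Γ'.ι z = φ (Γ.ι z))
      (hJ : Γ'.J = Γ.J.map φ) :
      Rel (Finsupp.single Γ 1 - Finsupp.single Γ' 1)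
  | low (Γ : ModularDiagram L) (h : Γ.flat ⊔ Γ.join < ⊤) : Rel (Finsupp.single Γ 1)
  | prod (Γ : ModularDiagram L) (A B : Type u) [Lattice A] [BoundedOrder A] [IsGeometric A]
      [Nontrivial A] [Lattice B] [BoundedOrder B] [IsGeometric B] [Nontrivial B]
      (e : Γ.E ≃o A × B) (h : (e Γ.flat).2 = ⊥) : Rel (Finsupp.single Γ 1)
  | two (Γ : ModularDiagram L) (G : Γ.E) (hG : IsModularElt G) (hFG : Γ.flat ≤ G)
      (hcard : {H | H ∈ Γ.J ∧ ¬ H ≤ G}.ncard = 2) : Rel (Finsupp.single Γ 1)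

end ModularDiagram

/-! ### The space of modular diagrams -/

/-- The rational vector space spanned by the modular diagrams, modulo the relations. -/
abbrev MD (L : Type u) [Lattice L] [BoundedOrder L] : Type (u + 1) :=
  (ModularDiagram L →₀ ℚ) ⧸ Submodule.span ℚ {x | ModularDiagram.Rel (L := L) x}

section MD

variable {L : Type u} [Lattice L] [BoundedOrder L]

/-- The class of a modular diagram. -/
noncomputable def ModularDiagram.cls (Γ : ModularDiagram L) : MD L :=
  Submodule.Quotient.mk (Finsupp.single Γ 1)

open Classical in
/-- The alternating sum of the contractions of a diagram at its contractible atoms. The positions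
are counted from `0`, hence the sign `(-1) ^ i`. A diagram with a repeated atom is zero in `MD L`,
and so is its differential. -/
noncomputable def ModularDiagram.dCls (Γ : ModularDiagram L) : MD L :=
  if hJ : Γ.J.Nodup then
    ∑ i : Fin Γ.J.length,
      if hi : Γ.IsContractible (Γ.J.get i) then
        (-1 : ℚ) ^ (i : ℕ) • (Γ.contract hJ i hi.2.2).cls
      else 0
  else 0

/-- `d` is the differential of `MD L`: it has the prescribed value on each diagram. -/
def IsDifferential (d : MD L →ₗ[ℚ] MD L) : Prop :=
  ∀ Γ : ModularDiagram L, d Γ.cls = Γ.dCls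

/-- `m` is the product of `MD L`: it has the prescribed value on each pair of diagrams. -/
def IsProduct [IsGeometric L] (m : MD L →ₗ[ℚ] MD L →ₗ[ℚ] MD L) : Prop :=
  ∀ Γ₁ Γ₂ : ModularDiagram L, m Γ₁.cls Γ₂.cls = (Γ₁.mul Γ₂).cls

variable (L) in
/-- The part of degree `k` of `MD L`. -/
noncomputable def degPart (k : ℤ) : Submodule ℚ (MD L) :=
  Submodule.span ℚ {x | ∃ Γ : ModularDiagram L, Γ.deg = k ∧ x = Γ.cls}

/-- The subspace `MD(L, F)` spanned by the diagrams of grading `F`. -/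
noncomputable def grPart (F : L) : Submodule ℚ (MD L) :=
  Submodule.span ℚ {x | ∃ Γ : ModularDiagram L, Γ.gr = F ∧ x = Γ.cls}

/-- `S` is a subcomplex: a graded subspace that is stable under `d`. -/
def IsSubcomplex (d : MD L →ₗ[ℚ] MD L) (S : Submodule ℚ (MD L)) : Prop :=
  (S = ⨆ k : ℤ, S ⊓ degPart L k) ∧ ∀ x ∈ S, d x ∈ S

theorem MD_hom_ext {M : Type*} [AddCommGroup M] [Module ℚ M] {f g : MD L →ₗ[ℚ] M}
    (h : ∀ Γ : ModularDiagram L, f Γ.cls = g Γ.cls) : f = g := by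
  apply Submodule.linearMap_qext
  apply Finsupp.lhom_ext'
  intro Γ
  apply LinearMap.ext_ring
  exact h Γ

/-- There is at most one differential. -/
theorem IsDifferential.unique {d d' : MD L →ₗ[ℚ] MD L} (h : IsDifferential d)
    (h' : IsDifferential d') : d = d' :=
  MD_hom_ext fun Γ => (h Γ).trans (h' Γ).symm

/-- There is at most one product. -/
theorem IsProduct.unique [IsGeometric L] {m m' : MD L →ₗ[ℚ] MD L →ₗ[ℚ] MD L} (h : IsProduct m)
    (h' : IsProduct m') : m = m' :=
  MD_hom_ext fun Γ₁ => MD_hom_ext fun Γ₂ => (h Γ₁ Γ₂).trans (h' Γ₁ Γ₂).symm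

end MD

end GeomLat

/-! Every map on `MD L` is obtained by giving its values on diagrams and checking the five relations
(`RespectsRel`). The relations `low`, `prod` and `two` each kill a single diagram, so a function on
diagrams grades `MD L` as soon as it is invariant under permutations of the word and under
embeddings of equal rank. This applies to the degree and to the `L`-grading; for the latter, the
point is that an embedding preserves meets with the modular flat although it need not preserve other
meets.

The differential is an alternating sum over the removal of one letter. The decisive relation is
`two`: if only `a` and `b` are not below the modular flat `G`, the contractions at the other letters
are again killed by `two`, while those at `a` and `b` have opposite signs and equal classes
(`con_two_comm`). Indeed, if `a ∨ G = 1`, then joining with `a` embeds `[0, G]` in `[a, 1]` with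
equal rank and identifies `b` with the letter `(a ∨ b) ∧ G`, which is symmetric in `a` and `b`; if
`a ∨ G < 1`, everything is zero by `low`. The equation `d² = 0` holds because contracting at two
letters in either order gives the same diagram on the interval above `a ∨ b`, with opposite signs.

For the product, one factor is fixed and only the other needs to be a modular extension of the
common lower interval. The resulting amalgam `Amalg` is functorial, compatible with products and
with modular flats above `F_ι`, so amalgamation respects the relations (`respectsRel_push`). The
product is such an amalgam in each variable.

The same amalgams give the isomorphism of `MD(L, F)` with `MD([0, F], 1)`. In one direction a
diagram is restricted to `[0, ⋁ J]`; in the other, a diagram of `[0, F]` is amalgamated with `L`.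
One composite is undone by the embedding `Amalg.inr`, the other by the embedding `ofRestrict` of the
amalgam of a restriction into the original lattice. Restriction commutes with contraction, since
both orders lead to the interval `[a, ⋁ J]`. -/

namespace GeomLat

/-! ### Alternating sums over the letters of a word -/

section AltSum

variable {α β V W : Type*} [AddCommGroup V] [Module ℚ V] [AddCommGroup W] [Module ℚ W]

/-- The sum of `(-1) ^ i • f a l` over the ways to remove the `i`-th letter `a` of a word, where
`l` is the remaining word. -/
def altSum (f : α → List α → V) : List α → V
  | [] => 0
  | a :: l => f a l - altSum (fun b l' => f b (a :: l')) l

/-- Every term of the sum comes from a word `a :: l` that rearranges `J`. Properties of `J` that do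
not depend on the order, such as its join, its atoms or the absence of repetitions, are therefore
available in each term. -/
theorem altSum_congr {f g : α → List α → V} {J : List α}
    (h : ∀ a l, (a :: l).Perm J → f a l = g a l) : altSum f J = altSum g J := by
  induction J generalizing f g with
  | nil => rfl
  | cons a J ih =>
    simp only [altSum]
    rw [h a J (List.Perm.refl _), ih fun b l hl => h b (a :: l)
      ((List.Perm.swap a b l).trans (hl.cons a))]

theorem altSum_zero (J : List α) : altSum (fun (_ : α) _ => (0 : V)) J = 0 := by
  induction J with
  | nil => rfl
  | cons a J ih => simp [altSum, ih]

theorem altSum_eq_zero {f : α → List α → V} {J : List α}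
    (h : ∀ a l, (a :: l).Perm J → f a l = 0) : altSum f J = 0 :=
  (altSum_congr h).trans (altSum_zero J)

theorem altSum_neg (f : α → List α → V) (J : List α) :
    altSum (fun a l => -f a l) J = -altSum f J := by
  induction J generalizing f with
  | nil => simp [altSum]
  | cons a J ih => simp only [altSum, ih]; abel

theorem altSum_sub (f g : α → List α → V) (J : List α) :
    altSum (fun a l => f a l - g a l) J = altSum f J - altSum g J := by
  induction J generalizing f g with
  | nil => simp [altSum]
  | cons a J ih => simp only [altSum, ih]; abel

theorem map_altSum (d : V →ₗ[ℚ] W) (f : α → List α → V) (J : List α) :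
    d (altSum f J) = altSum (fun a l => d (f a l)) J := by
  induction J generalizing f with
  | nil => simp [altSum]
  | cons a J ih => simp only [altSum, map_sub, ih]

theorem altSum_map (φ : β → α) (f : α → List α → V) (J : List β) :
    altSum f (J.map φ) = altSum (fun a l => f (φ a) (l.map φ)) J := by
  induction J generalizing f with
  | nil => rfl
  | cons a J ih => simp only [List.map_cons, altSum, ih]

theorem altSum_mem (S : Submodule ℚ V) {f : α → List α → V} {J : List α}
    (h : ∀ a l, (a :: l).Perm J → f a l ∈ S) : altSum f J ∈ S := by
  induction J generalizing f with
  | nil => exact S.zero_mem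
  | cons a J ih =>
    exact S.sub_mem (h a J (List.Perm.refl _)) (ih fun b l hl => h b (a :: l)
      ((List.Perm.swap a b l).trans (hl.cons a)))

/-- This links the recursive form, suited to induction, with the indexed sum in the definition of
`dCls`. -/
theorem altSum_eq_sum (f : α → List α → V) (J : List α) :
    altSum f J = ∑ i : Fin J.length, (-1 : ℚ) ^ (i : ℕ) • f (J.get i) (J.eraseIdx i) := by
  induction J generalizing f with
  | nil => simp [altSum]
  | cons a J ih =>
    rw [altSum, ih]
    have : ∀ g : Fin (a :: J).length → V, ∑ i, g i = g 0 + ∑ i : Fin J.length, g i.succ :=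
      fun g => Fin.sum_univ_succ g
    rw [this, sub_eq_add_neg, ← Finset.sum_neg_distrib]
    congr 1
    · simp
    · refine Finset.sum_congr rfl fun i _ => ?_
      simp [pow_succ]

/-- The combinatorial half of `d² = 0`. The terms that remove the first letter first and those that
remove it second cancel by symmetry; the terms that keep it form a double sum over the tail, to
which the induction applies. -/
theorem altSum_altSum_eq_zero {T : α → α → List α → V} {J : List α}
    (h : ∀ a b l, (a :: b :: l).Perm J → T a b l = T b a l) :
    altSum (fun a l => altSum (T a) l) J = 0 := by
  induction J generalizing T with
  | nil => rfl
  | cons a J ih =>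
    simp only [altSum]
    rw [altSum_sub, ih fun b c l hl => h b c (a :: l) (((List.Perm.swap a c l).cons b).trans
      ((List.Perm.swap a b _).trans (hl.cons a))),
      altSum_congr (g := fun b l => T b a l) fun b l hl => h a b l (hl.cons a)]
    abel

/-- Functions on words that change their sign when two neighbouring letters are exchanged. -/
def IsAlternating (w : List α → V) : Prop :=
  ∀ l₁ a b l₂, w (l₁ ++ a :: b :: l₂) = -w (l₁ ++ b :: a :: l₂)

theorem IsAlternating.cons {w : List α → V} (hw : IsAlternating w) (c : α) :
    IsAlternating fun l => w (c :: l) := fun l₁ a b l₂ => hw (c :: l₁) a b l₂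

theorem IsAlternating.perm {w : List α → V} (hw : IsAlternating w) {J J' : List α}
    (h : J.Perm J') : w J = w J' ∨ w J = -w J' := by
  induction h generalizing w with
  | nil => exact Or.inl rfl
  | cons c _ ih => exact ih (hw.cons c)
  | swap a b l => exact Or.inr (hw [] b a l)
  | trans _ _ ih₁ ih₂ =>
    rcases ih₁ hw with h1 | h1 <;> rcases ih₂ hw with h2 | h2 <;> simp [h1, h2]

theorem IsAlternating.eq_zero_of_perm {w : List α → V} (hw : IsAlternating w) {J J' : List α}
    (h : J.Perm J') (h' : w J' = 0) : w J = 0 := by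
  rcases hw.perm h with h1 | h1 <;> simp [h1, h']

/-- Two equal letters can be moved to the front, where their exchange shows that the value equals
its opposite; 2 is invertible in `ℚ`. -/
theorem IsAlternating.eq_zero_of_not_nodup {w : List α → V} (hw : IsAlternating w) {J : List α}
    (h : ¬ J.Nodup) : w J = 0 := by
  classical
  obtain ⟨a, ha⟩ : ∃ a, a ∈ J ∧ a ∈ J.erase a := by
    by_contra! hcon
    refine h (List.nodup_iff_count_le_one.mpr fun a => ?_)
    by_cases ha : a ∈ J
    · have h1 := List.count_eq_zero_of_not_mem (hcon a ha)
      rw [List.count_erase_self] at h1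
      omega
    · rw [List.count_eq_zero_of_not_mem ha]; omega
  refine hw.eq_zero_of_perm ((List.perm_cons_erase ha.1).trans
    ((List.perm_cons_erase ha.2).cons a)) ?_
  have h1 := hw [] a a ((J.erase a).erase a)
  have h2 : (2 : ℚ) • w (a :: a :: (J.erase a).erase a) = 0 := by
    rw [two_smul, add_eq_zero_iff_eq_neg]
    exact h1
  exact (smul_eq_zero.mp h2).resolve_left two_ne_zero

/-- Exchanging `a` and `b` exchanges the two terms that remove one of them, whose signs are
opposite. In every other term both letters remain and the alternation of `f` applies. -/
theorem isAlternating_altSum {f : α → List α → V} (hf : ∀ a, IsAlternating (f a)) :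
    IsAlternating (altSum f) := by
  intro l₁ a b l₂
  induction l₁ generalizing f with
  | nil =>
    simp only [List.nil_append, altSum]
    have h : altSum (fun c l => f c (a :: b :: l)) l₂ =
        -altSum (fun c l => f c (b :: a :: l)) l₂ := by
      rw [← altSum_neg]
      exact altSum_congr fun c l _ => hf c [] a b l
    rw [h]
    abel
  | cons c l₁ ih =>
    simp only [List.cons_append, altSum]
    rw [hf c l₁ a b l₂, ih fun d => (hf d).cons c]
    abel

end AltSum

/-! ### Joins of words -/

section Join

variable {E E' : Type*} [Lattice E] [BoundedOrder E] [Lattice E'] [BoundedOrder E']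

/-- The join of the letters of a word. -/
def lsup (J : List E) : E := (J : Multiset E).sup

@[simp] theorem lsup_cons (a : E) (J : List E) : lsup (a :: J) = a ⊔ lsup J := by
  simp [lsup, ← Multiset.cons_coe]

theorem lsup_le_iff {J : List E} {x : E} : lsup J ≤ x ↔ ∀ a ∈ J, a ≤ x :=
  Multiset.sup_le.trans (by simp)

theorem le_lsup {J : List E} {a : E} (h : a ∈ J) : a ≤ lsup J := lsup_le_iff.mp le_rfl a h

theorem lsup_perm {J J' : List E} (h : J.Perm J') : lsup J = lsup J' :=
  le_antisymm (lsup_le_iff.mpr fun _ ha => le_lsup (h.mem_iff.mp ha))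
    (lsup_le_iff.mpr fun _ ha => le_lsup (h.mem_iff.mpr ha))

theorem IsEmb.map_lsup {φ : E → E'} (h : IsEmb φ) (J : List E) :
    lsup (J.map φ) = φ (lsup J) := by
  induction J with
  | nil => exact h.map_bot.symm
  | cons a J ih => simp [ih, h.map_sup]

end Join

/-! ### Ranks and embeddings -/

section Embeddings

variable {L M E E' : Type*} [Lattice L] [BoundedOrder L] [Lattice M] [BoundedOrder M]
  [Lattice E] [BoundedOrder E] [Lattice E'] [BoundedOrder E']

theorem IsEmb.monotone {φ : E → E'} (h : IsEmb φ) : Monotone φ := fun _ _ => h.le_iff.mpr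

theorem IsEmb.strictMono {φ : E → E'} (h : IsEmb φ) : StrictMono φ :=
  h.monotone.strictMono_of_injective h.injective

theorem IsEmb.comp {φ : E → E'} {ψ : M → E} (h : IsEmb φ) (h' : IsEmb ψ) :
    IsEmb fun x => φ (ψ x) :=
  ⟨h.injective.comp h'.injective, by rw [h'.map_bot, h.map_bot],
    fun x y => by rw [h'.map_sup, h.map_sup], fun a ha => h.map_atom _ (h'.map_atom a ha)⟩

theorem isEmb_id : IsEmb fun x : E => x :=
  ⟨fun _ _ h => h, rfl, fun _ _ => rfl, fun _ h => h⟩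

theorem isEmb_orderIso (e : E ≃o E') : IsEmb e :=
  ⟨e.injective, e.map_bot, fun x y => map_sup e x y, fun a ha => (e.isAtom_iff a).mpr ha⟩

theorem exists_atom_not_le [IsGeometric E] {x y : E} (h : ¬ x ≤ y) :
    ∃ a, IsAtom a ∧ a ≤ x ∧ ¬ a ≤ y := by
  obtain ⟨S, hS, hlub⟩ := IsGeometric.atomistic x
  by_contra! hcon
  exact h (hlub.2 fun a ha => hcon a (hS a ha) (hlub.1 ha))

theorem rk_atom_sup_le [IsGeometric E] {a : E} (ha : IsAtom a) (x : E) :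
    rk (a ⊔ x) ≤ rk x + 1 := by
  by_cases h : a ≤ x
  · rw [sup_eq_right.mpr h]; omega
  · rw [rk_atom_sup ha h]

/-- A flat is built by adding atoms, and each atom raises the rank of the image by at most one.
Conversely, a strictly increasing map cannot lower heights. -/
theorem IsEmb.rk_map [IsGeometric E] [IsGeometric E'] {φ : E → E'} (h : IsEmb φ) (x : E) :
    rk (φ x) = rk x := by
  have := IsGeometric.finite (L := E)
  have := IsGeometric.finite (L := E')
  apply le_antisymm
  · induction x using WellFoundedLT.induction with
    | ind x ih =>
      rcases eq_or_ne x ⊥ with rfl | hx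
      · rw [h.map_bot, rk_bot]; omega
      · obtain ⟨y, -, hyx⟩ := exists_le_covBy_of_lt (bot_lt_iff_ne_bot.mpr hx)
        obtain ⟨a, ha, hax, hay⟩ := exists_atom_not_le (not_le_of_gt hyx.lt)
        have e : a ⊔ y = x := by
          rcases hyx.eq_or_eq le_sup_right (sup_le hax hyx.le) with h1 | h1
          · exact absurd (le_sup_left.trans h1.le) hay
          · exact h1
        have h1 := rk_atom_sup_le (h.map_atom a ha) (φ y)
        have h2 := ih y hyx.lt
        have h3 := rk_strictMono hyx.lt
        rw [← h.map_sup, e] at h1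
        omega
  · have := Order.height_le_height_apply_of_strictMono φ h.strictMono x
    rw [← coe_rk, ← coe_rk] at this
    exact_mod_cast this

theorem IsEmb.isAtom_iff [IsGeometric E] [IsGeometric E'] {φ : E → E'} (h : IsEmb φ) {a : E} :
    IsAtom (φ a) ↔ IsAtom a := by
  have := IsGeometric.finite (L := E)
  have := IsGeometric.finite (L := E')
  exact ⟨fun ha => isAtom_of_rk (by rw [← h.rk_map, rk_atom ha]), h.map_atom a⟩

theorem IsEmb.map_top [IsGeometric E] [IsGeometric E'] {φ : E → E'} (h : IsEmb φ)
    (hrk : rk (⊤ : E) = rk (⊤ : E')) : φ ⊤ = ⊤ := by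
  have := IsGeometric.finite (L := E')
  exact eq_of_le_of_rk le_top (by rw [h.rk_map, hrk])

/-- An embedding need not preserve meets, but the rank of a meet with a modular flat is determined
by ranks of joins, and these are preserved. Hence the evident inequality between the two meets is an
equality. -/
theorem IsEmb.trace_map [IsGeometric E] [IsGeometric E'] {φ : E → E'} (h : IsEmb φ)
    {ι : L → E} {ι' : L → E'} (hι : IsModExt ι) (hι' : IsModExt ι') (hφ : ∀ z, ι' z = φ (ι z))
    (x : E) : trace ι' (φ x) = trace ι x := by
  have := IsGeometric.finite (L := E')
  apply hι'.emb.injective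
  rw [hι'.map_trace, hφ, hφ, hι.map_trace]
  symm
  apply eq_of_le_of_rk (le_inf (h.monotone inf_le_left) (h.monotone inf_le_right))
  have h1 := hι'.modular (φ x)
  have h2 := hι.modular x
  rw [hφ, ← h.map_sup, h.rk_map, h.rk_map, h.rk_map] at h1
  rw [h.rk_map, inf_comm, inf_comm x]
  omega

/-- Exchange of two atoms. -/
theorem atom_exchange [IsGeometric E] {a b x : E} (ha : IsAtom a) (hb : IsAtom b)
    (hax : ¬ a ≤ x) (h : a ≤ b ⊔ x) : b ≤ a ⊔ x := by
  have := IsGeometric.finite (L := E)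
  have h1 := rk_atom_sup ha hax
  have h2 := rk_atom_sup_le hb x
  have h3 : a ⊔ x = b ⊔ x := eq_of_le_of_rk (sup_le h le_sup_right) (by omega)
  rw [h3]
  exact le_sup_left

/-- Embeddings onto a lower interval. -/
structure IsIntervalEmb (j : M → E) : Prop where
  emb : IsEmb j
  range_eq : Set.range j = Set.Icc ⊥ (j ⊤)

theorem IsModExt.intervalEmb {ι : M → E} (h : IsModExt ι) : IsIntervalEmb ι :=
  ⟨h.emb, h.range_eq⟩

theorem IsIntervalEmb.map_trace {j : M → E} (h : IsIntervalEmb j) (x : E) :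
    j (trace j x) = x ⊓ j ⊤ := by
  have : x ⊓ j ⊤ ∈ Set.range j := by rw [h.range_eq]; exact ⟨bot_le, inf_le_right⟩
  exact Function.invFun_eq this

theorem IsIntervalEmb.le_trace_iff {j : M → E} (h : IsIntervalEmb j) {z : M} {x : E} :
    z ≤ trace j x ↔ j z ≤ x := by
  rw [← h.emb.le_iff, h.map_trace, le_inf_iff, and_iff_left (h.emb.le_iff.mpr le_top)]

theorem IsIntervalEmb.trace_mono {j : M → E} (h : IsIntervalEmb j) {x y : E} (hxy : x ≤ y) :
    trace j x ≤ trace j y :=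
  h.le_trace_iff.mpr ((h.le_trace_iff.mp le_rfl).trans hxy)

theorem IsIntervalEmb.trace_map {j : M → E} (h : IsIntervalEmb j) (z : M) : trace j (j z) = z :=
  h.emb.injective (by rw [h.map_trace, inf_eq_left]; exact h.emb.le_iff.mpr le_top)

theorem IsIntervalEmb.trace_inf {j : M → E} (h : IsIntervalEmb j) (x y : E) :
    trace j (x ⊓ y) = trace j x ⊓ trace j y :=
  le_antisymm (le_inf (h.trace_mono inf_le_left) (h.trace_mono inf_le_right))
    (h.le_trace_iff.mpr (le_inf (h.le_trace_iff.mp inf_le_left) (h.le_trace_iff.mp inf_le_right)))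

theorem IsIntervalEmb.trace_bot {j : M → E} (h : IsIntervalEmb j) : trace j ⊥ = ⊥ := by
  rw [← h.emb.map_bot, h.trace_map]

theorem IsIntervalEmb.trace_top {j : M → E} (h : IsIntervalEmb j) : trace j ⊤ = ⊤ :=
  top_le_iff.mp (h.le_trace_iff.mpr le_top)

/-- Modular extensions can be composed. -/
theorem IsModExt.comp [IsGeometric E] [IsGeometric M] {κ : L → M} {ι : M → E} (h : IsModExt ι)
    (hκ : IsModExt κ) : IsModExt fun z => ι (κ z) := by
  refine ⟨h.emb.comp hκ.emb, ?_, ?_⟩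
  · ext x
    constructor
    · rintro ⟨z, rfl⟩
      exact ⟨bot_le, h.emb.monotone (hκ.emb.monotone le_top)⟩
    · rintro ⟨-, hx⟩
      refine ⟨trace κ (trace ι x), ?_⟩
      change ι (κ (trace κ (trace ι x))) = x
      have h1 : trace ι x ≤ κ ⊤ := by
        rw [← h.trace_map (κ ⊤)]
        exact h.trace_mono hx
      rw [hκ.map_trace, inf_eq_left.mpr h1, h.map_trace, inf_eq_left]
      exact hx.trans (h.emb.monotone le_top)
  · intro p
    -- Modularity is transitive: the equality for `κ ⊤` in `M`, tested on the trace of `p`, is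
    -- combined with the equalities for `ι ⊤` tested on `p` and on `ι (κ ⊤) ⊔ p`, which have the
    -- same join with `ι ⊤`.
    have h1 := hκ.modular (trace ι p)
    have h2 : ι (κ ⊤ ⊓ trace ι p) = ι (κ ⊤) ⊓ p := by
      have : κ ⊤ ⊓ trace ι p = trace ι (ι (κ ⊤) ⊓ p) := by rw [h.trace_inf, h.trace_map]
      rw [this, h.map_trace, inf_eq_left]
      exact inf_le_left.trans (h.emb.monotone le_top)
    have h3 : κ ⊤ ⊔ trace ι p = trace ι (ι (κ ⊤) ⊔ p) := by
      rw [sup_comm, sup_comm _ p, h.trace_sup]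
    have h4 := h.rk_trace p
    have h5 := h.rk_trace (ι (κ ⊤) ⊔ p)
    have h6 : ι (κ ⊤) ⊔ p ⊔ ι ⊤ = p ⊔ ι ⊤ := by
      rw [sup_comm (ι (κ ⊤)), sup_assoc, sup_eq_right.mpr (h.emb.monotone le_top)]
    rw [h6] at h5
    rw [← h.rk_map (κ ⊤ ⊓ trace ι p), h2, h3, ← h.rk_map (κ ⊤)] at h1
    change rk (ι (κ ⊤) ⊓ p) + rk (ι (κ ⊤) ⊔ p) = rk (ι (κ ⊤)) + rk p
    omega

theorem isModExt_id : IsModExt fun x : L => x :=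
  ⟨isEmb_id, by ext; simp, fun G => by rw [top_inf_eq, top_sup_eq, add_comm]⟩

/-! ### Lower intervals -/

theorem geometric_Iic [IsGeometric E] (X : E) :
    IsGeometric (Set.Iic X) ∧ ∀ x : Set.Iic X, rk x = rk (x : E) := by
  have := IsGeometric.finite (L := E)
  apply geometric_of_rank
  · intro x y hxy
    exact rk_strictMono (show (x : E) < y from hxy)
  · exact rk_bot
  · intro x y
    exact IsGeometric.semimodular (x : E) (y : E)
  · intro x
    obtain ⟨S, hS, hlub⟩ := IsGeometric.atomistic (x : E)
    refine ⟨{y | (y : E) ∈ S}, fun a ha => rk_atom (hS _ ha), fun a ha => hlub.1 ha, ?_⟩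
    intro z hz
    exact hlub.2 fun a ha => hz (a := ⟨a, (hlub.1 ha).trans x.2⟩) ha

instance instGeometricIic [IsGeometric E] (X : E) : IsGeometric (Set.Iic X) := (geometric_Iic X).1

theorem rk_Iic [IsGeometric E] {X : E} (x : Set.Iic X) : rk x = rk (x : E) := (geometric_Iic X).2 x

theorem isEmb_coe_Iic [IsGeometric E] (X : E) : IsEmb ((↑) : Set.Iic X → E) := by
  have := IsGeometric.finite (L := E)
  exact ⟨Subtype.val_injective, rfl, fun _ _ => rfl,
    fun a ha => isAtom_of_rk (by rw [← rk_Iic, rk_atom ha])⟩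

theorem isIntervalEmb_coe_Iic [IsGeometric E] (X : E) :
    IsIntervalEmb ((↑) : Set.Iic X → E) :=
  ⟨isEmb_coe_Iic X, by ext; simp⟩

/-- The intersection of a modular extension with a lower interval. -/
theorem IsModExt.restrict [IsGeometric E] {ι : L → E} (h : IsModExt ι) {j : M → L}
    (hj : IsIntervalEmb j) (X : E) (hX : j ⊤ = trace ι X) :
    IsModExt fun z => (⟨ι (j z), (h.emb.monotone (hj.emb.monotone le_top)).trans
      (h.le_trace_iff.mp hX.le)⟩ : Set.Iic X) := by
  have := IsGeometric.finite (L := E)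
  have hjX : ι (j ⊤) = X ⊓ ι ⊤ := by rw [hX, h.map_trace]
  refine ⟨⟨?_, ?_, ?_, ?_⟩, ?_, ?_⟩
  · intro z w hzw
    exact hj.emb.injective (h.emb.injective (congrArg Subtype.val hzw))
  · exact Subtype.ext (show ι (j ⊥) = ⊥ by rw [hj.emb.map_bot, h.emb.map_bot])
  · intro z w
    exact Subtype.ext (show ι (j (z ⊔ w)) = ι (j z) ⊔ ι (j w) by rw [hj.emb.map_sup, h.emb.map_sup])
  · intro a ha
    apply isAtom_of_rk
    rw [rk_Iic]
    exact rk_atom (h.emb.map_atom _ (hj.emb.map_atom a ha))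
  · ext x
    constructor
    · rintro ⟨z, rfl⟩
      exact ⟨bot_le, h.emb.monotone (hj.emb.monotone le_top)⟩
    · rintro ⟨-, hx⟩
      have hx' : (x : E) ≤ ι (j ⊤) := hx
      have h1 : trace ι (x : E) ≤ j ⊤ := by
        rw [← h.trace_map (j ⊤)]
        exact h.trace_mono hx'
      refine ⟨trace j (trace ι (x : E)), Subtype.ext ?_⟩
      change ι (j (trace j (trace ι (x : E)))) = x
      rw [hj.map_trace, inf_eq_left.mpr h1, h.map_trace, inf_eq_left]
      exact hx'.trans (h.emb.monotone le_top)
  · intro Y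
    rw [rk_Iic, rk_Iic, rk_Iic, rk_Iic]
    change rk (ι (j ⊤) ⊓ (Y : E)) + rk (ι (j ⊤) ⊔ (Y : E)) = rk (ι (j ⊤)) + rk (Y : E)
    have hY : (Y : E) ≤ X := Y.2
    have e1 : ι (j ⊤) ⊓ (Y : E) = ι ⊤ ⊓ (Y : E) := by
      rw [hjX, inf_comm X, inf_assoc, inf_eq_right.mpr hY]
    have e2 : ι (j ⊤) ⊔ (Y : E) = X ⊓ (Y ⊔ ι ⊤) := by
      rw [hjX, modular_law' h.modular hY, sup_comm]
    -- By the modular law the join inside `[0, X]` is `X ⊓ (Y ⊔ ι ⊤)`. This element and `Y` have the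
    -- same join with `ι ⊤`, so the difference of the two modular equalities is the claim.
    have h1 := h.modular (Y : E)
    have h2 := h.modular (X ⊓ (Y ⊔ ι ⊤))
    have e3 : ι ⊤ ⊓ (X ⊓ (Y ⊔ ι ⊤)) = ι (j ⊤) := by
      rw [hjX]
      exact le_antisymm (le_inf (inf_le_right.trans inf_le_left) inf_le_left)
        (le_inf inf_le_right (le_inf inf_le_left (inf_le_right.trans le_sup_right)))
    have e4 : ι ⊤ ⊔ (X ⊓ (Y ⊔ ι ⊤)) = ι ⊤ ⊔ (Y : E) := by
      apply le_antisymm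
      · exact sup_le le_sup_left (inf_le_right.trans (by rw [sup_comm]))
      · exact sup_le le_sup_left (le_sup_of_le_right (le_inf hY le_sup_left))
    rw [e3, e4] at h2
    rw [e1, e2]
    omega

/-- The modular equalities of `G` against `Y` and against `X ⊓ (Y ⊔ G)`, which have the same join
with `G`, are subtracted. This carries the relation `two` through a restriction. -/
theorem IsModularElt.inf_Iic [IsGeometric E] {G : E} (hG : IsModularElt G) (X : E) :
    IsModularElt (⟨X ⊓ G, inf_le_left⟩ : Set.Iic X) := by
  have := IsGeometric.finite (L := E)
  intro Y
  have hY : (Y : E) ≤ X := Y.2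
  rw [rk_Iic, rk_Iic, rk_Iic, rk_Iic]
  change rk (X ⊓ G ⊓ (Y : E)) + rk (X ⊓ G ⊔ (Y : E)) = rk (X ⊓ G) + rk (Y : E)
  have e1 : X ⊓ G ⊓ (Y : E) = G ⊓ (Y : E) := by
    rw [inf_comm X, inf_assoc, inf_eq_right.mpr hY]
  have e2 : X ⊓ G ⊔ (Y : E) = X ⊓ (Y ⊔ G) := by rw [modular_law' hG hY, sup_comm]
  have h1 := hG (Y : E)
  have h2 := hG (X ⊓ (Y ⊔ G))
  have e3 : G ⊓ (X ⊓ (Y ⊔ G)) = X ⊓ G :=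
    le_antisymm (le_inf (inf_le_right.trans inf_le_left) inf_le_left)
      (le_inf inf_le_right (le_inf inf_le_left (inf_le_right.trans le_sup_right)))
  have e4 : G ⊔ (X ⊓ (Y ⊔ G)) = G ⊔ (Y : E) :=
    le_antisymm (sup_le le_sup_left (inf_le_right.trans (by rw [sup_comm])))
      (sup_le le_sup_left (le_sup_of_le_right (le_inf hY le_sup_left)))
  rw [e3, e4] at h2
  rw [e1, e2]
  omega

end Embeddings

/-! ### Relations, linear maps and gradings on the space of modular diagrams -/

section Relations

variable {L : Type u} [Lattice L] [BoundedOrder L] {V : Type*} [AddCommGroup V] [Module ℚ V]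

theorem mk_eq_zero_of_rel {x : ModularDiagram L →₀ ℚ} (h : ModularDiagram.Rel x) :
    (Submodule.Quotient.mk x : MD L) = 0 :=
  (Submodule.Quotient.mk_eq_zero _).mpr (Submodule.subset_span h)

/-- Maps on diagrams that respect the relations. -/
structure RespectsRel (f : ModularDiagram L → V) : Prop where
  swap : ∀ (Γ : ModularDiagram L) (l₁ l₂ : List Γ.E) (a b : Γ.E), Γ.J = l₁ ++ a :: b :: l₂ →
    ∀ h', f Γ = -f (Γ.withWord (l₁ ++ b :: a :: l₂) h')
  emb : ∀ (Γ Γ' : ModularDiagram L) (φ : Γ.E → Γ'.E), IsEmb φ → rk (⊤ : Γ.E) = rk (⊤ : Γ'.E) →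
    (∀ z, Γ'.ι z = φ (Γ.ι z)) → Γ'.J = Γ.J.map φ → f Γ = f Γ'
  low : ∀ Γ : ModularDiagram L, Γ.flat ⊔ Γ.join < ⊤ → f Γ = 0
  prod : ∀ (Γ : ModularDiagram L) (A B : Type u) [Lattice A] [BoundedOrder A] [IsGeometric A]
    [Nontrivial A] [Lattice B] [BoundedOrder B] [IsGeometric B] [Nontrivial B]
    (e : Γ.E ≃o A × B), (e Γ.flat).2 = ⊥ → f Γ = 0
  two : ∀ (Γ : ModularDiagram L) (G : Γ.E), IsModularElt G → Γ.flat ≤ G →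
    {H | H ∈ Γ.J ∧ ¬ H ≤ G}.ncard = 2 → f Γ = 0

theorem RespectsRel.exists_lift {f : ModularDiagram L → V} (hf : RespectsRel f) :
    ∃ g : MD L →ₗ[ℚ] V, ∀ Γ, g Γ.cls = f Γ := by
  refine ⟨Submodule.liftQ _ (Finsupp.linearCombination ℚ f) ?_, fun Γ => ?_⟩
  · rw [Submodule.span_le]
    intro x hx
    change Finsupp.linearCombination ℚ f x = 0
    cases hx with
    | swap Γ l₁ l₂ a b h h' => simp [hf.swap Γ l₁ l₂ a b h h']
    | emb Γ Γ' φ hφ hrk hι hJ => simp [hf.emb Γ Γ' φ hφ hrk hι hJ]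
    | low Γ h => simp [hf.low Γ h]
    | prod Γ A B e h => simp [hf.prod Γ A B e h]
    | two Γ G hG hFG hcard => simp [hf.two Γ G hG hFG hcard]
  · change Finsupp.linearCombination ℚ f (Finsupp.single Γ 1) = f Γ
    simp

theorem respectsRel_cls : RespectsRel (ModularDiagram.cls (L := L)) where
  swap Γ l₁ l₂ a b h h' := by
    have := mk_eq_zero_of_rel (ModularDiagram.Rel.swap Γ l₁ l₂ a b h h')
    rw [Submodule.Quotient.mk_add] at this
    exact eq_neg_of_add_eq_zero_left this
  emb Γ Γ' φ hφ hrk hι hJ := by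
    have := mk_eq_zero_of_rel (ModularDiagram.Rel.emb Γ Γ' φ hφ hrk hι hJ)
    rw [Submodule.Quotient.mk_sub] at this
    exact sub_eq_zero.mp this
  low Γ h := mk_eq_zero_of_rel (ModularDiagram.Rel.low Γ h)
  prod Γ A B _ _ _ _ _ _ _ _ e h := mk_eq_zero_of_rel (ModularDiagram.Rel.prod Γ A B e h)
  two Γ G hG hFG hcard := mk_eq_zero_of_rel (ModularDiagram.Rel.two Γ G hG hFG hcard)

theorem MD_eq_top {S : Submodule ℚ (MD L)} (h : ∀ Γ : ModularDiagram L, Γ.cls ∈ S) : S = ⊤ := by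
  rw [← Submodule.ker_mkQ S, LinearMap.ker_eq_top]
  exact MD_hom_ext fun Γ => by simpa using h Γ

/-- Functions on diagrams for which the relations are homogeneous. -/
structure IsGrading {I : Type*} (g : ModularDiagram L → I) : Prop where
  perm : ∀ (Γ : ModularDiagram L) (J' : List Γ.E) (h : ∀ H ∈ J', IsAtom H), Γ.J.Perm J' →
    g (Γ.withWord J' h) = g Γ
  emb : ∀ (Γ Γ' : ModularDiagram L) (φ : Γ.E → Γ'.E), IsEmb φ → rk (⊤ : Γ.E) = rk (⊤ : Γ'.E) →
    (∀ z, Γ'.ι z = φ (Γ.ι z)) → Γ'.J = Γ.J.map φ → g Γ' = g Γ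

theorem perm_swap_append {α : Type*} (l₁ l₂ : List α) (a b : α) :
    (l₁ ++ a :: b :: l₂).Perm (l₁ ++ b :: a :: l₂) :=
  (List.Perm.swap b a l₂).append_left l₁

-- The relations `low`, `prod` and `two` involve one diagram each and are homogeneous for any `g`;
-- only `swap` and `emb` put a condition on it. Truncating `f` in this way yields the projections of
-- the decomposition.
open Classical in
theorem IsGrading.respectsRel {I : Type*} {g : ModularDiagram L → I} (hg : IsGrading g) (i : I)
    {f : ModularDiagram L → V} (hf : RespectsRel f) :
    RespectsRel fun Γ => if g Γ = i then f Γ else 0 where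
  swap Γ l₁ l₂ a b h h' := by
    rw [hg.perm Γ _ h' (by rw [h]; exact perm_swap_append _ _ _ _), hf.swap Γ l₁ l₂ a b h h']
    split_ifs <;> simp
  emb Γ Γ' φ hφ hrk hι hJ := by
    rw [hg.emb Γ Γ' φ hφ hrk hι hJ, hf.emb Γ Γ' φ hφ hrk hι hJ]
  low Γ h := by rw [hf.low Γ h, ite_self]
  prod Γ A B _ _ _ _ _ _ _ _ e h := by rw [hf.prod Γ A B e h, ite_self]
  two Γ G hG hFG hcard := by rw [hf.two Γ G hG hFG hcard, ite_self]

/-- Homogeneous relations give a direct sum decomposition. -/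
theorem IsGrading.isInternal {I : Type*} [DecidableEq I] {g : ModularDiagram L → I}
    (hg : IsGrading g) : DirectSum.IsInternal fun i : I =>
      Submodule.span ℚ {x : MD L | ∃ Γ : ModularDiagram L, g Γ = i ∧ x = Γ.cls} := by
  classical
  rw [DirectSum.isInternal_submodule_iff_iSupIndep_and_iSup_eq_top]
  constructor
  · intro i
    -- `π` is the projection on the part of index `i`: the identity there and zero on all the other
    -- parts.
    obtain ⟨π, hπ⟩ := (hg.respectsRel i respectsRel_cls).exists_lift
    rw [Submodule.disjoint_def]
    intro x hx hx'
    have h1 : π x = x := by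
      refine LinearMap.eqOn_span (g := LinearMap.id) ?_ hx
      rintro _ ⟨Γ, hΓ, rfl⟩
      rw [hπ, if_pos hΓ, LinearMap.id_apply]
    have h2 : (⨆ (j) (_ : j ≠ i), Submodule.span ℚ
        {x : MD L | ∃ Γ : ModularDiagram L, g Γ = j ∧ x = Γ.cls}) ≤ LinearMap.ker π := by
      refine iSup₂_le fun j hj => Submodule.span_le.mpr ?_
      rintro _ ⟨Γ, hΓ, rfl⟩
      rw [SetLike.mem_coe, LinearMap.mem_ker, hπ, if_neg (by rw [hΓ]; exact hj)]
    rw [← h1]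
    exact h2 hx'
  · exact MD_eq_top fun Γ => Submodule.mem_iSup_of_mem (g Γ) (Submodule.subset_span ⟨Γ, rfl, rfl⟩)

theorem ModularDiagram.join_eq (Γ : ModularDiagram L) : Γ.join = lsup Γ.J := rfl

theorem ModularDiagram.flat_eq (Γ : ModularDiagram L) : Γ.flat = Γ.ι ⊤ := rfl

/-- Modularity of `F_ι` removes the meet from the degree, leaving ranks of joins, which are easy to
follow through embeddings and contractions. -/
theorem ModularDiagram.deg_eq (Γ : ModularDiagram L) :
    Γ.deg = (Γ.J.length : ℤ) - 2 * ((rk (Γ.ι ⊤ ⊔ lsup Γ.J) : ℤ) - (rk (Γ.ι ⊤) : ℤ)) := by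
  have := Γ.ext.modular (lsup Γ.J)
  rw [deg, join_eq, flat_eq, inf_comm]
  omega

theorem isGrading_deg : IsGrading (ModularDiagram.deg (L := L)) where
  perm Γ J' h hp := by
    rw [ModularDiagram.deg_eq, ModularDiagram.deg_eq]
    change (J'.length : ℤ) - 2 * ((rk (Γ.ι ⊤ ⊔ lsup J') : ℤ) - (rk (Γ.ι ⊤) : ℤ)) = _
    rw [hp.length_eq, lsup_perm hp]
  emb Γ Γ' φ hφ hrk hι hJ := by
    rw [ModularDiagram.deg_eq, ModularDiagram.deg_eq, hJ, hι, hφ.map_lsup, ← hφ.map_sup,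
      hφ.rk_map, hφ.rk_map, List.length_map]

theorem isGrading_gr : IsGrading (ModularDiagram.gr (L := L)) where
  perm Γ J' h hp := by
    change trace Γ.ι (lsup J') = trace Γ.ι (lsup Γ.J)
    rw [lsup_perm hp]
  emb Γ Γ' φ hφ hrk hι hJ := by
    change trace Γ'.ι (lsup Γ'.J) = trace Γ.ι (lsup Γ.J)
    rw [hJ, hφ.map_lsup, hφ.trace_map Γ.ext Γ'.ext hι]

/-! ### Classes of words -/

variable {E E' : Type u} [Lattice E] [BoundedOrder E] [IsGeometric E]
  [Lattice E'] [BoundedOrder E'] [IsGeometric E'] {ι : L → E} {ι' : L → E'}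

open Classical in
/-- The class of the diagram with extension `ι` and word `J`, which is zero by convention if some
letter of `J` is not an atom. -/
noncomputable def wcls (h : IsModExt ι) (J : List E) : MD L :=
  if hJ : ∀ H ∈ J, IsAtom H then (ModularDiagram.mk E ι h J hJ).cls else 0

theorem wcls_of_atoms (h : IsModExt ι) {J : List E} (hJ : ∀ H ∈ J, IsAtom H) :
    wcls h J = (ModularDiagram.mk E ι h J hJ).cls := dif_pos hJ

theorem wcls_of_not_atoms (h : IsModExt ι) {J : List E} (hJ : ¬ ∀ H ∈ J, IsAtom H) :
    wcls h J = 0 := dif_neg hJ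

theorem ModularDiagram.wcls_eq (Γ : ModularDiagram L) : wcls Γ.ext Γ.J = Γ.cls :=
  wcls_of_atoms Γ.ext Γ.atoms

theorem forall_mem_swap {α : Type*} {p : α → Prop} {l₁ l₂ : List α} {a b : α} :
    (∀ c ∈ l₁ ++ a :: b :: l₂, p c) ↔ ∀ c ∈ l₁ ++ b :: a :: l₂, p c :=
  forall_congr' fun _ => imp_congr_left (perm_swap_append _ _ _ _).mem_iff

theorem wcls_alternating (h : IsModExt ι) : IsAlternating (wcls h) := by
  intro l₁ a b l₂
  by_cases hJ : ∀ H ∈ l₁ ++ a :: b :: l₂, IsAtom H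
  · rw [wcls_of_atoms h hJ, wcls_of_atoms h (forall_mem_swap.mp hJ)]
    exact respectsRel_cls.swap (ModularDiagram.mk E ι h _ hJ) l₁ l₂ a b rfl
      (forall_mem_swap.mp hJ)
  · rw [wcls_of_not_atoms h hJ, wcls_of_not_atoms h (forall_mem_swap.not.mp hJ), neg_zero]

theorem wcls_emb (h : IsModExt ι) (h' : IsModExt ι') {φ : E → E'} (hφ : IsEmb φ)
    (hrk : rk (⊤ : E) = rk (⊤ : E')) (hι : ∀ z, ι' z = φ (ι z)) (J : List E) :
    wcls h' (J.map φ) = wcls h J := by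
  have key : (∀ H ∈ J.map φ, IsAtom H) ↔ ∀ H ∈ J, IsAtom H := by
    simp only [List.forall_mem_map, hφ.isAtom_iff]
  by_cases hJ : ∀ H ∈ J, IsAtom H
  · rw [wcls_of_atoms h hJ, wcls_of_atoms h' (key.mpr hJ)]
    exact (respectsRel_cls.emb (ModularDiagram.mk E ι h _ hJ) (ModularDiagram.mk E' ι' h' _ _)
      φ hφ hrk hι rfl).symm
  · rw [wcls_of_not_atoms h hJ, wcls_of_not_atoms h' (key.not.mpr hJ)]

theorem wcls_orderIso (h : IsModExt ι) (h' : IsModExt ι') (e : E ≃o E')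
    (hι : ∀ z, ι' z = e (ι z)) (J : List E) : wcls h' (J.map e) = wcls h J := by
  refine wcls_emb h h' (isEmb_orderIso e) ?_ hι J
  rw [← (isEmb_orderIso e).rk_map, e.map_top]

theorem wcls_low (h : IsModExt ι) {J : List E} (hJ : ι ⊤ ⊔ lsup J < ⊤) : wcls h J = 0 := by
  by_cases hJ' : ∀ H ∈ J, IsAtom H
  · rw [wcls_of_atoms h hJ']
    exact respectsRel_cls.low _ hJ
  · exact wcls_of_not_atoms h hJ'

theorem wcls_prod (h : IsModExt ι) (J : List E) {A B : Type u} [Lattice A] [BoundedOrder A]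
    [IsGeometric A] [Nontrivial A] [Lattice B] [BoundedOrder B] [IsGeometric B] [Nontrivial B]
    (e : E ≃o A × B) (he : (e (ι ⊤)).2 = ⊥) : wcls h J = 0 := by
  by_cases hJ' : ∀ H ∈ J, IsAtom H
  · rw [wcls_of_atoms h hJ']
    exact respectsRel_cls.prod (ModularDiagram.mk E ι h _ hJ') A B e he
  · exact wcls_of_not_atoms h hJ'

theorem wcls_two (h : IsModExt ι) {G : E} (hG : IsModularElt G) (hFG : ι ⊤ ≤ G) {J l : List E}
    {a b : E} (hJ : J.Perm (a :: b :: l)) (ha : ¬ a ≤ G) (hb : ¬ b ≤ G) (hl : ∀ c ∈ l, c ≤ G) :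
    wcls h J = 0 := by
  by_cases hJ' : ∀ H ∈ J, IsAtom H
  -- The relation `two` counts distinct atoms and does not apply if `a = b`; the word then has a
  -- repeated letter and vanishes by alternation.
  · by_cases hab : a = b
    · refine (wcls_alternating h).eq_zero_of_not_nodup fun hn => ?_
      have := hJ.nodup_iff.mp hn
      simp [hab] at this
    · rw [wcls_of_atoms h hJ']
      refine respectsRel_cls.two (ModularDiagram.mk E ι h _ hJ') G hG hFG ?_
      rw [← Set.ncard_pair hab]
      congr 1
      ext c
      change c ∈ J ∧ ¬ c ≤ G ↔ _
      rw [hJ.mem_iff]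
      simp only [List.mem_cons, Set.mem_insert_iff, Set.mem_singleton_iff]
      constructor
      · rintro ⟨h1 | h1 | h1, h2⟩
        · exact Or.inl h1
        · exact Or.inr h1
        · exact absurd (hl c h1) h2
      · rintro (rfl | rfl)
        · exact ⟨Or.inl rfl, ha⟩
        · exact ⟨Or.inr (Or.inl rfl), hb⟩
  · exact wcls_of_not_atoms h hJ'

/-- The form of the words with exactly two letters outside a lower interval. -/
theorem exists_perm_of_ncard_two {J : List E} {G : E} (hJ : J.Nodup)
    (h : {H | H ∈ J ∧ ¬ H ≤ G}.ncard = 2) :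
    ∃ a b l, J.Perm (a :: b :: l) ∧ ¬ a ≤ G ∧ ¬ b ≤ G ∧ ∀ c ∈ l, c ≤ G := by
  classical
  obtain ⟨a, b, hab, hs⟩ := Set.ncard_eq_two.mp h
  have ha : a ∈ J ∧ ¬ a ≤ G := by
    have : a ∈ {H | H ∈ J ∧ ¬ H ≤ G} := by rw [hs]; simp
    exact this
  have hb : b ∈ J ∧ ¬ b ≤ G := by
    have : b ∈ {H | H ∈ J ∧ ¬ H ≤ G} := by rw [hs]; simp
    exact this
  refine ⟨a, b, (J.erase a).erase b, (List.perm_cons_erase ha.1).trans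
    ((List.perm_cons_erase ((List.mem_erase_of_ne hab.symm).mpr hb.1)).cons a), ha.2, hb.2, ?_⟩
  intro c hc
  by_contra hcG
  have h1 := (hJ.erase a).mem_erase_iff.mp hc
  have h2 := hJ.mem_erase_iff.mp h1.2
  have : c ∈ ({a, b} : Set E) := by rw [← hs]; exact ⟨h2.2, hcG⟩
  rcases this with h3 | h3
  · exact h2.1 h3
  · exact h1.1 h3

end Relations

/-! ### Contractions -/

section Contraction

variable {L : Type u} [Lattice L] [BoundedOrder L]
  {E E' : Type u} [Lattice E] [BoundedOrder E] [IsGeometric E]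
  [Lattice E'] [BoundedOrder E'] [IsGeometric E'] {ι : L → E} {ι' : L → E'}

/-- The join with `a`, as an element of the upper interval above `a`. -/
def toIci (a x : E) : Set.Ici a := ⟨a ⊔ x, le_sup_left⟩

theorem lsup_map_toIci (a : E) (l : List E) : lsup (l.map (toIci a)) = toIci a (lsup l) := by
  induction l with
  | nil => exact Subtype.ext (sup_bot_eq a).symm
  | cons b l ih =>
    rw [List.map_cons, lsup_cons, ih, lsup_cons]
    exact Subtype.ext (sup_sup_distrib_left a b (lsup l)).symm

theorem toIci_le_iff {a x y : E} (h : a ≤ y) : toIci a x ≤ ⟨y, h⟩ ↔ x ≤ y :=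
  (sup_le_iff : a ⊔ x ≤ y ↔ _).trans (and_iff_right h)

theorem rk_Ici {a : E} (x : Set.Ici a) : rk x = rk (x : E) - rk a := (geometric_Ici a).2 x

theorem isAtom_toIci {a b : E} (ha : IsAtom a) (hb : IsAtom b) (hab : a ≠ b) :
    IsAtom (toIci a b) :=
  isAtom_sup_Ici hb fun hle => (ha.le_iff.mp hle).elim hb.1 fun h => hab h.symm

theorem toIci_self_not_isAtom (a : E) : ¬ IsAtom (toIci a a) :=
  fun h => h.1 (Subtype.ext (sup_idem a))

theorem IsModularElt.of_Ici {G : E} (hG : IsModularElt G) {a : E} (h : a ≤ G) :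
    IsModularElt (⟨G, h⟩ : Set.Ici a) := by
  have := IsGeometric.finite (L := E)
  intro Y
  have h1 := hG (Y : E)
  have hY : a ≤ (Y : E) := Y.2
  have h2 : rk a ≤ rk (G ⊓ (Y : E)) := rk_mono (le_inf h hY)
  have h3 : rk a ≤ rk G := rk_mono h
  have h4 : rk a ≤ rk (Y : E) := rk_mono hY
  have h5 : rk a ≤ rk (G ⊔ (Y : E)) := rk_mono (h.trans le_sup_left)
  rw [rk_Ici, rk_Ici, rk_Ici, rk_Ici]
  change rk (G ⊓ (Y : E)) - rk a + (rk (G ⊔ (Y : E)) - rk a) = rk G - rk a + (rk (Y : E) - rk a)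
  omega

open Classical in
/-- The contraction at `a` of the diagram with word `a l`, or zero if `a` is not contractible. -/
noncomputable def con (h : IsModExt ι) (a : E) (l : List E) : MD L :=
  if c : (IsAtom a ∧ ¬ a ≤ ι ⊤) ∧ a ≤ ι ⊤ ⊔ lsup l then
    wcls (h.contract c.1.1 c.1.2) (l.map (toIci a)) else 0

theorem con_of (h : IsModExt ι) {a : E} {l : List E} (ha : IsAtom a) (haF : ¬ a ≤ ι ⊤)
    (hal : a ≤ ι ⊤ ⊔ lsup l) : con h a l = wcls (h.contract ha haF) (l.map (toIci a)) :=
  dif_pos ⟨⟨ha, haF⟩, hal⟩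

theorem con_of_not (h : IsModExt ι) {a : E} {l : List E}
    (hc : ¬ ((IsAtom a ∧ ¬ a ≤ ι ⊤) ∧ a ≤ ι ⊤ ⊔ lsup l)) : con h a l = 0 := dif_neg hc

theorem con_alternating (h : IsModExt ι) (a : E) : IsAlternating (con h a) := by
  intro l₁ b c l₂
  have hs := lsup_perm (perm_swap_append l₁ l₂ b c)
  by_cases hc : (IsAtom a ∧ ¬ a ≤ ι ⊤) ∧ a ≤ ι ⊤ ⊔ lsup (l₁ ++ b :: c :: l₂)
  · rw [con_of h hc.1.1 hc.1.2 hc.2, con_of h hc.1.1 hc.1.2 (hs ▸ hc.2)]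
    simp only [List.map_append, List.map_cons]
    exact wcls_alternating _ _ _ _ _
  · rw [con_of_not h hc, con_of_not h (hs ▸ hc), neg_zero]

/-- A second copy of `a` becomes the least element of `[a, 1]`, which is not an atom, so the
convention for `wcls` gives zero. -/
theorem con_eq_zero_of_mem (h : IsModExt ι) {a : E} {l : List E} (hal : a ∈ l) :
    con h a l = 0 := by
  by_cases hc : (IsAtom a ∧ ¬ a ≤ ι ⊤) ∧ a ≤ ι ⊤ ⊔ lsup l
  · rw [con_of h hc.1.1 hc.1.2 hc.2]
    exact wcls_of_not_atoms _ fun hat =>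
      toIci_self_not_isAtom a (hat _ (List.mem_map_of_mem hal))
  · exact con_of_not h hc

/-- An embedding of equal rank restricts to an embedding of `[a, 1]` in `[φ a, 1]`, again of equal
rank. Both conditions of contractibility are expressed by joins and order, which it preserves and
reflects. -/
theorem con_emb (h : IsModExt ι) (h' : IsModExt ι') {φ : E → E'} (hφ : IsEmb φ)
    (hrk : rk (⊤ : E) = rk (⊤ : E')) (hι : ∀ z, ι' z = φ (ι z)) (a : E) (l : List E) :
    con h' (φ a) (l.map φ) = con h a l := by
  have := IsGeometric.finite (L := E)
  have := IsGeometric.finite (L := E')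
  have key : ((IsAtom (φ a) ∧ ¬ φ a ≤ ι' ⊤) ∧ φ a ≤ ι' ⊤ ⊔ lsup (l.map φ)) ↔
      (IsAtom a ∧ ¬ a ≤ ι ⊤) ∧ a ≤ ι ⊤ ⊔ lsup l := by
    rw [hφ.isAtom_iff, hι, hφ.le_iff, hφ.map_lsup, ← hφ.map_sup, hφ.le_iff]
  by_cases hc : (IsAtom a ∧ ¬ a ≤ ι ⊤) ∧ a ≤ ι ⊤ ⊔ lsup l
  · have hc' := key.mpr hc
    rw [con_of h hc.1.1 hc.1.2 hc.2, con_of h' hc'.1.1 hc'.1.2 hc'.2]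
    let ψ : Set.Ici a → Set.Ici (φ a) := fun x => ⟨φ x, hφ.monotone x.2⟩
    have hψ : ∀ x, ψ (toIci a x) = toIci (φ a) (φ x) := fun x => Subtype.ext (hφ.map_sup a x)
    have hψrk : ∀ x, rk (ψ x) = rk x := fun x => by
      rw [rk_Ici, rk_Ici, ← hφ.rk_map, ← hφ.rk_map]
    rw [← wcls_emb (h.contract hc.1.1 hc.1.2) (h'.contract hc'.1.1 hc'.1.2) (φ := ψ) ?_ ?_ ?_,
      List.map_map, List.map_map]
    · congr 1
      exact List.map_congr_left fun x _ => (hψ x).symm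
    · refine ⟨fun x y hxy => Subtype.ext (hφ.injective (congrArg Subtype.val hxy)),
        Subtype.ext rfl, fun x y => Subtype.ext (hφ.map_sup _ _), fun x hx => isAtom_of_rk ?_⟩
      rw [hψrk, rk_atom hx]
    · rw [← hψrk]
      congr 1
      exact Subtype.ext (hφ.map_top hrk)
    · intro z
      exact Subtype.ext (by
        change φ a ⊔ ι' z = φ (a ⊔ ι z)
        rw [hφ.map_sup, hι])
  · rw [con_of_not h hc, con_of_not h' (key.not.mpr hc)]

theorem con_low (h : IsModExt ι) {a : E} {l : List E} (hl : ι ⊤ ⊔ lsup (a :: l) < ⊤) :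
    con h a l = 0 := by
  by_cases hc : (IsAtom a ∧ ¬ a ≤ ι ⊤) ∧ a ≤ ι ⊤ ⊔ lsup l
  · rw [con_of h hc.1.1 hc.1.2 hc.2]
    apply wcls_low
    rw [lsup_map_toIci]
    change (a ⊔ ι ⊤) ⊔ (a ⊔ lsup l) < ⊤
    rwa [← sup_sup_distrib_left, sup_left_comm, ← lsup_cons]
  · exact con_of_not h hc

/-- Upper intervals in a product. -/
def iciProd {A B : Type*} [Lattice A] [Lattice B] (e : E ≃o A × B) (a : E) :
    Set.Ici a ≃o Set.Ici (e a).1 × Set.Ici (e a).2 where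
  toFun x := (⟨(e x).1, (e.monotone x.2).1⟩, ⟨(e x).2, (e.monotone x.2).2⟩)
  invFun y := ⟨e.symm (y.1, y.2), by
    rw [Set.mem_Ici, e.le_symm_apply]
    exact ⟨y.1.2, y.2.2⟩⟩
  left_inv x := Subtype.ext (e.symm_apply_apply x)
  right_inv y := by
    apply Prod.ext <;> apply Subtype.ext <;> simp
  map_rel_iff' := by
    intro x y
    change ((e x).1 ≤ (e y).1 ∧ (e x).2 ≤ (e y).2) ↔ (x : E) ≤ y
    rw [← e.le_iff_le]
    rfl

theorem nontrivial_Ici {x : E} (h : x ≠ ⊤) : Nontrivial (Set.Ici x) :=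
  ⟨⟨x, le_rfl⟩, ⟨⊤, le_top⟩, fun he => h (congrArg Subtype.val he)⟩

theorem atom_prod {A B : Type*} [Lattice A] [BoundedOrder A] [Lattice B] [BoundedOrder B]
    {x : A × B} (hx : IsAtom x) : x.1 = ⊥ ∨ x.2 = ⊥ := by
  have h : ((x.1, ⊥) : A × B) ≤ x := ⟨le_rfl, bot_le⟩
  rcases hx.le_iff.mp h with h1 | h1
  · exact Or.inl (congrArg Prod.fst h1)
  · exact Or.inr (congrArg Prod.snd h1).symm

theorem IsModExt.flat_ne_bot [Nontrivial L] (h : IsModExt ι) : ι ⊤ ≠ ⊥ := fun he =>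
  top_ne_bot (h.emb.injective (he.trans h.emb.map_bot.symm))

/-- The interval `[a, 1]` is a product of upper intervals of the two factors, so `prod` applies
again unless one of them is trivial. Both exceptions are excluded below. -/
theorem con_prod [Nontrivial L] (h : IsModExt ι) {a : E} {l : List E}
    (hJ : ∀ b ∈ a :: l, IsAtom b)
    {A B : Type u} [Lattice A] [BoundedOrder A] [IsGeometric A] [Nontrivial A] [Lattice B]
    [BoundedOrder B] [IsGeometric B] [Nontrivial B] (e : E ≃o A × B) (he : (e (ι ⊤)).2 = ⊥) :
    con h a l = 0 := by
  by_cases hc : (IsAtom a ∧ ¬ a ≤ ι ⊤) ∧ a ≤ ι ⊤ ⊔ lsup l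
  swap
  · exact con_of_not h hc
  by_cases hal : a ∈ l
  · exact con_eq_zero_of_mem h hal
  rw [con_of h hc.1.1 hc.1.2 hc.2]
  have hat : ∀ b, IsAtom b → (e b).1 = ⊥ ∨ (e b).2 = ⊥ := fun b hb =>
    atom_prod ((e.isAtom_iff b).mpr hb)
  -- If the first factor became trivial, `F_ι` would lie below the atom `a`; as `a` is not below
  -- `F_ι`, this would force `F_ι = ⊥`, which is impossible for a nontrivial `L`.
  have h1 : (e a).1 ≠ ⊤ := by
    rcases hat a hc.1.1 with h1 | h1
    · rw [h1]; exact bot_ne_top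
    · intro h2
      have h3 : ι ⊤ ≤ a := by
        rw [← e.le_iff_le]
        exact ⟨by rw [h2]; exact le_top, by rw [he]; exact bot_le⟩
      rcases hc.1.1.le_iff.mp h3 with h4 | h4
      · exact h.flat_ne_bot h4
      · exact hc.1.2 h4.ge
  -- If the second factor became trivial, `a` would be its only atom. All other letters and `F_ι`
  -- would lie in the first factor, so `a` would be a bridge.
  have h2 : (e a).2 ≠ ⊤ := by
    rcases hat a hc.1.1 with h2 | h2
    swap
    · rw [h2]; exact bot_ne_top
    intro h3
    have h4 : ι ⊤ ⊔ lsup l ≤ e.symm (⊤, ⊥) := by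
      refine sup_le ?_ (lsup_le_iff.mpr fun b hb => ?_)
      · rw [e.le_symm_apply]
        exact ⟨le_top, he.le⟩
      · rw [e.le_symm_apply]
        refine ⟨le_top, ?_⟩
        have hba := hJ b (List.mem_cons_of_mem _ hb)
        rcases hat b hba with h5 | h5
        · have h6 : b ≤ a := by
            rw [← e.le_iff_le]
            exact ⟨by rw [h5]; exact bot_le, by rw [h3]; exact le_top⟩
          rcases hc.1.1.le_iff.mp h6 with h7 | h7
          · exact absurd h7 hba.1
          · exact absurd (h7 ▸ hb) hal
        · exact h5.le
    have h5 := hc.2.trans h4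
    rw [e.le_symm_apply] at h5
    have h6 : (e a).2 ≤ ⊥ := h5.2
    rw [h3] at h6
    exact bot_ne_top (le_bot_iff.mp h6).symm
  have := nontrivial_Ici h1
  have := nontrivial_Ici h2
  refine wcls_prod _ _ (iciProd e a) (Subtype.ext ?_)
  change (e (a ⊔ ι ⊤)).2 = (e a).2
  rw [map_sup, Prod.snd_sup, he, sup_bot_eq]

/-- After contraction at a letter below `G`, the flat `G` is still modular and `a`, `b` still give
the only letters not below it. -/
theorem con_two_eq_zero (h : IsModExt ι) {G : E} (hG : IsModularElt G) (hFG : ι ⊤ ≤ G)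
    {a b c : E} {l : List E} (hc : c ≤ G) (ha : ¬ a ≤ G) (hb : ¬ b ≤ G) (hl : ∀ x ∈ l, x ≤ G) :
    con h c (a :: b :: l) = 0 := by
  by_cases hcc : (IsAtom c ∧ ¬ c ≤ ι ⊤) ∧ c ≤ ι ⊤ ⊔ lsup (a :: b :: l)
  · rw [con_of h hcc.1.1 hcc.1.2 hcc.2]
    refine wcls_two _ (hG.of_Ici hc) (show c ⊔ ι ⊤ ≤ G from sup_le hc hFG) (List.Perm.refl _)
      ((toIci_le_iff hc).not.mpr ha) ((toIci_le_iff hc).not.mpr hb) ?_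
    intro x hx
    obtain ⟨y, hy, rfl⟩ := List.mem_map.mp hx
    exact (toIci_le_iff hc).mpr (hl y hy)
  · exact con_of_not h hcc

/-- Since `a` is a complement of `G`, joining with `a` embeds `[0, G]` in `[a, 1]`, and the relation
`emb` moves the contraction to `[0, G]`. The letter `b` becomes the intersection of the line `a ⊔ b`
with `G`. -/
theorem con_eq_restrict (h : IsModExt ι) {G : E} (hG : IsModularElt G) (hFG : ι ⊤ ≤ G)
    (hr : IsModExt fun z => (⟨ι z, (h.emb.monotone le_top).trans hFG⟩ : Set.Iic G))
    {a b : E} (l : List (Set.Iic G)) (ha : IsAtom a) (haG : ¬ a ≤ G) (htop : a ⊔ G = ⊤)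
    (hal : a ≤ ι ⊤ ⊔ lsup (b :: l.map (↑))) :
    con h a (b :: l.map (↑)) = wcls hr (⟨(a ⊔ b) ⊓ G, inf_le_right⟩ :: l) := by
  have := IsGeometric.finite (L := E)
  have haF : ¬ a ≤ ι ⊤ := fun h => haG (h.trans hFG)
  have hdisj : G ⊓ a = ⊥ := by
    rcases ha.le_iff.mp (inf_le_right : G ⊓ a ≤ a) with h1 | h1
    · exact h1
    · exact absurd (inf_eq_right.mp h1) haG
  rw [con_of h ha haF hal, ← wcls_emb hr (h.contract ha haF) (φ := fun x => toIci a x) ?_ ?_ ?_]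
  · rw [List.map_cons, List.map_cons, List.map_map]
    congr 2
    apply Subtype.ext
    change a ⊔ b = a ⊔ (a ⊔ b) ⊓ G
    rw [← modular_law' hG le_sup_left, htop, inf_top_eq]
  · refine ⟨?_, Subtype.ext (sup_bot_eq a), fun x y => Subtype.ext (sup_sup_distrib_left a _ _), ?_⟩
    · intro x y hxy
      have h1 : a ⊔ (x : E) = a ⊔ y := congrArg Subtype.val hxy
      have h2 := modular_law hG x.2 a
      have h3 := modular_law hG y.2 a
      rw [hdisj, sup_bot_eq, sup_comm] at h2 h3
      exact Subtype.ext (by rw [← h2, h1, h3])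
    · intro x hx
      refine isAtom_toIci ha ((isEmb_coe_Iic G).map_atom x hx) ?_
      rintro rfl
      exact haG x.2
  -- Adding the atom `a` to `G` gives the top, so both intervals have rank one less than `E`.
  · rw [rk_Iic, rk_Ici]
    change rk G = rk (⊤ : E) - rk a
    rw [← htop, rk_atom_sup ha haG, rk_atom ha]
    rfl
  · intro z
    rfl

/-- The heart of the compatibility of `d` with `two`. By exchange, `a` and `b` are both bridges or
both not. In the latter case `a ⊔ G = b ⊔ G`; if this is not the top, both sides vanish by `low`,
and otherwise `con_eq_restrict` gives a class on `[0, G]` that depends on `a` and `b` through `a ⊔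
b` only. -/
theorem con_two_comm (h : IsModExt ι) {G : E} (hG : IsModularElt G) (hFG : ι ⊤ ≤ G)
    {a b : E} {l : List E} (ha : IsAtom a) (hb : IsAtom b) (haG : ¬ a ≤ G) (hbG : ¬ b ≤ G)
    (hl : ∀ x ∈ l, x ≤ G) : con h a (b :: l) = con h b (a :: l) := by
  have haF : ¬ a ≤ ι ⊤ := fun h => haG (h.trans hFG)
  have hbF : ¬ b ≤ ι ⊤ := fun h => hbG (h.trans hFG)
  have hlG : ι ⊤ ⊔ lsup l ≤ G := sup_le hFG (lsup_le_iff.mpr hl)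
  have key : ∀ {x y : E}, IsAtom x → IsAtom y → ¬ x ≤ G →
      x ≤ ι ⊤ ⊔ lsup (y :: l) → y ≤ ι ⊤ ⊔ lsup (x :: l) := by
    intro x y hx hy hxG
    rw [lsup_cons, lsup_cons, sup_left_comm, sup_left_comm _ x]
    exact atom_exchange hx hy fun hle => hxG (hle.trans hlG)
  by_cases hal : a ≤ ι ⊤ ⊔ lsup (b :: l)
  swap
  · rw [con_of_not h fun hc => hal hc.2, con_of_not h fun hc => hal (key hb ha hbG hc.2)]
  have hbl := key ha hb haG hal
  have hle : ∀ {x y : E}, x ≤ ι ⊤ ⊔ lsup (y :: l) → x ⊔ G ≤ y ⊔ G := by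
    intro x y hx
    rw [lsup_cons, sup_left_comm] at hx
    exact sup_le (hx.trans (sup_le_sup_left hlG y)) le_sup_right
  have hab : a ⊔ G = b ⊔ G := le_antisymm (hle hal) (hle hbl)
  rcases (le_top : a ⊔ G ≤ ⊤).lt_or_eq with htop | htop
  · have hlow : ι ⊤ ⊔ lsup (a :: b :: l) < ⊤ := by
      refine lt_of_le_of_lt ?_ htop
      rw [lsup_cons, lsup_cons]
      refine sup_le (hFG.trans le_sup_right) (sup_le le_sup_left (sup_le ?_ ?_))
      · rw [hab]; exact le_sup_left
      · exact (le_sup_right.trans hlG).trans le_sup_right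
    rw [con_low h hlow, con_low h]
    rwa [lsup_perm (List.Perm.swap a b l)]
  · lift l to List (Set.Iic G) using hl
    have hr : IsModExt fun z => (⟨ι z, (h.emb.monotone le_top).trans hFG⟩ : Set.Iic G) :=
      h.restrict (j := fun x => x) isModExt_id.intervalEmb G
        (top_le_iff.mp (h.le_trace_iff.mpr hFG)).symm
    rw [con_eq_restrict h hG hFG hr l ha haG htop hal,
      con_eq_restrict h hG hFG hr l hb hbG (hab ▸ htop) hbl]
    simp only [sup_comm a b]

/-! ### The differential -/

/-- The smallest flat above `F_ι` and all other letters is their join, so it suffices to test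
bridges on this flat. -/
theorem ModularDiagram.isContractible_iff (Γ : ModularDiagram L) (hJ : Γ.J.Nodup)
    (i : Fin Γ.J.length) : Γ.IsContractible (Γ.J.get i) ↔
      (IsAtom (Γ.J.get i) ∧ ¬ Γ.J.get i ≤ Γ.ι ⊤) ∧
        Γ.J.get i ≤ Γ.ι ⊤ ⊔ lsup (Γ.J.eraseIdx i) := by
  have hmem : Γ.J.get i ∈ Γ.J := List.get_mem _ _
  have hb : Γ.IsBridge (Γ.J.get i) ↔ ¬ Γ.J.get i ≤ Γ.ι ⊤ ⊔ lsup (Γ.J.eraseIdx i) := by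
    constructor
    · rintro ⟨-, G, hFG, hG, hK⟩ hle
      refine hG (hle.trans (sup_le hFG (lsup_le_iff.mpr fun K hKm => ?_)))
      exact hK K (List.mem_of_mem_eraseIdx hKm) fun he =>
        get_not_mem_eraseIdx hJ i (he ▸ hKm)
    · intro hle
      refine ⟨hmem, _, le_sup_left, hle, fun K hK hne => ?_⟩
      refine le_sup_of_le_right (le_lsup ?_)
      rw [List.mem_eraseIdx_iff_getElem]
      obtain ⟨j, hj, rfl⟩ := List.mem_iff_getElem.mp hK
      exact ⟨j, hj, fun hji => hne (by subst hji; rfl), rfl⟩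
  rw [IsContractible, hb, not_not]
  exact ⟨fun h => ⟨⟨Γ.atoms _ hmem, h.2.2⟩, h.2.1⟩, fun h => ⟨hmem, h.2, h.1.2⟩⟩

theorem ModularDiagram.dCls_eq (Γ : ModularDiagram L) : Γ.dCls = altSum (con Γ.ext) Γ.J := by
  classical
  by_cases hJ : Γ.J.Nodup
  · rw [dCls, dif_pos hJ, altSum_eq_sum]
    refine Finset.sum_congr rfl fun i _ => ?_
    by_cases hi : Γ.IsContractible (Γ.J.get i)
    · have hc := (Γ.isContractible_iff hJ i).mp hi
      rw [dif_pos hi, con_of Γ.ext hc.1.1 hc.1.2 hc.2]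
      congr 1
      exact (Γ.contract hJ i hi.2.2).wcls_eq.symm
    · rw [dif_neg hi, con_of_not _ fun hc => hi ((Γ.isContractible_iff hJ i).mpr hc), smul_zero]
  · rw [dCls, dif_neg hJ, (isAlternating_altSum (con_alternating Γ.ext)).eq_zero_of_not_nodup hJ]

/-- Nontriviality of `L` enters through `prod` only: it ensures that contraction does not trivialize
the factor containing `F_ι`. -/
theorem respectsRel_dCls [Nontrivial L] : RespectsRel (ModularDiagram.dCls (L := L)) where
  swap Γ l₁ l₂ a b h h' := by
    rw [ModularDiagram.dCls_eq, ModularDiagram.dCls_eq, h]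
    exact isAlternating_altSum (con_alternating Γ.ext) l₁ a b l₂
  emb Γ Γ' φ hφ hrk hι hJ := by
    rw [ModularDiagram.dCls_eq, ModularDiagram.dCls_eq, hJ, altSum_map]
    exact altSum_congr fun a l _ => (con_emb Γ.ext Γ'.ext hφ hrk hι a l).symm
  low Γ h := by
    rw [ModularDiagram.dCls_eq]
    refine altSum_eq_zero fun a l hal => con_low Γ.ext ?_
    rw [lsup_perm hal]
    exact h
  prod Γ A B _ _ _ _ _ _ _ _ e he := by
    rw [ModularDiagram.dCls_eq]
    exact altSum_eq_zero fun a l hal =>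
      con_prod Γ.ext (fun b hb => Γ.atoms b (hal.mem_iff.mp hb)) e he
  two Γ G hG hFG hcard := by
    rw [ModularDiagram.dCls_eq]
    have halt := isAlternating_altSum (con_alternating Γ.ext)
    by_cases hJ : Γ.J.Nodup
    · obtain ⟨a, b, l, hp, ha, hb, hl⟩ := exists_perm_of_ncard_two hJ hcard
      refine halt.eq_zero_of_perm hp ?_
      simp only [altSum]
      -- With `a` and `b` moved to the front, their contractions have signs `+` and `-` and cancel.
      rw [con_two_comm Γ.ext hG hFG (Γ.atoms a (hp.mem_iff.mpr (by simp)))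
        (Γ.atoms b (hp.mem_iff.mpr (by simp))) ha hb hl, sub_sub_cancel]
      refine altSum_eq_zero fun c l' hcl => ?_
      exact con_two_eq_zero Γ.ext hG hFG (hl c (hcl.mem_iff.mp (by simp))) ha hb
        fun x hx => hl x (hcl.mem_iff.mp (by simp [hx]))
    · exact halt.eq_zero_of_not_nodup hJ

theorem exists_isDifferential [Nontrivial L] : ∃ d : MD L →ₗ[ℚ] MD L, IsDifferential d :=
  respectsRel_dCls.exists_lift

theorem IsDifferential.wcls_eq {d : MD L →ₗ[ℚ] MD L} (hd : IsDifferential d) (h : IsModExt ι)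
    {J : List E} (hJ : ∀ H ∈ J, IsAtom H) : d (wcls h J) = altSum (con h) J := by
  rw [wcls_of_atoms h hJ, hd, ModularDiagram.dCls_eq]

/-! ### The square of the differential -/

open Classical in
/-- The contraction at `a` and then at `b`. -/
noncomputable def conCon (h : IsModExt ι) (a b : E) (l : List E) : MD L :=
  if c : (IsAtom a ∧ ¬ a ≤ ι ⊤) ∧ a ≤ ι ⊤ ⊔ lsup (b :: l) then
    con (h.contract c.1.1 c.1.2) (toIci a b) (l.map (toIci a)) else 0

/-- The condition for a contraction at `a` and then at `b`. -/
structure Contractible₂ (ι : L → E) (a b : E) (l : List E) : Prop where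
  not_le : ¬ a ≤ ι ⊤
  le : a ≤ ι ⊤ ⊔ lsup (b :: l)
  not_le' : ¬ b ≤ a ⊔ ι ⊤
  le' : b ≤ a ⊔ ι ⊤ ⊔ lsup l

/-- The two conditions on membership in the spanned flat are interchanged. The condition that `b` is
not below `a ⊔ ι ⊤` is symmetric by the exchange property. -/
theorem Contractible₂.symm {a b : E} {l : List E} (h : Contractible₂ ι a b l) (ha : IsAtom a)
    (hb : IsAtom b) : Contractible₂ ι b a l where
  not_le := fun h1 => h.not_le' (h1.trans le_sup_right)
  le := by
    rw [lsup_cons, sup_left_comm, ← sup_assoc]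
    exact h.le'
  not_le' := fun h1 => h.not_le' (atom_exchange ha hb h.not_le h1)
  le' := by
    have := h.le
    rwa [lsup_cons, sup_left_comm, ← sup_assoc] at this

theorem con_toIci_cond {a b : E} {l : List E} :
    (¬ toIci a b ≤ toIci a (ι ⊤) ∧
      toIci a b ≤ toIci a (ι ⊤) ⊔ lsup (l.map (toIci a))) ↔
      ¬ b ≤ a ⊔ ι ⊤ ∧ b ≤ a ⊔ ι ⊤ ⊔ lsup l := by
  rw [lsup_map_toIci]
  change (¬ a ⊔ b ≤ a ⊔ ι ⊤ ∧ a ⊔ b ≤ (a ⊔ ι ⊤) ⊔ (a ⊔ lsup l)) ↔ _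
  rw [← sup_sup_distrib_left, ← sup_assoc, sup_le_iff, sup_le_iff,
    and_iff_right (le_sup_left : a ≤ a ⊔ ι ⊤),
    and_iff_right (le_sup_left.trans le_sup_left : a ≤ a ⊔ ι ⊤ ⊔ lsup l)]

theorem conCon_of_not (h : IsModExt ι) {a b : E} {l : List E} (hc : ¬ Contractible₂ ι a b l) :
    conCon h a b l = 0 := by
  by_cases c : (IsAtom a ∧ ¬ a ≤ ι ⊤) ∧ a ≤ ι ⊤ ⊔ lsup (b :: l)
  · rw [conCon, dif_pos c]
    refine con_of_not _ fun hc' => hc ?_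
    have := con_toIci_cond.mp ⟨hc'.1.2, hc'.2⟩
    exact ⟨c.1.2, c.2, this.1, this.2⟩
  · exact dif_neg c

/-- Iterated upper intervals do not depend on the order. -/
def iciIciComm (a b : E) : Set.Ici (toIci a b) ≃o Set.Ici (toIci b a) where
  toFun x := ⟨⟨x.1.1, le_sup_left.trans
      (le_of_eq_of_le (sup_comm b a) (show a ⊔ b ≤ x.1.1 from x.2))⟩,
    le_of_eq_of_le (sup_comm b a) (show a ⊔ b ≤ x.1.1 from x.2)⟩
  invFun x := ⟨⟨x.1.1, le_sup_left.trans
      (le_of_eq_of_le (sup_comm a b) (show b ⊔ a ≤ x.1.1 from x.2))⟩,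
    le_of_eq_of_le (sup_comm a b) (show b ⊔ a ≤ x.1.1 from x.2)⟩
  left_inv _ := rfl
  right_inv _ := rfl
  map_rel_iff' := Iff.rfl

/-- Both iterated contractions are diagrams on the interval above `a ⊔ b`, with the same extension
and the same word, and they are defined under equivalent conditions. -/
theorem conCon_comm (h : IsModExt ι) {a b : E} {l : List E} (ha : IsAtom a) (hb : IsAtom b)
    (hab : a ≠ b) : conCon h a b l = conCon h b a l := by
  have key : ∀ x : E, iciIciComm a b (toIci (toIci a b) (toIci a x)) =
      toIci (toIci b a) (toIci b x) := by
    intro x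
    apply Subtype.ext
    apply Subtype.ext
    change (a ⊔ b) ⊔ (a ⊔ x) = (b ⊔ a) ⊔ (b ⊔ x)
    rw [← sup_assoc, ← sup_assoc, sup_eq_left.mpr (le_sup_left : a ≤ a ⊔ b),
      sup_eq_left.mpr (le_sup_left : b ≤ b ⊔ a), sup_comm a b]
  by_cases hc : Contractible₂ ι a b l
  · have hc' := hc.symm ha hb
    rw [conCon, dif_pos ⟨⟨ha, hc.not_le⟩, hc.le⟩, conCon, dif_pos ⟨⟨hb, hc'.not_le⟩, hc'.le⟩]
    have h1 := con_toIci_cond.mpr ⟨hc.not_le', hc.le'⟩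
    have h2 := con_toIci_cond.mpr ⟨hc'.not_le', hc'.le'⟩
    rw [con_of _ (isAtom_toIci ha hb hab) h1.1 h1.2,
      con_of _ (isAtom_toIci hb ha hab.symm) h2.1 h2.2,
      ← wcls_orderIso (IsModExt.contract (h.contract ha hc.not_le) (isAtom_toIci ha hb hab) h1.1)
        (IsModExt.contract (h.contract hb hc'.not_le) (isAtom_toIci hb ha hab.symm) h2.1)
        (iciIciComm a b) (fun z => (key (ι z)).symm), List.map_map, List.map_map, List.map_map]
    congr 1
    exact List.map_congr_left fun x _ => key x
  · rw [conCon_of_not h hc, conCon_of_not h fun hc' => hc (hc'.symm hb ha)]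

theorem IsDifferential.sq_eq_zero {d : MD L →ₗ[ℚ] MD L} (hd : IsDifferential d) (x : MD L) :
    d (d x) = 0 := by
  suffices h : d ∘ₗ d = 0 from LinearMap.congr_fun h x
  refine MD_hom_ext fun Γ => ?_
  change d (d Γ.cls) = 0
  rw [hd, ModularDiagram.dCls_eq]
  by_cases hJ : Γ.J.Nodup
  swap
  · rw [(isAlternating_altSum (con_alternating Γ.ext)).eq_zero_of_not_nodup hJ, map_zero]
  rw [map_altSum, altSum_congr (g := fun a l => altSum (conCon Γ.ext a) l) fun a l hal => ?_]
  · refine altSum_altSum_eq_zero fun a b l hp => ?_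
    refine conCon_comm Γ.ext (Γ.atoms a (hp.mem_iff.mp (by simp)))
      (Γ.atoms b (hp.mem_iff.mp (by simp))) ?_
    rintro rfl
    have := hp.nodup_iff.mpr hJ
    simp at this
  · have hnd : a ∉ l := (List.nodup_cons.mp (hal.nodup_iff.mpr hJ)).1
    by_cases hc : (IsAtom a ∧ ¬ a ≤ Γ.ι ⊤) ∧ a ≤ Γ.ι ⊤ ⊔ lsup l
    · rw [con_of Γ.ext hc.1.1 hc.1.2 hc.2, hd.wcls_eq, altSum_map]
      · refine altSum_congr fun b l' hbl => ?_
        -- The word `b :: l'` rearranges `l`, so the test for `a` in `conCon` has the same outcome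
        -- for every choice of `b`.
        rw [conCon, dif_pos]
        rwa [lsup_perm hbl]
      · intro K hK
        obtain ⟨b, hb, rfl⟩ := List.mem_map.mp hK
        exact isAtom_toIci hc.1.1 (Γ.atoms b (hal.mem_iff.mp (by simp [hb])))
          fun he => hnd (he ▸ hb)
    · rw [con_of_not Γ.ext hc, map_zero]
      refine (altSum_eq_zero fun b l' hbl => ?_).symm
      rw [conCon, dif_neg]
      rwa [lsup_perm hbl]

/-! ### The differential and the gradings -/

theorem cls_mem_degPart (Γ : ModularDiagram L) : Γ.cls ∈ degPart L Γ.deg :=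
  Submodule.subset_span ⟨Γ, rfl, rfl⟩

theorem cls_mem_grPart (Γ : ModularDiagram L) : Γ.cls ∈ grPart Γ.gr :=
  Submodule.subset_span ⟨Γ, rfl, rfl⟩

theorem wcls_mem_degPart (h : IsModExt ι) (J : List E) :
    wcls h J ∈ degPart L
      ((J.length : ℤ) - 2 * ((rk (ι ⊤ ⊔ lsup J) : ℤ) - (rk (ι ⊤) : ℤ))) := by
  by_cases hJ : ∀ H ∈ J, IsAtom H
  · rw [wcls_of_atoms h hJ]
    have := cls_mem_degPart (ModularDiagram.mk E ι h J hJ)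
    rwa [ModularDiagram.deg_eq] at this
  · rw [wcls_of_not_atoms h hJ]
    exact Submodule.zero_mem _

theorem wcls_mem_grPart (h : IsModExt ι) (J : List E) :
    wcls h J ∈ grPart (trace ι (lsup J)) := by
  by_cases hJ : ∀ H ∈ J, IsAtom H
  · rw [wcls_of_atoms h hJ]
    exact cls_mem_grPart (ModularDiagram.mk E ι h J hJ)
  · rw [wcls_of_not_atoms h hJ]
    exact Submodule.zero_mem _

/-- The word loses one letter. The rank of `F_ι ∨ ⋁ J` drops by one while that of the new modular
flat remains `rk F_ι`, as `a` is not below `F_ι`. The degree thus changes by `-1 + 2`. -/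
theorem con_mem_degPart (h : IsModExt ι) (a : E) (l : List E) :
    con h a l ∈ degPart L
      (((a :: l).length : ℤ) - 2 * ((rk (ι ⊤ ⊔ lsup (a :: l)) : ℤ) - (rk (ι ⊤) : ℤ)) + 1) := by
  have := IsGeometric.finite (L := E)
  by_cases hc : (IsAtom a ∧ ¬ a ≤ ι ⊤) ∧ a ≤ ι ⊤ ⊔ lsup l
  · rw [con_of h hc.1.1 hc.1.2 hc.2]
    have h1 := wcls_mem_degPart (h.contract hc.1.1 hc.1.2) (l.map (toIci a))
    convert h1 using 2
    rw [rk_Ici, rk_Ici, lsup_map_toIci]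
    change _ = _ - 2 * (((rk ((a ⊔ ι ⊤) ⊔ (a ⊔ lsup l)) - rk a : ℕ) : ℤ) -
      ((rk (a ⊔ ι ⊤) - rk a : ℕ) : ℤ))
    have e : (a ⊔ ι ⊤) ⊔ (a ⊔ lsup l) = ι ⊤ ⊔ lsup (a :: l) := by
      rw [← sup_sup_distrib_left, sup_left_comm, lsup_cons]
    rw [e, rk_atom_sup hc.1.1 hc.1.2, rk_atom hc.1.1]
    have h2 : rk (a ⊔ ι ⊤) ≤ rk (ι ⊤ ⊔ lsup (a :: l)) := by
      rw [lsup_cons]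
      exact rk_mono (sup_le (le_sup_left.trans le_sup_right) le_sup_left)
    rw [rk_atom_sup hc.1.1 hc.1.2] at h2
    simp only [List.length_cons, List.length_map]
    omega
  · rw [con_of_not h hc]
    exact Submodule.zero_mem _

/-- By the modular law, `(a ⊔ x) ⊓ (a ⊔ ι ⊤)` is `a ⊔ ((a ⊔ x) ⊓ ι ⊤)`. Hence contraction does not
change the grading. -/
theorem trace_contract (h : IsModExt ι) {a : E} (ha : IsAtom a) (haF : ¬ a ≤ ι ⊤) (x : E) :
    trace (fun z => (⟨a ⊔ ι z, le_sup_left⟩ : Set.Ici a)) (toIci a x) = trace ι (a ⊔ x) := by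
  apply (h.contract ha haF).emb.injective
  refine ((h.contract ha haF).map_trace _).trans ?_
  apply Subtype.ext
  change (a ⊔ x) ⊓ (a ⊔ ι ⊤) = a ⊔ ι (trace ι (a ⊔ x))
  rw [h.map_trace, modular_law' h.modular le_sup_left]

theorem con_mem_grPart (h : IsModExt ι) (a : E) (l : List E) :
    con h a l ∈ grPart (trace ι (lsup (a :: l))) := by
  by_cases hc : (IsAtom a ∧ ¬ a ≤ ι ⊤) ∧ a ≤ ι ⊤ ⊔ lsup l
  · rw [con_of h hc.1.1 hc.1.2 hc.2]
    have h1 := wcls_mem_grPart (h.contract hc.1.1 hc.1.2) (l.map (toIci a))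
    rwa [lsup_map_toIci, trace_contract h hc.1.1 hc.1.2] at h1
  · rw [con_of_not h hc]
    exact Submodule.zero_mem _

theorem IsDifferential.map_degPart {d : MD L →ₗ[ℚ] MD L} (hd : IsDifferential d) {k : ℤ}
    {x : MD L} (hx : x ∈ degPart L k) : d x ∈ degPart L (k + 1) := by
  have h : degPart L k ≤ (degPart L (k + 1)).comap d := by
    refine Submodule.span_le.mpr ?_
    rintro _ ⟨Γ, rfl, rfl⟩
    rw [SetLike.mem_coe, Submodule.mem_comap, hd, ModularDiagram.dCls_eq]
    refine altSum_mem _ fun a l hal => ?_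
    rw [Γ.deg_eq, ← hal.length_eq, ← lsup_perm hal]
    exact con_mem_degPart Γ.ext a l
  exact h hx

theorem IsDifferential.isSubcomplex {d : MD L →ₗ[ℚ] MD L} (hd : IsDifferential d) (F : L) :
    IsSubcomplex d (grPart F) := by
  refine ⟨le_antisymm (Submodule.span_le.mpr ?_) (iSup_le fun _ => inf_le_left), ?_⟩
  · rintro _ ⟨Γ, rfl, rfl⟩
    exact Submodule.mem_iSup_of_mem Γ.deg ⟨cls_mem_grPart Γ, cls_mem_degPart Γ⟩
  · have h : grPart F ≤ (grPart F).comap d := by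
      refine Submodule.span_le.mpr ?_
      rintro _ ⟨Γ, rfl, rfl⟩
      rw [SetLike.mem_coe, Submodule.mem_comap, hd, ModularDiagram.dCls_eq]
      refine altSum_mem _ fun a l hal => ?_
      change _ ∈ grPart (trace Γ.ι (lsup Γ.J))
      rw [← lsup_perm hal]
      exact con_mem_grPart Γ.ext a l
    exact fun x hx => h hx

end Contraction

/-! ### Amalgams of a modular extension with another lattice -/

section Amalgam

variable {M N E E' : Type*} [Lattice M] [BoundedOrder M] [Lattice N] [BoundedOrder N]
  [Lattice E] [BoundedOrder E] [Lattice E'] [BoundedOrder E'] {j : M → N} {ι : M → E}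
  {ι' : M → E'}

/-- The amalgam of `N` and `E` over the common lower interval `M`, which is the interval below a
modular element of `E`. -/
def Amalg (hj : IsIntervalEmb j) (h : IsModExt ι) : Type _ :=
  {p : N × E // trace j p.1 = trace ι p.2}

variable (hj : IsIntervalEmb j) (h : IsModExt ι) (h' : IsModExt ι')

instance : PartialOrder (Amalg hj h) := inferInstanceAs (PartialOrder {p : N × E // _})

variable [IsGeometric N] [IsGeometric E] [IsGeometric E']

/-- The join needs two corrections. The first component receives the trace of the second, which may
enlarge its own trace as `j ⊤` need not be modular; the second then receives this trace. Modularity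
of `ι ⊤` ensures that nothing more is added, so the process stops. -/
noncomputable instance : Lattice (Amalg hj h) :=
  { (inferInstance : PartialOrder (Amalg hj h)) with
    inf := fun p q => ⟨p.1 ⊓ q.1, by
      rw [Prod.fst_inf, Prod.snd_inf, hj.trace_inf, h.trace_inf, p.2, q.2]⟩
    sup := fun p q => ⟨(p.1.1 ⊔ q.1.1 ⊔ j (trace ι (p.1.2 ⊔ q.1.2)), p.1.2 ⊔ q.1.2 ⊔
        ι (trace j (p.1.1 ⊔ q.1.1 ⊔ j (trace ι (p.1.2 ⊔ q.1.2))))), by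
      rw [h.trace_sup]
      exact (sup_eq_right.mpr (hj.le_trace_iff.mpr le_sup_right)).symm⟩
    inf_le_left := fun p q => (inf_le_left : p.1 ⊓ q.1 ≤ p.1)
    inf_le_right := fun p q => (inf_le_right : p.1 ⊓ q.1 ≤ q.1)
    le_inf := fun p q r hq hr => (le_inf hq hr : p.1 ≤ q.1 ⊓ r.1)
    le_sup_left := fun p q => ⟨le_sup_left.trans le_sup_left, le_sup_left.trans le_sup_left⟩
    le_sup_right := fun p q => ⟨le_sup_right.trans le_sup_left, le_sup_right.trans le_sup_left⟩
    sup_le := fun p q r hp hq => by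
      have a2 : p.1.2 ⊔ q.1.2 ≤ r.1.2 := sup_le hp.2 hq.2
      have a1 : p.1.1 ⊔ q.1.1 ⊔ j (trace ι (p.1.2 ⊔ q.1.2)) ≤ r.1.1 :=
        sup_le (sup_le hp.1 hq.1) (hj.le_trace_iff.mp ((h.trace_mono a2).trans r.2.ge))
      exact ⟨a1, sup_le a2 (h.le_trace_iff.mp ((hj.trace_mono a1).trans r.2.le))⟩ }

noncomputable instance : BoundedOrder (Amalg hj h) where
  top := ⟨⊤, by rw [Prod.fst_top, Prod.snd_top, hj.trace_top, h.trace_top]⟩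
  bot := ⟨⊥, by rw [Prod.fst_bot, Prod.snd_bot, hj.trace_bot, h.trace_bot]⟩
  le_top p := (le_top : p.1 ≤ ⊤)
  bot_le p := (bot_le : ⊥ ≤ p.1)

variable {hj h}

theorem Amalg.ext {p q : Amalg hj h} (h1 : p.1.1 = q.1.1) (h2 : p.1.2 = q.1.2) : p = q :=
  Subtype.ext (Prod.ext h1 h2)

theorem Amalg.fst_sup (p q : Amalg hj h) :
    (p ⊔ q).1.1 = p.1.1 ⊔ q.1.1 ⊔ j (trace ι (p.1.2 ⊔ q.1.2)) := rfl

theorem Amalg.snd_sup (p q : Amalg hj h) :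
    (p ⊔ q).1.2 = p.1.2 ⊔ q.1.2 ⊔ ι (trace j (p ⊔ q).1.1) := rfl

variable (hj h)

/-- The embedding of the first lattice in the amalgam. -/
noncomputable def Amalg.inl (x : N) : Amalg hj h := ⟨(x, ι (trace j x)), (h.trace_map _).symm⟩

/-- The embedding of the second lattice in the amalgam. -/
noncomputable def Amalg.inr (y : E) : Amalg hj h := ⟨(j (trace ι y), y), hj.trace_map _⟩

/-- The element of the amalgam given by an element above the modular flat. -/
noncomputable def Amalg.upper (y : E) (hy : ι ⊤ ≤ y) : Amalg hj h :=
  ⟨(⊤, y), hj.trace_top.trans (top_le_iff.mp (h.le_trace_iff.mpr hy)).symm⟩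

variable {hj h}

/-- `Amalg.inl` is left adjoint to the first projection, and `Amalg.inr` to the second. This is why
both preserve joins. -/
theorem Amalg.inl_le_iff {x : N} {p : Amalg hj h} : inl hj h x ≤ p ↔ x ≤ p.1.1 :=
  ⟨fun hle => hle.1, fun hle => ⟨hle, h.le_trace_iff.mp ((hj.trace_mono hle).trans p.2.le)⟩⟩

theorem Amalg.inr_le_iff {y : E} {p : Amalg hj h} : inr hj h y ≤ p ↔ y ≤ p.1.2 :=
  ⟨fun hle => hle.2, fun hle => ⟨hj.le_trace_iff.mp ((h.trace_mono hle).trans p.2.ge), hle⟩⟩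

theorem IsModExt.relRk_map (h : IsModExt ι) (z : M) : relRk ι (ι z) = 0 := by
  have := h.relRk_add (ι z)
  rw [h.trace_map, h.rk_map] at this
  omega

variable [IsGeometric M] (hj h)

/-- The rank counts the first component in full and the second relative to the common part.
Semimodularity adds the relative inequality in `E` to two semimodular inequalities in `N`; the
traces on `M` that occur cancel by `s4`. Atoms come from both lattices. -/
theorem amalg_geometric :
    IsGeometric (Amalg hj h) ∧ ∀ p : Amalg hj h, rk p = rk p.1.1 + relRk ι p.1.2 := by
  have := IsGeometric.finite (L := N)
  have := IsGeometric.finite (L := E)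
  have : Finite (Amalg hj h) := inferInstanceAs (Finite {p : N × E // _})
  apply geometric_of_rank
  · intro p q hpq
    have hle : p.1 ≤ q.1 := hpq.le
    by_contra! hcon
    have m1 := IsModExt.relRk_mono (ι := ι) hle.2
    have m2 := rk_mono hle.1
    have e1 : p.1.1 = q.1.1 := eq_of_le_of_rk hle.1 (by omega)
    have a1 := h.relRk_add p.1.2
    have a2 := h.relRk_add q.1.2
    rw [← p.2, e1] at a1
    rw [← q.2] at a2
    have e2 : p.1.2 = q.1.2 := eq_of_le_of_rk hle.2 (by omega)
    exact hpq.ne (Amalg.ext e1 e2)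
  · change rk (⊥ : N) + relRk ι ⊥ = 0
    rw [rk_bot, relRk, bot_sup_eq, Nat.sub_self]
  · intro p q
    rw [Amalg.snd_sup, h.relRk_sup, Amalg.fst_sup]
    change rk (p.1.1 ⊓ q.1.1) + relRk ι (p.1.2 ⊓ q.1.2) + _ ≤ _
    have s1 := h.relRk_semi p.1.2 q.1.2
    have s2 := IsGeometric.semimodular (p.1.1 ⊔ q.1.1) (j (trace ι (p.1.2 ⊔ q.1.2)))
    have s3 := IsGeometric.semimodular p.1.1 q.1.1
    have s4 : rk (trace ι p.1.2 ⊔ trace ι q.1.2) ≤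
        rk ((p.1.1 ⊔ q.1.1) ⊓ j (trace ι (p.1.2 ⊔ q.1.2))) := by
      rw [← hj.emb.rk_map]
      refine rk_mono (le_inf ?_ (hj.emb.monotone (sup_le (h.trace_mono le_sup_left)
        (h.trace_mono le_sup_right))))
      rw [hj.emb.map_sup, ← p.2, ← q.2]
      exact sup_le_sup (hj.le_trace_iff.mp le_rfl) (hj.le_trace_iff.mp le_rfl)
    rw [hj.emb.rk_map] at s2
    omega
  · intro p
    obtain ⟨S, hS, hSlub⟩ := IsGeometric.atomistic p.1.1
    obtain ⟨T, hT, hTlub⟩ := IsGeometric.atomistic p.1.2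
    refine ⟨Amalg.inl hj h '' S ∪ Amalg.inr hj h '' T, ?_, ?_, ?_⟩
    · rintro _ (⟨a, ha, rfl⟩ | ⟨a, ha, rfl⟩)
      · change rk a + relRk ι (ι (trace j a)) = 1
        rw [h.relRk_map, rk_atom (hS a ha)]
      · change rk (j (trace ι a)) + relRk ι a = 1
        rw [hj.emb.rk_map, add_comm, h.relRk_add, rk_atom (hT a ha)]
    · rintro _ (⟨a, ha, rfl⟩ | ⟨a, ha, rfl⟩)
      · exact Amalg.inl_le_iff.mpr (hSlub.1 ha)
      · exact Amalg.inr_le_iff.mpr (hTlub.1 ha)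
    · intro q hq
      exact ⟨hSlub.2 fun a ha => Amalg.inl_le_iff.mp (hq (Or.inl ⟨a, ha, rfl⟩)),
        hTlub.2 fun a ha => Amalg.inr_le_iff.mp (hq (Or.inr ⟨a, ha, rfl⟩))⟩

instance : IsGeometric (Amalg hj h) := (amalg_geometric hj h).1

variable {hj h} in
theorem Amalg.rk_eq (p : Amalg hj h) : rk p = rk p.1.1 + relRk ι p.1.2 := (amalg_geometric hj h).2 p

theorem Amalg.rk_inl (x : N) : rk (inl hj h x) = rk x := by
  rw [rk_eq]
  change rk x + relRk ι (ι (trace j x)) = _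
  rw [h.relRk_map, add_zero]

theorem Amalg.rk_inr (y : E) : rk (inr hj h y) = rk y := by
  rw [rk_eq]
  change rk (j (trace ι y)) + relRk ι y = _
  rw [hj.emb.rk_map, add_comm, h.relRk_add]

theorem Amalg.isEmb_inr : IsEmb (inr hj h) := by
  have := IsGeometric.finite (L := E)
  have := IsGeometric.finite (L := Amalg hj h)
  refine ⟨fun x y hxy => congrArg (fun p => p.1.2) hxy, le_bot_iff.mp (inr_le_iff.mpr bot_le),
    fun x y => le_antisymm (inr_le_iff.mpr le_sup_left) ?_, fun a ha => isAtom_of_rk ?_⟩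
  · exact sup_le (inr_le_iff.mpr le_sup_left) (inr_le_iff.mpr le_sup_right)
  · rw [rk_inr, rk_atom ha]

theorem Amalg.isEmb_inl : IsEmb (inl hj h) := by
  have := IsGeometric.finite (L := N)
  have := IsGeometric.finite (L := Amalg hj h)
  refine ⟨fun x y hxy => congrArg (fun p => p.1.1) hxy, le_bot_iff.mp (inl_le_iff.mpr bot_le),
    fun x y => le_antisymm (inl_le_iff.mpr le_sup_left) ?_, fun a ha => isAtom_of_rk ?_⟩
  · exact sup_le (inl_le_iff.mpr le_sup_left) (inl_le_iff.mpr le_sup_right)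
  · rw [rk_inl, rk_atom ha]

theorem Amalg.rk_upper_sup {G : E} (hG : ι ⊤ ≤ G) (p : Amalg hj h) :
    rk (upper hj h G hG ⊔ p) = rk (⊤ : N) + relRk ι (G ⊔ p.1.2) := by
  rw [rk_eq, snd_sup, h.relRk_sup]
  congr 2
  exact top_le_iff.mp (le_sup_left.trans le_sup_left)

/-- Above the modular flat the rank in `E` and the relative rank differ by a constant, so the
equality for `G` passes to the amalgam. The case `G = ι ⊤` makes `inl` a modular extension, and the
general case carries the relation `two`. -/
theorem Amalg.isModularElt_upper {G : E} (hG : IsModularElt G) (hFG : ι ⊤ ≤ G) :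
    IsModularElt (upper hj h G hFG) := by
  intro p
  rw [rk_upper_sup, rk_eq, rk_eq, rk_eq p]
  change rk (⊤ ⊓ p.1.1) + relRk ι (G ⊓ p.1.2) + _ = rk (⊤ : N) + relRk ι G + _
  rw [top_inf_eq]
  have h1 := hG p.1.2
  have h2 := h.relRk_add G
  have h3 := h.relRk_add (G ⊓ p.1.2)
  have h4 := h.relRk_add (G ⊔ p.1.2)
  have h5 := h.relRk_add p.1.2
  have e1 : trace ι G = ⊤ := top_le_iff.mp (h.le_trace_iff.mpr hFG)
  have e2 : trace ι (G ⊔ p.1.2) = ⊤ :=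
    top_le_iff.mp (h.le_trace_iff.mpr (hFG.trans le_sup_left))
  rw [e1] at h2
  rw [e2] at h4
  rw [h.trace_inf, e1, top_inf_eq] at h3
  omega

theorem Amalg.isModExt_inl : IsModExt (inl hj h) := by
  have e : inl hj h ⊤ = upper hj h (ι ⊤) le_rfl :=
    Amalg.ext rfl (congrArg ι hj.trace_top)
  refine ⟨isEmb_inl hj h, ?_, ?_⟩
  · ext p
    constructor
    · rintro ⟨z, rfl⟩
      exact ⟨bot_le, (isEmb_inl hj h).monotone le_top⟩
    · rintro ⟨-, hp⟩
      rw [e] at hp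
      refine ⟨p.1.1, Amalg.ext rfl ?_⟩
      change ι (trace j p.1.1) = p.1.2
      rw [p.2, h.map_trace, inf_eq_left]
      exact hp.2
  · rw [e]
    exact isModularElt_upper hj h h.modular le_rfl

variable {L : Type*} [Lattice L] [BoundedOrder L] {κ : L → N}

/-- The grading of an amalgam is read on its component in `N`. -/
theorem Amalg.trace_eq (hκ : IsModExt κ) (p : Amalg hj h) :
    trace (fun z => inl hj h (κ z)) p = trace κ p.1.1 :=
  eq_of_forall_le_iff fun z => by
    rw [((isModExt_inl hj h).comp hκ).le_trace_iff, hκ.le_trace_iff, inl_le_iff]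

variable {hj} in
/-- Amalgams are functorial in the modular extension. -/
def Amalg.map {φ : E → E'} (hφ : IsEmb φ) (hι : ∀ z, ι' z = φ (ι z)) (p : Amalg hj h) :
    Amalg hj h' :=
  ⟨(p.1.1, φ p.1.2), p.2.trans (hφ.trace_map h h' hι _).symm⟩

theorem Amalg.map_inr {φ : E → E'} (hφ : IsEmb φ) (hι : ∀ z, ι' z = φ (ι z)) (y : E) :
    map h h' hφ hι (inr hj h y) = inr hj h' (φ y) :=
  Amalg.ext (congrArg j (hφ.trace_map h h' hι y).symm) rfl

theorem Amalg.map_inl {φ : E → E'} (hφ : IsEmb φ) (hι : ∀ z, ι' z = φ (ι z)) (x : N) :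
    map h h' hφ hι (inl hj h x) = inl hj h' x :=
  Amalg.ext rfl (hι _).symm

theorem Amalg.rk_map {φ : E → E'} (hφ : IsEmb φ) (hι : ∀ z, ι' z = φ (ι z)) (p : Amalg hj h) :
    rk (map h h' hφ hι p) = rk p := by
  rw [rk_eq, rk_eq]
  congr 1
  change rk (φ p.1.2 ⊔ ι' ⊤) - rk (ι' ⊤) = rk (p.1.2 ⊔ ι ⊤) - rk (ι ⊤)
  rw [hι, ← hφ.map_sup, hφ.rk_map, hφ.rk_map]

theorem Amalg.isEmb_map {φ : E → E'} (hφ : IsEmb φ) (hι : ∀ z, ι' z = φ (ι z)) :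
    IsEmb (map (hj := hj) h h' hφ hι) := by
  have := IsGeometric.finite (L := Amalg hj h)
  have := IsGeometric.finite (L := Amalg hj h')
  have hfst : ∀ p q : Amalg hj h,
      (map h h' hφ hι (p ⊔ q)).1.1 = (map h h' hφ hι p ⊔ map h h' hφ hι q).1.1 := by
    intro p q
    change p.1.1 ⊔ q.1.1 ⊔ j (trace ι (p.1.2 ⊔ q.1.2)) =
      p.1.1 ⊔ q.1.1 ⊔ j (trace ι' (φ p.1.2 ⊔ φ q.1.2))
    rw [← hφ.map_sup, hφ.trace_map h h' hι]
  refine ⟨?_, Amalg.ext rfl hφ.map_bot, fun p q => Amalg.ext (hfst p q) ?_,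
    fun a ha => isAtom_of_rk ?_⟩
  · intro p q hpq
    exact Amalg.ext (congrArg (fun r => r.1.1) hpq)
      (hφ.injective (congrArg (fun r => r.1.2) hpq))
  · rw [snd_sup, ← hfst]
    change φ ((p ⊔ q).1.2) = φ p.1.2 ⊔ φ q.1.2 ⊔ ι' (trace j (p ⊔ q).1.1)
    rw [snd_sup, hφ.map_sup, hφ.map_sup, hι]
  · rw [rk_map, rk_atom ha]

end Amalgam

/-! ### Modular extensions with values in a product -/

section ProductExtension

variable {M N E A B : Type*} [Lattice M] [BoundedOrder M] [Lattice N] [BoundedOrder N]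
  [Lattice E] [BoundedOrder E] [Lattice A] [BoundedOrder A] [Lattice B] [BoundedOrder B]
  [IsGeometric N] [IsGeometric E] [IsGeometric A] {j : M → N} {ι : M → E}

theorem isEmb_symm_prod (e : E ≃o A × B) : IsEmb fun x => e.symm (x, ⊥) := by
  refine ⟨fun x y hxy => congrArg Prod.fst (e.symm.injective hxy), e.symm.map_bot, fun x y => ?_,
    fun a ha => (e.symm.isAtom_iff _).mpr ⟨fun h0 => ha.1 (congrArg Prod.fst h0), ?_⟩⟩
  · rw [← map_sup]
    congr 1
    exact Prod.ext rfl (sup_idem _).symm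
  · rintro ⟨y, z⟩ hyz
    have hz : z = ⊥ := le_bot_iff.mp hyz.le.2
    subst hz
    have hy : y < a := lt_of_le_of_ne hyz.le.1 fun he => hyz.ne (by rw [he])
    rw [ha.2 y hy]
    rfl

theorem IsModExt.snd_eq_bot (h : IsModExt ι) (e : E ≃o A × B) (he : (e (ι ⊤)).2 = ⊥) (z : M) :
    (e (ι z)).2 = ⊥ :=
  le_bot_iff.mp (he ▸ (e.monotone (h.emb.monotone le_top)).2)

/-- Since `F_ι` lies in `A × {⊥}`, the extension factors through the embedding of `A`, which
preserves the ranks and meets in the modular equality. Amalgamating then changes only the factor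
`A`. -/
theorem IsModExt.fst (h : IsModExt ι) (e : E ≃o A × B) (he : (e (ι ⊤)).2 = ⊥) :
    IsModExt fun z => (e (ι z)).1 := by
  have hα : ∀ z, e.symm ((e (ι z)).1, ⊥) = ι z := by
    intro z
    rw [e.symm_apply_eq]
    exact Prod.ext rfl (h.snd_eq_bot e he z).symm
  have hemb := isEmb_symm_prod e
  refine ⟨⟨?_, ?_, ?_, ?_⟩, ?_, ?_⟩
  · intro x y hxy
    apply h.emb.injective
    rw [← hα x, ← hα y]
    exact congrArg (fun t => e.symm (t, ⊥)) hxy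
  · rw [h.emb.map_bot, e.map_bot]
    rfl
  · intro x y
    rw [h.emb.map_sup, map_sup]
    rfl
  · intro a ha
    rw [← hemb.isAtom_iff, hα]
    exact h.emb.map_atom a ha
  · ext x
    constructor
    · rintro ⟨z, rfl⟩
      exact ⟨bot_le, (e.monotone (h.emb.monotone le_top)).1⟩
    · rintro ⟨-, hx⟩
      have h1 : e.symm (x, ⊥) ≤ ι ⊤ := by
        rw [← hα ⊤]
        exact hemb.monotone hx
      refine ⟨trace ι (e.symm (x, ⊥)), ?_⟩
      change (e (ι (trace ι (e.symm (x, ⊥))))).1 = x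
      rw [h.map_trace, inf_eq_left.mpr h1, e.apply_symm_apply]
  · intro G
    have hf := hα ⊤
    change rk ((e (ι ⊤)).1 ⊓ G) + rk ((e (ι ⊤)).1 ⊔ G) = rk (e (ι ⊤)).1 + rk G
    generalize (e (ι ⊤)).1 = f at hf ⊢
    have h1 := h.modular (e.symm (G, ⊥))
    have h2 : e.symm (f ⊓ G, ⊥) = e.symm (f, ⊥) ⊓ e.symm (G, ⊥) := by
      rw [← map_inf]
      congr 1
      exact Prod.ext rfl (inf_idem _).symm
    have h3 : e.symm (f ⊔ G, ⊥) = e.symm (f, ⊥) ⊔ e.symm (G, ⊥) := hemb.map_sup f G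
    have h4 : ∀ x, rk (e.symm (x, ⊥)) = rk x := hemb.rk_map
    rwa [← hf, ← h2, ← h3, h4, h4, h4, h4] at h1

theorem IsModExt.trace_fst (h : IsModExt ι) (e : E ≃o A × B) (he : (e (ι ⊤)).2 = ⊥) (x : E) :
    trace (fun z => (e (ι z)).1) (e x).1 = trace ι x :=
  eq_of_forall_le_iff fun z => by
    rw [(h.fst e he).le_trace_iff, h.le_trace_iff, ← e.le_iff_le]
    exact ⟨fun h1 => ⟨h1, (h.snd_eq_bot e he z).le.trans bot_le⟩, fun h1 => h1.1⟩

/-- The amalgam with a product. -/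
def amalgProd (hj : IsIntervalEmb j) (h : IsModExt ι) (e : E ≃o A × B) (he : (e (ι ⊤)).2 = ⊥) :
    Amalg hj h ≃o Amalg hj (h.fst e he) × B where
  toFun p := (⟨(p.1.1, (e p.1.2).1), p.2.trans (h.trace_fst e he _).symm⟩, (e p.1.2).2)
  invFun q := ⟨(q.1.1.1, e.symm (q.1.1.2, q.2)), by
    have h1 := h.trace_fst e he (e.symm (q.1.1.2, q.2))
    rw [e.apply_symm_apply] at h1
    exact q.1.2.trans h1⟩
  left_inv p := Amalg.ext rfl (e.symm_apply_apply p.1.2)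
  right_inv q := by
    apply Prod.ext
    · exact Amalg.ext rfl (congrArg Prod.fst (e.apply_symm_apply (q.1.1.2, q.2)))
    · exact (congrArg Prod.snd (e.apply_symm_apply (q.1.1.2, q.2)) :)
  map_rel_iff' := by
    intro p q
    change ((p.1.1 ≤ q.1.1 ∧ (e p.1.2).1 ≤ (e q.1.2).1) ∧ (e p.1.2).2 ≤ (e q.1.2).2) ↔
      p.1.1 ≤ q.1.1 ∧ p.1.2 ≤ q.1.2
    rw [and_assoc, ← e.le_iff_le (x := p.1.2)]
    rfl

end ProductExtension

/-! ### Amalgams of diagrams -/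

section Push

variable {L M N : Type u} [Lattice L] [BoundedOrder L] [Lattice M] [BoundedOrder M]
  [IsGeometric M] [Lattice N] [BoundedOrder N] [IsGeometric N] {j : M → N} {κ : L → N}
  (hj : IsIntervalEmb j) (hκ : IsModExt κ) (w₁ w₂ : List N)
  {E : Type u} [Lattice E] [BoundedOrder E] [IsGeometric E] {ι : M → E}

/-- The word of the amalgam of a diagram of `M` with `N`. -/
noncomputable def pushWord (h : IsModExt ι) (J : List E) : List (Amalg hj h) :=
  w₁.map (Amalg.inl hj h) ++ J.map (Amalg.inr hj h) ++ w₂.map (Amalg.inl hj h)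

/-- The class of the amalgam of a diagram of `M` with the extension `κ : L → N`. The word is
enlarged by letters from `N` at both sides. -/
noncomputable def push (h : IsModExt ι) (J : List E) : MD L :=
  wcls ((Amalg.isModExt_inl hj h).comp hκ) (pushWord hj w₁ w₂ h J)

/-- The added letters lie below the new modular flat, so they affect neither `low` nor `two`. The
relation `emb` follows from functoriality, `low` and `two` from `Amalg.upper`, and `prod` from
`amalgProd`. -/
theorem respectsRel_push :
    RespectsRel fun Γ : ModularDiagram M => push hj hκ w₁ w₂ Γ.ext Γ.J where
  swap Γ l₁ l₂ a b h h' := by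
    change push hj hκ w₁ w₂ Γ.ext Γ.J = -push hj hκ w₁ w₂ Γ.ext (l₁ ++ b :: a :: l₂)
    rw [h, push, push, pushWord, pushWord]
    simp only [List.map_append, List.map_cons, List.append_assoc, List.cons_append]
    rw [← List.append_assoc, ← List.append_assoc]
    exact wcls_alternating _ _ _ _ _
  emb Γ Γ' φ hφ hrk hι hJ := by
    rw [push, push, ← wcls_emb ((Amalg.isModExt_inl hj Γ.ext).comp hκ)
      ((Amalg.isModExt_inl hj Γ'.ext).comp hκ) (Amalg.isEmb_map hj Γ.ext Γ'.ext hφ hι) ?_ ?_, hJ]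
    · congr 1
      simp only [pushWord, List.map_append, List.map_map, Function.comp_def, Amalg.map_inl,
        Amalg.map_inr]
    · rw [← Amalg.rk_map hj Γ.ext Γ'.ext hφ hι]
      congr 1
      exact Amalg.ext rfl (hφ.map_top hrk)
    · intro z
      exact (Amalg.map_inl hj Γ.ext Γ'.ext hφ hι (κ z)).symm
  low Γ h := by
    refine wcls_low _ ?_
    have h1 : Amalg.inl hj Γ.ext (κ ⊤) ⊔ lsup (pushWord hj w₁ w₂ Γ.ext Γ.J) ≤
        Amalg.upper hj Γ.ext (Γ.ι ⊤ ⊔ lsup Γ.J) le_sup_left := by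
      refine sup_le (Amalg.inl_le_iff.mpr le_top) (lsup_le_iff.mpr fun a ha => ?_)
      simp only [pushWord, List.mem_append, List.mem_map] at ha
      rcases ha with (⟨b, -, rfl⟩ | ⟨b, hb, rfl⟩) | ⟨b, -, rfl⟩
      · exact Amalg.inl_le_iff.mpr le_top
      · exact Amalg.inr_le_iff.mpr (le_sup_of_le_right (le_lsup hb))
      · exact Amalg.inl_le_iff.mpr le_top
    refine lt_of_le_of_lt h1 (lt_top_iff_ne_top.mpr fun h2 => h.ne ?_)
    exact congrArg (fun p => p.1.2) h2
  prod Γ A B _ _ _ _ _ _ _ _ e he := by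
    have : Nontrivial (Amalg hj (Γ.ext.fst e he)) :=
      (Amalg.isEmb_inr hj (Γ.ext.fst e he)).injective.nontrivial
    exact wcls_prod _ _ (amalgProd hj Γ.ext e he) (Γ.ext.snd_eq_bot e he _)
  two Γ G hG hFG hcard := by
    by_cases hJ : Γ.J.Nodup
    · obtain ⟨a, b, l, hp, ha, hb, hl⟩ := exists_perm_of_ncard_two hJ hcard
      change push hj hκ w₁ w₂ Γ.ext Γ.J = 0
      rw [push]
      refine wcls_two ((Amalg.isModExt_inl hj Γ.ext).comp hκ)
        (Amalg.isModularElt_upper hj Γ.ext hG hFG) (Amalg.inl_le_iff.mpr le_top)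
        (a := Amalg.inr hj Γ.ext a) (b := Amalg.inr hj Γ.ext b)
        (l := l.map (Amalg.inr hj Γ.ext) ++ (w₁.map (Amalg.inl hj Γ.ext) ++
          w₂.map (Amalg.inl hj Γ.ext))) ?_ (Amalg.inr_le_iff.not.mpr ha)
        (Amalg.inr_le_iff.not.mpr hb) ?_
      · rw [pushWord]
        refine (List.perm_append_comm.append_right _).trans ?_
        rw [List.append_assoc]
        exact (hp.map _).append_right _
      · intro c hc
        simp only [List.mem_append, List.mem_map] at hc
        rcases hc with ⟨x, hx, rfl⟩ | ⟨x, -, rfl⟩ | ⟨x, -, rfl⟩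
        · exact Amalg.inr_le_iff.mpr (hl x hx)
        · exact Amalg.inl_le_iff.mpr le_top
        · exact Amalg.inl_le_iff.mpr le_top
    · refine (wcls_alternating _).eq_zero_of_not_nodup fun hn => hJ ?_
      exact (hn.of_append_left.of_append_right).of_map _

end Push

/-! ### The product -/

section Product

variable {L : Type u} [Lattice L] [BoundedOrder L] [IsGeometric L]

/-- With the first factor fixed, the product is the amalgam of the second factor with `Γ₁.E`, the
letters of `Γ₁` being added on the left. Well-definedness in the second variable follows from
`respectsRel_push`; the next lemma serves the first variable. -/
theorem ModularDiagram.mul_cls_right (Γ₁ Γ₂ : ModularDiagram L) :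
    (Γ₁.mul Γ₂).cls = push Γ₁.ext.intervalEmb Γ₁.ext Γ₁.J [] Γ₂.ext Γ₂.J := by
  rw [← (Γ₁.mul Γ₂).wcls_eq, push]
  let e : Amalg Γ₁.ext.intervalEmb Γ₂.ext ≃o (Γ₁.mul Γ₂).E :=
    { toFun := fun p => p
      invFun := fun p => p
      left_inv := fun _ => rfl
      right_inv := fun _ => rfl
      map_rel_iff' := Iff.rfl }
  rw [← wcls_orderIso ((Amalg.isModExt_inl Γ₁.ext.intervalEmb Γ₂.ext).comp Γ₁.ext)
    (Γ₁.mul Γ₂).ext e fun z => Subtype.ext (Prod.ext rfl (congrArg Γ₂.ι (Γ₁.ext.trace_map z).symm))]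
  congr 1
  rw [pushWord, List.map_nil, List.append_nil, List.map_append, List.map_map, List.map_map]
  rfl

theorem ModularDiagram.mul_cls_left (Γ₁ Γ₂ : ModularDiagram L) :
    (Γ₁.mul Γ₂).cls = push Γ₂.ext.intervalEmb Γ₂.ext [] Γ₂.J Γ₁.ext Γ₁.J := by
  rw [← (Γ₁.mul Γ₂).wcls_eq, push]
  let e : Amalg Γ₂.ext.intervalEmb Γ₁.ext ≃o (Γ₁.mul Γ₂).E :=
    { toFun := fun p => ⟨(p.1.2, p.1.1), p.2.symm⟩
      invFun := fun p => ⟨(p.1.2, p.1.1), p.2.symm⟩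
      left_inv := fun _ => rfl
      right_inv := fun _ => rfl
      map_rel_iff' := and_comm }
  rw [← wcls_orderIso ((Amalg.isModExt_inl Γ₂.ext.intervalEmb Γ₁.ext).comp Γ₂.ext)
    (Γ₁.mul Γ₂).ext e fun z => Subtype.ext (Prod.ext (congrArg Γ₁.ι (Γ₂.ext.trace_map z).symm) rfl)]
  congr 1
  rw [pushWord, List.map_nil, List.nil_append, List.map_append, List.map_map, List.map_map]
  rfl

theorem exists_isProduct : ∃ m : MD L →ₗ[ℚ] MD L →ₗ[ℚ] MD L, IsProduct m := by
  have hr : ∀ Γ₁ : ModularDiagram L, ∃ g : MD L →ₗ[ℚ] MD L, ∀ Γ₂, g Γ₂.cls = (Γ₁.mul Γ₂).cls := by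
    intro Γ₁
    obtain ⟨g, hg⟩ := (respectsRel_push Γ₁.ext.intervalEmb Γ₁.ext Γ₁.J []).exists_lift
    exact ⟨g, fun Γ₂ => (hg Γ₂).trans (Γ₁.mul_cls_right Γ₂).symm⟩
  choose R hR using hr
  have hR' : ∀ Γ₁ Γ₂ : ModularDiagram L, R Γ₁ Γ₂.cls =
      push Γ₂.ext.intervalEmb Γ₂.ext [] Γ₂.J Γ₁.ext Γ₁.J :=
    fun Γ₁ Γ₂ => (hR Γ₁ Γ₂).trans (Γ₁.mul_cls_left Γ₂)
  have hl := fun Γ₂ : ModularDiagram L => respectsRel_push Γ₂.ext.intervalEmb Γ₂.ext [] Γ₂.J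
  -- The relations for `R` are equalities of linear maps, so they are tested on classes, where `hR'`
  -- turns them into those of an amalgam in the first variable.
  have hresp : RespectsRel R :=
    { swap := fun Γ l₁ l₂ a b h h' => MD_hom_ext fun Γ₂ => by
        rw [LinearMap.neg_apply, hR', hR']
        exact (hl Γ₂).swap Γ l₁ l₂ a b h h'
      emb := fun Γ Γ' φ hφ hrk hι hJ => MD_hom_ext fun Γ₂ => by
        rw [hR', hR']
        exact (hl Γ₂).emb Γ Γ' φ hφ hrk hι hJ
      low := fun Γ h => MD_hom_ext fun Γ₂ => (hR' Γ Γ₂).trans ((hl Γ₂).low Γ h)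
      prod := fun Γ A B _ _ _ _ _ _ _ _ e he => MD_hom_ext fun Γ₂ =>
        (hR' Γ Γ₂).trans ((hl Γ₂).prod Γ A B e he)
      two := fun Γ G hG hFG hcard => MD_hom_ext fun Γ₂ =>
        (hR' Γ Γ₂).trans ((hl Γ₂).two Γ G hG hFG hcard) }
  obtain ⟨m, hm⟩ := hresp.exists_lift
  exact ⟨m, fun Γ₁ Γ₂ => by rw [hm, hR]⟩

theorem ModularDiagram.mul_cls_mem_grPart (Γ₁ Γ₂ : ModularDiagram L) :
    (Γ₁.mul Γ₂).cls ∈ grPart (Γ₁.gr ⊔ Γ₂.gr) := by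
  rw [mul_cls_right]
  have h1 := wcls_mem_grPart ((Amalg.isModExt_inl Γ₁.ext.intervalEmb Γ₂.ext).comp Γ₁.ext)
    (pushWord Γ₁.ext.intervalEmb Γ₁.J [] Γ₂.ext Γ₂.J)
  have h2 : lsup (pushWord Γ₁.ext.intervalEmb Γ₁.J [] Γ₂.ext Γ₂.J) =
      Amalg.inl Γ₁.ext.intervalEmb Γ₂.ext (lsup Γ₁.J) ⊔
        Amalg.inr Γ₁.ext.intervalEmb Γ₂.ext (lsup Γ₂.J) := by
    rw [← (Amalg.isEmb_inl _ _).map_lsup, ← (Amalg.isEmb_inr _ _).map_lsup, pushWord,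
      List.map_nil, List.append_nil]
    apply le_antisymm
    · refine lsup_le_iff.mpr fun a ha => ?_
      rcases List.mem_append.mp ha with ha | ha
      · exact le_sup_of_le_left (le_lsup ha)
      · exact le_sup_of_le_right (le_lsup ha)
    · exact sup_le (lsup_le_iff.mpr fun a ha => le_lsup (List.mem_append_left _ ha))
        (lsup_le_iff.mpr fun a ha => le_lsup (List.mem_append_right _ ha))
  -- The first component of the join receives the trace of the second. By modularity both
  -- contributions equal `gr Γ₁ ∨ gr Γ₂`.
  rw [h2, Amalg.trace_eq _ _ Γ₁.ext, Amalg.fst_sup, Γ₁.ext.trace_sup] at h1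
  change _ ∈ grPart (trace Γ₁.ι (lsup Γ₁.J ⊔ Γ₁.ι (trace Γ₂.ι (lsup Γ₂.J))) ⊔
    trace Γ₂.ι (Γ₂.ι (trace Γ₁.ι (lsup Γ₁.J)) ⊔ lsup Γ₂.J)) at h1
  rw [Γ₁.ext.trace_sup, sup_comm (Γ₂.ι _), Γ₂.ext.trace_sup, sup_comm (trace Γ₂.ι _),
    sup_idem] at h1
  exact h1

theorem IsProduct.mem_grPart {m : MD L →ₗ[ℚ] MD L →ₗ[ℚ] MD L} (hm : IsProduct m) {F₁ F₂ : L}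
    {x y : MD L} (hx : x ∈ grPart F₁) (hy : y ∈ grPart F₂) : m x y ∈ grPart (F₁ ⊔ F₂) := by
  have h1 : grPart F₁ ≤ (grPart (F₁ ⊔ F₂)).comap (m.flip y) := by
    refine Submodule.span_le.mpr ?_
    rintro _ ⟨Γ₁, rfl, rfl⟩
    have h2 : grPart F₂ ≤ (grPart (Γ₁.gr ⊔ F₂)).comap (m Γ₁.cls) := by
      refine Submodule.span_le.mpr ?_
      rintro _ ⟨Γ₂, rfl, rfl⟩
      rw [SetLike.mem_coe, Submodule.mem_comap, hm]
      exact Γ₁.mul_cls_mem_grPart Γ₂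
    exact h2 hy
  exact h1 hx

end Product

/-! ### Restriction of a diagram to the join of its letters -/

section Restriction

variable {E E' : Type*} [Lattice E] [BoundedOrder E] [IsGeometric E]
  [Lattice E'] [BoundedOrder E'] [IsGeometric E']

/-- The meet with `X`, as an element of the lower interval below `X`. -/
def toIic (X x : E) : Set.Iic X := ⟨x ⊓ X, inf_le_right⟩

theorem toIic_of_le {X x : E} (h : x ≤ X) : toIic X x = ⟨x, h⟩ :=
  Subtype.ext (inf_eq_left.mpr h)

theorem coe_lsup_map_toIic {X : E} {J : List E} (h : ∀ x ∈ J, x ≤ X) :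
    ((lsup (J.map (toIic X)) : Set.Iic X) : E) = lsup J := by
  rw [← (isEmb_coe_Iic X).map_lsup, List.map_map]
  congr 1
  exact (List.map_congr_left (g := id) fun x hx => inf_eq_left.mpr (h x hx)).trans (List.map_id J)

theorem isAtom_toIic {X a : E} (ha : IsAtom a) (h : a ≤ X) : IsAtom (toIic X a) := by
  rw [← (isEmb_coe_Iic X).isAtom_iff, toIic_of_le h]
  exact ha

/-- Lower intervals in a product. -/
def iicProd {A B : Type*} [Lattice A] [Lattice B] (e : E ≃o A × B) (a : E) :
    Set.Iic a ≃o Set.Iic (e a).1 × Set.Iic (e a).2 where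
  toFun x := (⟨(e x).1, (e.monotone x.2).1⟩, ⟨(e x).2, (e.monotone x.2).2⟩)
  invFun y := ⟨e.symm (y.1, y.2), by
    rw [Set.mem_Iic, e.symm_apply_le]
    exact ⟨y.1.2, y.2.2⟩⟩
  left_inv x := Subtype.ext (e.symm_apply_apply x)
  right_inv y := by
    apply Prod.ext <;> apply Subtype.ext <;> simp
  map_rel_iff' := by
    intro x y
    change ((e x).1 ≤ (e y).1 ∧ (e x).2 ≤ (e y).2) ↔ (x : E) ≤ y
    rw [← e.le_iff_le]
    rfl

theorem nontrivial_Iic {x : E} (h : x ≠ ⊥) : Nontrivial (Set.Iic x) :=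
  ⟨⟨x, le_rfl⟩, ⟨⊥, bot_le⟩, fun he => h (congrArg Subtype.val he)⟩

theorem IsEmb.mapIic {φ : E → E'} (hφ : IsEmb φ) (X : E) :
    IsEmb fun x : Set.Iic X => (⟨φ x, hφ.monotone x.2⟩ : Set.Iic (φ X)) := by
  have := IsGeometric.finite (L := E')
  refine ⟨fun x y hxy => Subtype.ext (hφ.injective (congrArg Subtype.val hxy)),
    Subtype.ext hφ.map_bot, fun x y => Subtype.ext (hφ.map_sup _ _), fun a ha => isAtom_of_rk ?_⟩
  rw [rk_Iic]
  exact rk_atom (hφ.map_atom _ ((isEmb_coe_Iic X).map_atom a ha))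

variable {L M : Type*} [Lattice L] [BoundedOrder L] [Lattice M] [BoundedOrder M]
  {ι : L → E} {j : M → L}

theorem IsModExt.trace_restrict (h : IsModExt ι) (hj : IsIntervalEmb j) {X : E}
    (hX : j ⊤ = trace ι X) (y : Set.Iic X) :
    j (trace (fun z => (⟨ι (j z), (h.emb.monotone (hj.emb.monotone le_top)).trans
      (h.le_trace_iff.mp hX.le)⟩ : Set.Iic X)) y) = trace ι (y : E) := by
  have hr := h.restrict hj X hX
  apply le_antisymm
  · rw [h.le_trace_iff]
    exact hr.le_trace_iff.mp le_rfl
  · have h1 : trace ι (y : E) ≤ j ⊤ := by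
      rw [hX]
      exact h.trace_mono y.2
    rw [← inf_eq_left.mpr h1, ← hj.map_trace]
    refine hj.emb.monotone (hr.le_trace_iff.mpr ?_)
    change ι (j (trace j (trace ι (y : E)))) ≤ y
    rw [hj.map_trace, inf_eq_left.mpr h1]
    exact h.le_trace_iff.mp le_rfl

theorem IsModExt.relRk_restrict [IsGeometric L] [IsGeometric M] (h : IsModExt ι)
    (hj : IsIntervalEmb j) {X : E} (hX : j ⊤ = trace ι X) (y : Set.Iic X) :
    relRk (fun z => (⟨ι (j z), (h.emb.monotone (hj.emb.monotone le_top)).trans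
      (h.le_trace_iff.mp hX.le)⟩ : Set.Iic X)) y = relRk ι (y : E) := by
  have h1 := (h.restrict hj X hX).relRk_add y
  have h2 := h.relRk_add (y : E)
  rw [← hj.emb.rk_map, h.trace_restrict hj hX, rk_Iic] at h1
  omega

/-! ### The amalgam of a restriction -/

variable [IsGeometric L] [IsGeometric M] (h : IsModExt ι) (hj : IsIntervalEmb j) {X : E}
  (hX : j ⊤ = trace ι X)

/-- The comparison map from the amalgam of a restriction. -/
def ofRestrict (p : Amalg hj (h.restrict hj X hX)) : E := ι p.1.1 ⊔ (p.1.2 : E)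

theorem trace_snd_eq (p : Amalg hj (h.restrict hj X hX)) :
    trace ι (p.1.2 : E) = p.1.1 ⊓ j ⊤ := by
  rw [← h.trace_restrict hj hX, ← p.2, hj.map_trace]

theorem trace_ofRestrict (p : Amalg hj (h.restrict hj X hX)) :
    trace ι (ofRestrict h hj hX p) = p.1.1 := by
  rw [ofRestrict, sup_comm, h.trace_sup, trace_snd_eq h hj hX]
  exact sup_eq_right.mpr inf_le_left

theorem ofRestrict_sup_top (p : Amalg hj (h.restrict hj X hX)) :
    ofRestrict h hj hX p ⊔ ι ⊤ = (p.1.2 : E) ⊔ ι ⊤ := by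
  rw [ofRestrict, sup_comm (ι p.1.1), sup_assoc, sup_eq_right.mpr (h.emb.monotone le_top)]

/-- Both sides have the same trace and the left one has no larger join with `ι ⊤`, so modularity
compares their ranks. Together with `trace_ofRestrict` this recovers both components of `p`, hence
injectivity. -/
theorem inf_ofRestrict (p : Amalg hj (h.restrict hj X hX)) :
    X ⊓ ofRestrict h hj hX p = p.1.2 := by
  have := IsGeometric.finite (L := E)
  symm
  apply eq_of_le_of_rk (le_inf p.1.2.2 le_sup_right)
  have h1 := h.rk_trace (X ⊓ ofRestrict h hj hX p)
  have h2 := h.rk_trace (p.1.2 : E)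
  have e : trace ι (X ⊓ ofRestrict h hj hX p) = trace ι (p.1.2 : E) := by
    rw [h.trace_inf, trace_ofRestrict, trace_snd_eq h hj hX, inf_comm]
    exact congrArg (p.1.1 ⊓ ·) hX.symm
  rw [e] at h1
  have h3 : rk (X ⊓ ofRestrict h hj hX p ⊔ ι ⊤) ≤ rk ((p.1.2 : E) ⊔ ι ⊤) := by
    rw [← ofRestrict_sup_top h hj hX]
    exact rk_mono (sup_le_sup_right inf_le_right _)
  change rk (X ⊓ ofRestrict h hj hX p) ≤ rk (p.1.2 : E)
  omega

theorem rk_ofRestrict (p : Amalg hj (h.restrict hj X hX)) :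
    rk (ofRestrict h hj hX p) = rk p := by
  rw [Amalg.rk_eq, h.relRk_restrict hj hX, ← h.relRk_add, trace_ofRestrict, relRk, relRk,
    ofRestrict_sup_top, add_comm]

theorem ofRestrict_inl (x : L) : ofRestrict h hj hX (Amalg.inl hj (h.restrict hj X hX) x) = ι x :=
  sup_eq_left.mpr (h.emb.monotone (hj.le_trace_iff.mp le_rfl))

theorem ofRestrict_inr (y : Set.Iic X) :
    ofRestrict h hj hX (Amalg.inr hj (h.restrict hj X hX) y) = y :=
  sup_eq_right.mpr ((h.restrict hj X hX).le_trace_iff.mp le_rfl)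

/-- The corrections in the join of an amalgam add only elements already below the join in `E`, so
joins are preserved. The image of the top is `ι ⊤ ⊔ X`; when this is the top of `E`, the relation
`emb` identifies diagrams on the amalgam with diagrams on `E`. -/
theorem isEmb_ofRestrict : IsEmb (ofRestrict h hj hX) := by
  have := IsGeometric.finite (L := E)
  have := IsGeometric.finite (L := Amalg hj (h.restrict hj X hX))
  have hmono : Monotone (ofRestrict h hj hX) := fun p q hpq =>
    sup_le_sup (h.emb.monotone hpq.1) hpq.2
  refine ⟨fun p q hpq => Amalg.ext ?_ (Subtype.ext ?_), ?_, fun p q => le_antisymm ?_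
    (sup_le (hmono le_sup_left) (hmono le_sup_right)), fun a ha => isAtom_of_rk ?_⟩
  · rw [← trace_ofRestrict h hj hX p, hpq, trace_ofRestrict]
  · rw [← inf_ofRestrict h hj hX p, hpq, inf_ofRestrict]
  · change ι ⊥ ⊔ ⊥ = ⊥
    rw [h.emb.map_bot, sup_bot_eq]
  · have h1 : ι (p ⊔ q).1.1 ≤ ofRestrict h hj hX p ⊔ ofRestrict h hj hX q := by
      rw [Amalg.fst_sup, h.emb.map_sup, h.emb.map_sup]
      refine sup_le (sup_le_sup le_sup_left le_sup_left) ?_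
      refine le_trans (?_ : _ ≤ (p.1.2 : E) ⊔ q.1.2) (sup_le_sup le_sup_right le_sup_right)
      exact (h.restrict hj X hX).le_trace_iff.mp le_rfl
    refine sup_le h1 ?_
    rw [Amalg.snd_sup]
    refine sup_le (sup_le_sup le_sup_right le_sup_right) (le_trans ?_ h1)
    exact h.emb.monotone (hj.le_trace_iff.mp le_rfl)
  · rw [rk_ofRestrict, rk_atom ha]

end Restriction

/-! ### Restriction of classes to the interval below `F` -/

section RestrictionMap

variable {L : Type u} [Lattice L] [BoundedOrder L] [IsGeometric L]
  {E E' : Type u} [Lattice E] [BoundedOrder E] [IsGeometric E]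
  [Lattice E'] [BoundedOrder E'] [IsGeometric E'] {ι : L → E} {ι' : L → E'} {F : L}

/-- The restriction of a modular extension to the interval below `F`. -/
theorem IsModExt.res (h : IsModExt ι) {X : E} (hX : F = trace ι X) :
    IsModExt fun z : Set.Iic F => (⟨ι z, (h.emb.monotone z.2).trans (h.le_trace_iff.mp hX.le)⟩ :
      Set.Iic X) :=
  h.restrict (isIntervalEmb_coe_Iic F) X hX

variable (F) in
open Classical in
/-- The class of the restriction of a diagram of grading `F` to the join of its letters, or zero
if the diagram has another grading or does not generate. -/
noncomputable def resCls (h : IsModExt ι) (J : List E) : MD (Set.Iic F) :=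
  if c : F = trace ι (lsup J) ∧ ι ⊤ ⊔ lsup J = ⊤ then
    wcls (h.res c.1) (J.map (toIic (lsup J))) else 0

theorem resCls_of (h : IsModExt ι) {J : List E} {X : E} (hX : F = trace ι X) (hJ : X = lsup J)
    (htop : ι ⊤ ⊔ X = ⊤) : resCls F h J = wcls (h.res hX) (J.map (toIic X)) := by
  subst hJ
  exact dif_pos ⟨hX, htop⟩

theorem resCls_of_not (h : IsModExt ι) {J : List E}
    (hc : ¬ (F = trace ι (lsup J) ∧ ι ⊤ ⊔ lsup J = ⊤)) : resCls F h J = 0 := dif_neg hc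

theorem resCls_alternating (h : IsModExt ι) : IsAlternating (resCls F h) := by
  intro l₁ a b l₂
  have hs := lsup_perm (perm_swap_append l₁ l₂ a b)
  by_cases hc : F = trace ι (lsup (l₁ ++ a :: b :: l₂)) ∧ ι ⊤ ⊔ lsup (l₁ ++ a :: b :: l₂) = ⊤
  · rw [resCls_of h hc.1 rfl hc.2, resCls_of h hc.1 hs hc.2]
    simp only [List.map_append, List.map_cons]
    exact wcls_alternating _ _ _ _ _
  · rw [resCls_of_not h hc, resCls_of_not h (hs ▸ hc), neg_zero]

theorem resCls_emb (h : IsModExt ι) (h' : IsModExt ι') {φ : E → E'} (hφ : IsEmb φ)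
    (hrk : rk (⊤ : E) = rk (⊤ : E')) (hι : ∀ z, ι' z = φ (ι z)) (J : List E) :
    resCls F h' (J.map φ) = resCls F h J := by
  have htr := hφ.trace_map h h' hι (lsup J)
  have hsup : ι' ⊤ ⊔ φ (lsup J) = ⊤ ↔ ι ⊤ ⊔ lsup J = ⊤ := by
    rw [hι, ← hφ.map_sup, ← hφ.map_top hrk, hφ.injective.eq_iff]
  by_cases hc : F = trace ι (lsup J) ∧ ι ⊤ ⊔ lsup J = ⊤
  · rw [resCls_of h hc.1 rfl hc.2, resCls_of h' (hc.1.trans htr.symm) (hφ.map_lsup J).symm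
      (hsup.mpr hc.2), ← wcls_emb (h.res hc.1) (h'.res (hc.1.trans htr.symm))
      (hφ.mapIic (lsup J)) ?_ fun z => Subtype.ext (hι z), List.map_map, List.map_map]
    · congr 1
      refine List.map_congr_left fun x hx => ?_
      change toIic (φ (lsup J)) (φ x) = ⟨φ (toIic (lsup J) x), _⟩
      rw [toIic_of_le (hφ.monotone (le_lsup hx))]
      exact Subtype.ext (congrArg φ (congrArg Subtype.val (toIic_of_le (le_lsup hx))).symm)
    · rw [rk_Iic, rk_Iic]
      exact (hφ.rk_map _).symm
  · rw [resCls_of_not h hc, resCls_of_not h']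
    rwa [hφ.map_lsup, htr, hsup]

/-- The condition `ι ⊤ ⊔ lsup J = ⊤` in `resCls` is what gives `low`, since the restricted diagram
does not remember the top of `E`. For `prod`, both factors of `[0, ⋁ J]` must be nontrivial: the
first contains `ι F ≠ ⊥`, and the second follows from the same generating condition. -/
theorem respectsRel_resCls (hF : F ≠ ⊥) :
    RespectsRel fun Γ : ModularDiagram L => resCls F Γ.ext Γ.J where
  swap Γ l₁ l₂ a b h h' := by
    change resCls F Γ.ext Γ.J = -resCls F Γ.ext (l₁ ++ b :: a :: l₂)
    rw [h]
    exact resCls_alternating Γ.ext l₁ a b l₂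
  emb Γ Γ' φ hφ hrk hι hJ := by
    rw [hJ]
    exact (resCls_emb Γ.ext Γ'.ext hφ hrk hι Γ.J).symm
  low Γ h := resCls_of_not Γ.ext fun hc => h.ne hc.2
  prod Γ A B _ _ _ _ _ _ _ _ e he := by
    by_cases hc : F = trace Γ.ι (lsup Γ.J) ∧ Γ.ι ⊤ ⊔ lsup Γ.J = ⊤
    swap
    · exact resCls_of_not Γ.ext hc
    change resCls F Γ.ext Γ.J = 0
    rw [resCls_of Γ.ext hc.1 rfl hc.2]
    have h1 : (e (lsup Γ.J)).1 ≠ ⊥ := by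
      intro h1
      have h2 : e (Γ.ι F) ≤ e (lsup Γ.J) := e.monotone (Γ.ext.le_trace_iff.mp hc.1.le)
      have h3 : e (Γ.ι F) = ⊥ :=
        Prod.ext (le_bot_iff.mp (h1 ▸ h2.1)) (Γ.ext.snd_eq_bot e he F)
      rw [map_eq_bot_iff, ← Γ.ext.emb.map_bot] at h3
      exact hF (Γ.ext.emb.injective h3)
    have h2 : (e (lsup Γ.J)).2 ≠ ⊥ := by
      intro h2
      have h3 := congrArg (fun x => (e x).2) hc.2
      simp only [map_sup, map_top, Prod.snd_sup, h2, Prod.snd_top] at h3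
      rw [show (e (Γ.ι ⊤)).2 = ⊥ from he, sup_bot_eq] at h3
      exact bot_ne_top h3
    have := nontrivial_Iic h1
    have := nontrivial_Iic h2
    exact wcls_prod _ _ (iicProd e (lsup Γ.J)) (Subtype.ext (Γ.ext.snd_eq_bot e he F))
  two Γ G hG hFG hcard := by
    by_cases hJ : Γ.J.Nodup
    swap
    · exact (resCls_alternating Γ.ext).eq_zero_of_not_nodup hJ
    by_cases hc : F = trace Γ.ι (lsup Γ.J) ∧ Γ.ι ⊤ ⊔ lsup Γ.J = ⊤
    swap
    · exact resCls_of_not Γ.ext hc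
    change resCls F Γ.ext Γ.J = 0
    rw [resCls_of Γ.ext hc.1 rfl hc.2]
    obtain ⟨a, b, l, hp, ha, hb, hl⟩ := exists_perm_of_ncard_two hJ hcard
    have key : ∀ x ∈ Γ.J, toIic (lsup Γ.J) x ≤ ⟨lsup Γ.J ⊓ G, inf_le_left⟩ ↔ x ≤ G := by
      intro x hx
      rw [toIic_of_le (le_lsup hx)]
      exact (le_inf_iff : x ≤ lsup Γ.J ⊓ G ↔ _).trans (and_iff_right (le_lsup hx))
    refine wcls_two (Γ.ext.res hc.1) (hG.inf_Iic (lsup Γ.J)) ?_ (hp.map _)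
      ((key a (hp.mem_iff.mpr (by simp))).not.mpr ha)
      ((key b (hp.mem_iff.mpr (by simp))).not.mpr hb) fun y hy => ?_
    · exact le_inf (Γ.ext.le_trace_iff.mp hc.1.le)
        ((Γ.ext.emb.monotone le_top).trans hFG : Γ.ι F ≤ G)
    · obtain ⟨x, hx, rfl⟩ := List.mem_map.mp hy
      exact (key x (hp.mem_iff.mpr (by simp [hx]))).mpr (hl x hx)

/-! ### The two maps between `MD(L, F)` and `MD([0, F], 1)` -/

/-- The restriction map. -/
def IsRestriction (R : MD L →ₗ[ℚ] MD (Set.Iic F)) : Prop :=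
  ∀ Γ : ModularDiagram L, R Γ.cls = resCls F Γ.ext Γ.J

/-- The map induced by the amalgams with `L`. -/
def IsExtension (X : MD (Set.Iic F) →ₗ[ℚ] MD L) : Prop :=
  ∀ Γ : ModularDiagram (Set.Iic F),
    X Γ.cls = push (isIntervalEmb_coe_Iic F) isModExt_id [] [] Γ.ext Γ.J

theorem IsRestriction.wcls_eq {R : MD L →ₗ[ℚ] MD (Set.Iic F)} (hR : IsRestriction R)
    (h : IsModExt ι) {J : List E} (hJ : ∀ H ∈ J, IsAtom H) : R (wcls h J) = resCls F h J := by
  rw [wcls_of_atoms h hJ, hR]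

theorem IsExtension.wcls_eq {X : MD (Set.Iic F) →ₗ[ℚ] MD L} (hX : IsExtension X)
    {ι : Set.Iic F → E} (h : IsModExt ι) {J : List E} (hJ : ∀ H ∈ J, IsAtom H) :
    X (wcls h J) = push (isIntervalEmb_coe_Iic F) isModExt_id [] [] h J := by
  rw [wcls_of_atoms h hJ, hX]

theorem push_nil {ι : Set.Iic F → E} (h : IsModExt ι) (J : List E) :
    push (isIntervalEmb_coe_Iic F) isModExt_id [] [] h J =
      wcls (Amalg.isModExt_inl (isIntervalEmb_coe_Iic F) h)
        (J.map (Amalg.inr (isIntervalEmb_coe_Iic F) h)) := by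
  simp [push, pushWord]

theorem IsRestriction.mem_degPart {R : MD L →ₗ[ℚ] MD (Set.Iic F)} (hR : IsRestriction R) {k : ℤ}
    {x : MD L} (hx : x ∈ degPart L k) : R x ∈ degPart (Set.Iic F) k := by
  have key : degPart L k ≤ (degPart (Set.Iic F) k).comap R := by
    refine Submodule.span_le.mpr ?_
    rintro _ ⟨Γ, rfl, rfl⟩
    rw [SetLike.mem_coe, Submodule.mem_comap, hR]
    by_cases hc : F = trace Γ.ι (lsup Γ.J) ∧ Γ.ι ⊤ ⊔ lsup Γ.J = ⊤
    · rw [resCls_of Γ.ext hc.1 rfl hc.2]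
      have h1 := wcls_mem_degPart (Γ.ext.res hc.1) (Γ.J.map (toIic (lsup Γ.J)))
      convert h1 using 2
      have h2 : Γ.ι F = lsup Γ.J ⊓ Γ.ι ⊤ := by rw [← Γ.ext.map_trace, ← hc.1]
      rw [rk_Iic, rk_Iic, List.length_map]
      -- The new modular flat is `ι F = X ∧ F_ι` with `X = ⋁ J`, so the degree in its original form,
      -- with a meet, is unchanged.
      change (Γ.J.length : ℤ) - 2 * ((rk (lsup Γ.J) : ℤ) - rk (lsup Γ.J ⊓ Γ.ι ⊤)) =
        _ - 2 * ((rk (Γ.ι F ⊔ (lsup (Γ.J.map (toIic (lsup Γ.J))) : Set.Iic (lsup Γ.J)).1) : ℤ) -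
          rk (Γ.ι F))
      rw [coe_lsup_map_toIic fun x hx => le_lsup hx, h2, sup_eq_right.mpr inf_le_left]
    · rw [resCls_of_not Γ.ext hc]
      exact Submodule.zero_mem _
  exact key hx

theorem IsRestriction.mem_grPart {R : MD L →ₗ[ℚ] MD (Set.Iic F)} (hR : IsRestriction R)
    (x : MD L) : R x ∈ grPart (⊤ : Set.Iic F) := by
  have key : (grPart (⊤ : Set.Iic F)).comap R = ⊤ := by
    refine MD_eq_top fun Γ => ?_
    rw [Submodule.mem_comap, hR]
    by_cases hc : F = trace Γ.ι (lsup Γ.J) ∧ Γ.ι ⊤ ⊔ lsup Γ.J = ⊤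
    · rw [resCls_of Γ.ext hc.1 rfl hc.2]
      have h1 := wcls_mem_grPart (Γ.ext.res hc.1) (Γ.J.map (toIic (lsup Γ.J)))
      have h2 : lsup (Γ.J.map (toIic (lsup Γ.J))) = ⊤ :=
        Subtype.ext (coe_lsup_map_toIic fun x hx => le_lsup hx)
      rwa [h2, (Γ.ext.res hc.1).trace_top] at h1
    · rw [resCls_of_not Γ.ext hc]
      exact Submodule.zero_mem _
  exact Submodule.mem_comap.mp (key ▸ Submodule.mem_top)

theorem IsExtension.mem_degPart {X : MD (Set.Iic F) →ₗ[ℚ] MD L} (hX : IsExtension X) {k : ℤ}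
    {x : MD (Set.Iic F)} (hx : x ∈ degPart (Set.Iic F) k) : X x ∈ degPart L k := by
  have key : degPart (Set.Iic F) k ≤ (degPart L k).comap X := by
    refine Submodule.span_le.mpr ?_
    rintro _ ⟨Γ, rfl, rfl⟩
    have := IsGeometric.finite (L := Γ.E)
    rw [SetLike.mem_coe, Submodule.mem_comap, hX, push_nil]
    have h1 := wcls_mem_degPart (Amalg.isModExt_inl (isIntervalEmb_coe_Iic F) Γ.ext)
      (Γ.J.map (Amalg.inr (isIntervalEmb_coe_Iic F) Γ.ext))
    convert h1 using 2
    have h2 : Amalg.inl (isIntervalEmb_coe_Iic F) Γ.ext ⊤ =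
        Amalg.upper (isIntervalEmb_coe_Iic F) Γ.ext (Γ.ι ⊤) le_rfl :=
      Amalg.ext rfl (congrArg Γ.ι (isIntervalEmb_coe_Iic F).trace_top)
    have h3 : rk (Γ.ι ⊤) ≤ rk (Γ.ι ⊤ ⊔ lsup Γ.J) := rk_mono le_sup_left
    rw [(Amalg.isEmb_inr _ _).map_lsup, Amalg.rk_inl, h2, Amalg.rk_upper_sup, Γ.deg_eq,
      List.length_map]
    change _ = _ - 2 * (((rk (⊤ : L) + relRk Γ.ι (Γ.ι ⊤ ⊔ lsup Γ.J) : ℕ) : ℤ) - _)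
    rw [relRk, sup_comm _ (Γ.ι ⊤), ← sup_assoc, sup_idem]
    omega
  exact key hx

theorem IsExtension.mem_grPart {X : MD (Set.Iic F) →ₗ[ℚ] MD L} (hX : IsExtension X)
    {x : MD (Set.Iic F)} (hx : x ∈ grPart (⊤ : Set.Iic F)) : X x ∈ grPart F := by
  have key : grPart (⊤ : Set.Iic F) ≤ (grPart F).comap X := by
    refine Submodule.span_le.mpr ?_
    rintro _ ⟨Γ, hΓ, rfl⟩
    rw [SetLike.mem_coe, Submodule.mem_comap, hX, push_nil]
    have h1 := wcls_mem_grPart (Amalg.isModExt_inl (isIntervalEmb_coe_Iic F) Γ.ext)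
      (Γ.J.map (Amalg.inr (isIntervalEmb_coe_Iic F) Γ.ext))
    have h2 := Amalg.trace_eq (isIntervalEmb_coe_Iic F) Γ.ext isModExt_id
      (Amalg.inr (isIntervalEmb_coe_Iic F) Γ.ext (lsup Γ.J))
    rw [(Amalg.isEmb_inr _ _).map_lsup, h2, isModExt_id.trace_map] at h1
    change _ ∈ grPart ((Γ.gr : Set.Iic F) : L) at h1
    rwa [hΓ] at h1
  exact key hx

/-- Grading `⊤` means `F_ι ≤ ⋁ J`, so either the diagram vanishes by `low` or `⋁ J = ⊤`. In the
latter case `Amalg.inr` embeds `E` in the interval of the amalgam below the join of the letters,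
with equal rank, and `emb` applies. -/
theorem IsRestriction.apply_extension {R : MD L →ₗ[ℚ] MD (Set.Iic F)} (hR : IsRestriction R)
    {X : MD (Set.Iic F) →ₗ[ℚ] MD L} (hX : IsExtension X) {x : MD (Set.Iic F)}
    (hx : x ∈ grPart (⊤ : Set.Iic F)) : R (X x) = x := by
  refine LinearMap.eqOn_span (f := R ∘ₗ X) (g := LinearMap.id) ?_ hx
  rintro _ ⟨Γ, hΓ, rfl⟩
  change R (X Γ.cls) = Γ.cls
  rcases (le_top : Γ.ι ⊤ ⊔ lsup Γ.J ≤ ⊤).lt_or_eq with hlow | htop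
  · rw [respectsRel_cls.low Γ hlow, map_zero, map_zero]
  have hj := isIntervalEmb_coe_Iic F
  have hle : Γ.ι ⊤ ≤ lsup Γ.J := Γ.ext.le_trace_iff.mp hΓ.ge
  rw [sup_eq_right.mpr hle] at htop
  have hemb := Amalg.isEmb_inr hj Γ.ext
  have h1 : F = trace (Amalg.inl hj Γ.ext) (Amalg.inr hj Γ.ext ⊤) := by
    rw [Amalg.trace_eq hj Γ.ext isModExt_id, isModExt_id.trace_map]
    change F = ((trace Γ.ι ⊤ : Set.Iic F) : L)
    rw [Γ.ext.trace_top]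
    rfl
  have h2 : Amalg.inl hj Γ.ext ⊤ ⊔ Amalg.inr hj Γ.ext ⊤ = ⊤ :=
    Amalg.ext (top_le_iff.mp (Amalg.inl_le_iff.mp le_sup_left))
      (top_le_iff.mp (Amalg.inr_le_iff.mp le_sup_right))
  rw [hX, push_nil, hR.wcls_eq]
  swap
  · intro H hH
    obtain ⟨a, ha, rfl⟩ := List.mem_map.mp hH
    exact hemb.map_atom a (Γ.atoms a ha)
  rw [resCls_of _ h1 (by rw [hemb.map_lsup, htop]) h2, List.map_map, ← Γ.wcls_eq,
    ← wcls_emb Γ.ext ((Amalg.isModExt_inl hj Γ.ext).res h1)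
      (φ := fun y => ⟨Amalg.inr hj Γ.ext y, hemb.monotone le_top⟩) ?_ ?_ ?_]
  · congr 1
    exact List.map_congr_left fun y _ => toIic_of_le (hemb.monotone le_top)
  · refine ⟨fun x y hxy => hemb.injective (congrArg Subtype.val hxy), Subtype.ext hemb.map_bot,
      fun x y => Subtype.ext (hemb.map_sup x y), fun a ha => ?_⟩
    rw [← (isEmb_coe_Iic _).isAtom_iff]
    exact hemb.map_atom a ha
  · rw [rk_Iic]
    exact (hemb.rk_map ⊤).symm
  · intro z
    refine Subtype.ext (Amalg.ext ?_ ?_)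
    · exact congrArg Subtype.val (Γ.ext.trace_map z).symm
    · exact congrArg Γ.ι (hj.trace_map z)

/-- Unless the diagram vanishes by `low`, `ofRestrict` is an embedding of equal rank from the
amalgam of `L` and `[0, ⋁ J]` back to `E`, and it returns the original extension and word. -/
theorem IsExtension.apply_restriction {R : MD L →ₗ[ℚ] MD (Set.Iic F)} (hR : IsRestriction R)
    {X : MD (Set.Iic F) →ₗ[ℚ] MD L} (hX : IsExtension X) {x : MD L}
    (hx : x ∈ grPart F) : X (R x) = x := by
  refine LinearMap.eqOn_span (f := X ∘ₗ R) (g := LinearMap.id) ?_ hx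
  rintro _ ⟨Γ, hΓ, rfl⟩
  change X (R Γ.cls) = Γ.cls
  rcases (le_top : Γ.ι ⊤ ⊔ lsup Γ.J ≤ ⊤).lt_or_eq with hlow | htop
  · rw [respectsRel_cls.low Γ hlow, map_zero, map_zero]
  have hj := isIntervalEmb_coe_Iic F
  have hF : F = trace Γ.ι (lsup Γ.J) := hΓ.symm
  rw [hR, resCls_of Γ.ext hF rfl htop, hX.wcls_eq]
  swap
  · intro H hH
    obtain ⟨a, ha, rfl⟩ := List.mem_map.mp hH
    exact isAtom_toIic (Γ.atoms a ha) (le_lsup ha)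
  have hemb := isEmb_ofRestrict Γ.ext hj hF
  rw [push_nil, ← Γ.wcls_eq, ← wcls_emb (Amalg.isModExt_inl hj (Γ.ext.res hF)) Γ.ext hemb ?_
    fun z => (ofRestrict_inl Γ.ext hj hF z).symm, List.map_map, List.map_map]
  · congr 1
    refine (List.map_congr_left fun x hx => ?_).trans (List.map_id Γ.J)
    refine (ofRestrict_inr Γ.ext hj hF _).trans ?_
    rw [toIic_of_le (le_lsup hx)]
    rfl
  · rw [← hemb.rk_map]
    -- The top of the amalgam is sent to `ι ⊤ ⊔ lsup J`, which is the top by `htop`.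
    congr 1

/-! ### Compatibility with the differentials -/

/-- The two ways to restrict to an interval. -/
def iicIciEquiv {a X : E} (h : a ≤ X) :
    Set.Iic (⟨X, h⟩ : Set.Ici a) ≃o Set.Ici (toIic X a) where
  toFun x := ⟨⟨x.1.1, x.2⟩, (inf_le_left : a ⊓ X ≤ a).trans x.1.2⟩
  invFun x := ⟨⟨x.1.1, (inf_eq_left.mpr h).ge.trans x.2⟩, x.1.2⟩
  left_inv _ := rfl
  right_inv _ := rfl
  map_rel_iff' := Iff.rfl

/-- Contracting at `a` and restricting below `X` give the interval `[a, X]` in either order.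
Contractibility agrees too: inside `[0, X]`, the flat spanned by `ι F` and `l` is `X ⊓ (ι ⊤ ⊔ lsup
l)` by the modular law. -/
theorem IsRestriction.map_con {R : MD L →ₗ[ℚ] MD (Set.Iic F)} (hR : IsRestriction R)
    (h : IsModExt ι) {a : E} {l : List E} {X : E} (hX : F = trace ι X) (hal : X = lsup (a :: l))
    (htop : ι ⊤ ⊔ X = ⊤) (hat : ∀ x ∈ a :: l, IsAtom x) (hnd : a ∉ l) :
    R (con h a l) = con (h.res hX) (toIic X a) (l.map (toIic X)) := by
  have haX : a ≤ X := by rw [hal]; exact le_lsup (by simp)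
  have hlX : ∀ x ∈ l, x ≤ X := fun x hx => by rw [hal]; exact le_lsup (by simp [hx])
  have ha : IsAtom a := hat a (by simp)
  have hιF : ι F = X ⊓ ι ⊤ := by rw [← h.map_trace, ← hX]
  have h1 : (⟨a, haX⟩ : Set.Iic X) ≤ ⟨ι F, h.le_trace_iff.mp hX.le⟩ ↔ a ≤ ι ⊤ := by
    change a ≤ ι F ↔ _
    rw [hιF, le_inf_iff, and_iff_right haX]
  have h2 : (⟨a, haX⟩ : Set.Iic X) ≤ ⟨ι F, h.le_trace_iff.mp hX.le⟩ ⊔ lsup (l.map (toIic X)) ↔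
      a ≤ ι ⊤ ⊔ lsup l := by
    change a ≤ ι F ⊔ (lsup (l.map (toIic X)) : Set.Iic X).1 ↔ _
    rw [coe_lsup_map_toIic hlX, hιF, sup_comm, ← modular_law' h.modular (lsup_le_iff.mpr hlX),
      le_inf_iff, and_iff_right haX, sup_comm]
  have hiff : ((IsAtom (toIic X a) ∧ ¬ toIic X a ≤ ⟨ι F, h.le_trace_iff.mp hX.le⟩) ∧
      toIic X a ≤ ⟨ι F, h.le_trace_iff.mp hX.le⟩ ⊔ lsup (l.map (toIic X))) ↔
      (IsAtom a ∧ ¬ a ≤ ι ⊤) ∧ a ≤ ι ⊤ ⊔ lsup l := by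
    rw [and_iff_right (isAtom_toIic ha haX), and_iff_right ha, toIic_of_le haX, h1, h2]
  by_cases hc : (IsAtom a ∧ ¬ a ≤ ι ⊤) ∧ a ≤ ι ⊤ ⊔ lsup l
  swap
  · rw [con_of_not h hc, con_of_not (h.res hX) (hiff.not.mpr hc), map_zero]
  have hc' := hiff.mpr hc
  rw [con_of h ha hc.1.2 hc.2, con_of (h.res hX) hc'.1.1 hc'.1.2 hc'.2, hR.wcls_eq]
  swap
  · intro H hH
    obtain ⟨x, hx, rfl⟩ := List.mem_map.mp hH
    exact isAtom_toIci ha (hat x (by simp [hx])) fun he => hnd (he ▸ hx)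
  have h3 : toIci a (lsup l) = ⟨X, haX⟩ := Subtype.ext (hal.trans (lsup_cons a l)).symm
  have h4 := trace_contract h ha hc.1.2 (lsup l)
  rw [h3, ← lsup_cons, ← hal, ← hX] at h4
  have h5 : toIci a (ι ⊤) ⊔ (⟨X, haX⟩ : Set.Ici a) = ⊤ := by
    apply Subtype.ext
    change a ⊔ ι ⊤ ⊔ X = ⊤
    rw [sup_assoc, htop, sup_top_eq]
  rw [resCls_of (h.contract ha hc.1.2) h4.symm ((lsup_map_toIci a l).trans h3).symm h5,
    ← wcls_orderIso ((h.contract ha hc.1.2).res h4.symm)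
      ((h.res hX).contract hc'.1.1 hc'.1.2) (iicIciEquiv haX) ?_, List.map_map, List.map_map,
    List.map_map]
  · congr 1
    refine List.map_congr_left fun x hx => ?_
    apply Subtype.ext
    apply Subtype.ext
    change (a ⊔ x) ⊓ X = (a ⊓ X) ⊔ (x ⊓ X)
    rw [inf_eq_left.mpr haX, inf_eq_left.mpr (hlX x hx),
      inf_eq_left.mpr (sup_le haX (hlX x hx))]
  · intro z
    apply Subtype.ext
    apply Subtype.ext
    change (a ⊓ X) ⊔ ι z = a ⊔ ι z
    rw [inf_eq_left.mpr haX]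

/-- Restriction keeps the positions of the letters, so the alternating sums are compared term by
term through `map_con`. Diagrams that do not generate or have a repeated letter are zero on both
sides. -/
theorem IsRestriction.map_differential {R : MD L →ₗ[ℚ] MD (Set.Iic F)} (hR : IsRestriction R)
    {d : MD L →ₗ[ℚ] MD L} (hd : IsDifferential d)
    {dF : MD (Set.Iic F) →ₗ[ℚ] MD (Set.Iic F)} (hdF : IsDifferential dF) {x : MD L}
    (hx : x ∈ grPart F) : R (d x) = dF (R x) := by
  refine LinearMap.eqOn_span (f := R ∘ₗ d) (g := dF ∘ₗ R) ?_ hx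
  rintro _ ⟨Γ, hΓ, rfl⟩
  change R (d Γ.cls) = dF (R Γ.cls)
  rcases (le_top : Γ.ι ⊤ ⊔ lsup Γ.J ≤ ⊤).lt_or_eq with hlow | htop
  · rw [respectsRel_cls.low Γ hlow]
    simp only [map_zero]
  by_cases hJ : Γ.J.Nodup
  swap
  · rw [← Γ.wcls_eq, (wcls_alternating Γ.ext).eq_zero_of_not_nodup hJ]
    simp only [map_zero]
  have hF : F = trace Γ.ι (lsup Γ.J) := hΓ.symm
  rw [hd, ModularDiagram.dCls_eq, map_altSum, hR, resCls_of Γ.ext hF rfl htop, hdF.wcls_eq,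
    altSum_map]
  · refine altSum_congr fun a l hal => ?_
    exact hR.map_con Γ.ext hF (lsup_perm hal).symm htop
      (fun x hx => Γ.atoms x (hal.mem_iff.mp hx)) (List.nodup_cons.mp (hal.nodup_iff.mpr hJ)).1
  · intro H hH
    obtain ⟨a, ha, rfl⟩ := List.mem_map.mp hH
    exact isAtom_toIic (Γ.atoms a ha) (le_lsup ha)

/-- The isomorphism of `MD(L, F)` and `MD([0, F], 1)`. -/
theorem exists_grPart_equiv (hF : F ≠ ⊥) {d : MD L →ₗ[ℚ] MD L} (hd : IsDifferential d) :
    ∃ dF : MD (Set.Iic F) →ₗ[ℚ] MD (Set.Iic F),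
      IsDifferential dF ∧ IsSubcomplex dF (grPart (⊤ : Set.Iic F)) ∧
      ∃ e : grPart F ≃ₗ[ℚ] grPart (⊤ : Set.Iic F),
        (∀ (k : ℤ) (x : grPart F),
          (x : MD L) ∈ degPart L k ↔ (e x : MD (Set.Iic F)) ∈ degPart (Set.Iic F) k) ∧
        ∀ x y : grPart F, (y : MD L) = d x → (e y : MD (Set.Iic F)) = dF (e x) := by
  have := nontrivial_Iic hF
  obtain ⟨dF, hdF⟩ := exists_isDifferential (L := Set.Iic F)
  obtain ⟨R, hR⟩ := (respectsRel_resCls hF).exists_lift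
  obtain ⟨X, hX⟩ := (respectsRel_push (isIntervalEmb_coe_Iic F) isModExt_id [] []).exists_lift
  have hR : IsRestriction R := hR
  have hX : IsExtension X := hX
  refine ⟨dF, hdF, hdF.isSubcomplex _, LinearEquiv.ofLinearMap
    (R.restrict fun x _ => hR.mem_grPart x) (X.restrict fun x hx => hX.mem_grPart hx)
    (LinearMap.ext fun x => Subtype.ext (hR.apply_extension hX x.2))
    (LinearMap.ext fun x => Subtype.ext (hX.apply_restriction hR x.2)), fun k x => ?_,
    fun x y hxy => ?_⟩
  · change (x : MD L) ∈ degPart L k ↔ R x ∈ degPart (Set.Iic F) k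
    -- Degrees are preserved in the other direction because `x` is recovered from `R x` by the
    -- extension map, which also has degree zero.
    refine ⟨hR.mem_degPart, fun h => ?_⟩
    rw [← hX.apply_restriction hR x.2]
    exact hX.mem_degPart h
  · change R y = dF (R x)
    rw [hxy, hR.map_differential hd hdF x.2]

end RestrictionMap

end GeomLat

theorem mainTheorem7 {L : Type u} [Lattice L] [BoundedOrder L] [GeomLat.IsGeometric L]
    [Nontrivial L] [DecidableEq L] :
    ∃ (d : GeomLat.MD L →ₗ[ℚ] GeomLat.MD L)
      (mul : GeomLat.MD L →ₗ[ℚ] GeomLat.MD L →ₗ[ℚ] GeomLat.MD L),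
      GeomLat.IsDifferential d ∧
      GeomLat.IsProduct mul ∧
      -- `MD L` is a dg-complex
      DirectSum.IsInternal (GeomLat.degPart L) ∧
      (∀ k : ℤ, ∀ x ∈ GeomLat.degPart L k, d x ∈ GeomLat.degPart L (k + 1)) ∧
      (∀ x, d (d x) = 0) ∧
      -- it is the direct sum of the subcomplexes `MD(L, F)`
      (∀ F : L, GeomLat.IsSubcomplex d (GeomLat.grPart F)) ∧
      DirectSum.IsInternal (fun F : L => GeomLat.grPart F) ∧
      -- the product is compatible with the decomposition
      (∀ F₁ F₂ : L, ∀ x ∈ GeomLat.grPart F₁, ∀ y ∈ GeomLat.grPart F₂,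
        mul x y ∈ GeomLat.grPart (F₁ ⊔ F₂)) ∧
      -- `MD(L, F)` is isomorphic to `MD([0, F], 1)` as a dg-complex
      (∀ F : L, F ≠ ⊥ →
        ∃ dF : GeomLat.MD (Set.Iic F) →ₗ[ℚ] GeomLat.MD (Set.Iic F),
          GeomLat.IsDifferential dF ∧
          GeomLat.IsSubcomplex dF (GeomLat.grPart (⊤ : Set.Iic F)) ∧
          ∃ e : GeomLat.grPart F ≃ₗ[ℚ] GeomLat.grPart (⊤ : Set.Iic F),
            (∀ (k : ℤ) (x : GeomLat.grPart F),
              (x : GeomLat.MD L) ∈ GeomLat.degPart L k ↔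
                (e x : GeomLat.MD (Set.Iic F)) ∈ GeomLat.degPart (Set.Iic F) k) ∧
            ∀ x y : GeomLat.grPart F, (y : GeomLat.MD L) = d x →
              (e y : GeomLat.MD (Set.Iic F)) = dF (e x)) := by
  obtain ⟨d, hd⟩ := GeomLat.exists_isDifferential (L := L)
  obtain ⟨m, hm⟩ := GeomLat.exists_isProduct (L := L)
  exact ⟨d, m, hd, hm, GeomLat.isGrading_deg.isInternal, fun k x hx => hd.map_degPart hx,
    hd.sq_eq_zero, hd.isSubcomplex, GeomLat.isGrading_gr.isInternal,
    fun F₁ F₂ x hx y hy => hm.mem_grPart hx hy, fun F hF => GeomLat.exists_grPart_equiv hF hd⟩
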